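/- Let $\mathbb{T}=\mathbb{R}/2\pi\mathbb{Z}$ and let $a:\mathbb{T}\to\mathbb{R}$ be smooth and nonnegative, with $a>0$ on some nonempty open set. All functions are real-valued. For $f=\sum_n c_n e^{inx}$ put $\|f\|_s^2=\sum_{n\in\mathbb{Z}}|c_n|^2(1+n^2)^s$, and let $[f]=(2\pi)^{-1}\int_{\mathbb{T}}f\,dx$. Consider $$u_t-u_{xxt}+u_x+uu_x-(a(x)u_x)_x=0,\qquad u(\cdot,0)=u_0\qquad(\ast)$$ on $\mathbb{T}$, understood in the sense of distributions. 1. (Local well-posedness.) Let $s\ge 0$. For every $\rho>0$ there is $T>0$ such that for every $u_0\in H^s(\mathbb{T})$ with $\|u_0\|_s\le\rho$ there is a unique solution $u\in C([0,T],H^s(\mathbb{T}))$ of $(\ast)$, and the map $u_0\mapsto u\in C([0,T],H^s(\mathbb{T}))$ is Lipschitz continuous on the ball $\{\|u_0\|_s\le\rho\}$. 2. (Global solutions and dissipation for $s=1$.) If $s=1$, then in part 1 every $T>0$ is allowed (for every $\rho$); in particular the solution exists for all $t\ge0$. Moreover $t\mapsto\|u(t)-[u_0]\|_1$ and $t\mapsto\|u(t)\|_1$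 are nonincreasing, and for all $t\ge 0$ $$\tfrac12\|u(t)\|_1^2-\tfrac12\|u_0\|_1^2+\frac1{2\pi}\int_0^t\!\!\int_{\mathbb{T}}a(x)|u_x(x,\tau)|^2\,dx\,d\tau=0.$$ 3. (Asymptotics.) Let $\delta\in(0,\infty]$ and suppose that the following unique continuation property holds: whenever $v_0\in H^1(\mathbb{T})$, $\|v_0\|_1<\delta$, and the solution $v$ of the BBM equation $v_t-v_{xxt}+v_x+vv_x=0$ on $\mathbb{T}$ with $v(\cdot,0)=v_0$ satisfies $v=C$ on $\omega'\times(0,T)$ for some nonempty open set $\omega'\subset\mathbb{T}$, some $T>0$ and some constant $C$, then $v_0\equiv C$. Then for every $u_0\in H^1(\mathbb{T})$ with $\|u_0\|_1<\delta$ the solution $u$ of $(\ast)$ satisfies, as $t\to\infty$, $u(t)\to[u_0]$ weakly in $H^1(\mathbb{T})$ and strongly in $H^s(\mathbb{T})$ for every $s<1$. -/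

import Mathlib

open MeasureTheory Filter Topology
open scoped ENNReal NNReal ComplexConjugate

namespace BBM

noncomputable section

/-- The one-dimensional torus `ℝ / 2πℤ`. -/
abbrev Torus : Type := AddCircle (2 * Real.pi)

/-- A helper instance: the period is positive. -/
instance factTwoPiPos : Fact (0 < 2 * Real.pi) := ⟨Real.two_pi_pos⟩

/-- Real-valued square-integrable functions on the torus (Lebesgue measure of total mass `2π`). -/
abbrev L2T : Type := Lp ℝ 2 (volume : Measure Torus)

/-- The Fourier coefficient `c_n = (2π)⁻¹ ∫ f(x) e^{-inx} dx`, so that `f = ∑ c_n e^{inx}`. -/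
def coeff (f : L2T) (n : ℤ) : ℂ := fourierCoeff (fun x : Torus => ((f x : ℝ) : ℂ)) n

/-- The `H^s` norm `(∑ |c_n|² (1 + n²)^s)^{1/2}`, with the value `∞` if the series diverges. -/
def sobNorm (s : ℝ) (f : L2T) : ℝ≥0∞ :=
  (∑' n : ℤ, ENNReal.ofReal (‖coeff f n‖ ^ 2 * (1 + (n : ℝ) ^ 2) ^ s)) ^ (1 / 2 : ℝ)

/-- Membership in `H^s` of the torus (for `s ≥ 0` every element of `H^s` is in `L²`). -/
def MemSob (s : ℝ) (f : L2T) : Prop := sobNorm s f < ∞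

/-- The inner product of `H^s`; the series converges absolutely if both functions are in `H^s`. -/
def sobInner (s : ℝ) (f g : L2T) : ℝ :=
  ∑' n : ℤ, (1 + (n : ℝ) ^ 2) ^ s * (coeff f n * conj (coeff g n)).re

/-- The constant function `c` on the torus. -/
def constFn (c : ℝ) : L2T := Lp.const 2 (volume : Measure Torus) c

/-- The mean value `[f] = (2π)⁻¹ ∫ f(x) dx`. -/
def mean (f : L2T) : ℝ := (2 * Real.pi)⁻¹ * ∫ x : Torus, f x

/-- Smooth functions on the torus, written as smooth `2π`-periodic functions on the line. -/
def SmoothPeriodic (φ : ℝ → ℝ) : Prop :=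
  ContDiff ℝ ((⊤ : ℕ∞) : WithTop ℕ∞) φ ∧ Function.Periodic φ (2 * Real.pi)

/-- `g` is the weak derivative of `f` on the torus. -/
def IsWeakDeriv (f g : L2T) : Prop :=
  ∀ φ : ℝ → ℝ, SmoothPeriodic φ →
    ∫ x in (0 : ℝ)..(2 * Real.pi), f (x : Torus) * deriv φ x =
      -∫ x in (0 : ℝ)..(2 * Real.pi), g (x : Torus) * φ x

/-- `u ∈ C([0,T], H^s)`. -/
def ContInSob (s T : ℝ) (u : ℝ → L2T) : Prop :=
  (∀ t ∈ Set.Icc 0 T, MemSob s (u t)) ∧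
  ∀ t₀ ∈ Set.Icc 0 T, Tendsto (fun t => sobNorm s (u t - u t₀)) (𝓝[Set.Icc 0 T] t₀) (𝓝 0)

/-- `u ∈ C([0,T], H^s)` solves, in the sense of distributions,
`u_t - u_xxt + u_x + u u_x - (a(x) u_x)_x = 0` on the torus, with `u(0) = u₀`:
the equation is tested against smooth functions of `x` and integrated in time from `0` to `t`.
For `a = 0` this is the BBM equation. -/
def IsSolution (a : ℝ → ℝ) (s T : ℝ) (u₀ : L2T) (u : ℝ → L2T) : Prop :=
  ContInSob s T u ∧ u 0 = u₀ ∧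
  ∀ φ : ℝ → ℝ, SmoothPeriodic φ → ∀ t ∈ Set.Icc 0 T,
    ∫ x in (0 : ℝ)..(2 * Real.pi), u t (x : Torus) * (φ x - deriv (deriv φ) x) =
      (∫ x in (0 : ℝ)..(2 * Real.pi), u₀ (x : Torus) * (φ x - deriv (deriv φ) x)) +
      ∫ τ in (0 : ℝ)..t, ∫ x in (0 : ℝ)..(2 * Real.pi),
        ((u τ (x : Torus) + u τ (x : Torus) ^ 2 / 2) * deriv φ x +
          u τ (x : Torus) * deriv (fun y => a y * deriv φ y) x)

/-- On `[0,T]`, every initial state in the ball of radius `ρ` of `H^s` has exactly one solution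
in `C([0,T], H^s)`, and the map from initial states in this ball to solutions
in `C([0,T], H^s)` is Lipschitz continuous. -/
def WellPosedOnBall (a : ℝ → ℝ) (s : ℝ) (ρ : ℝ≥0) (T : ℝ) : Prop :=
  (∀ u₀ : L2T, sobNorm s u₀ ≤ ρ → ∃ u, IsSolution a s T u₀ u) ∧
  (∀ u₀ : L2T, sobNorm s u₀ ≤ ρ → ∀ u v, IsSolution a s T u₀ u → IsSolution a s T u₀ v →
    Set.EqOn u v (Set.Icc 0 T)) ∧
  ∃ K : ℝ≥0, ∀ u₀ v₀ : L2T, sobNorm s u₀ ≤ ρ → sobNorm s v₀ ≤ ρ →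
    ∀ u v, IsSolution a s T u₀ u → IsSolution a s T v₀ v →
      ∀ t ∈ Set.Icc 0 T, sobNorm s (u t - v t) ≤ K * sobNorm s (u₀ - v₀)

/-- Unique continuation for the (undamped) BBM equation, for initial states of `H^1` norm less
than `δ`: a solution that is constant on `ω × (0,T)`, for some nonempty open set `ω` and some
`T > 0`, starts from that constant. The value `δ = ∞` means that no smallness is required. -/
def UCPConst (δ : ℝ≥0∞) : Prop :=
  ∀ v₀ : L2T, MemSob 1 v₀ → sobNorm 1 v₀ < δ →
    ∀ (ω : Set Torus) (T C : ℝ) (v : ℝ → L2T), IsOpen ω → ω.Nonempty → 0 < T →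
      IsSolution (fun _ => 0) 1 T v₀ v →
      (∀ t ∈ Set.Ioo 0 T, ∀ᵐ x : Torus, x ∈ ω → v t x = C) →
      v₀ = constFn C

/-- Weak convergence in the Hilbert space `H^1` as `t → ∞`. -/
def TendstoWeakH1 (u : ℝ → L2T) (w : L2T) : Prop :=
  ∀ g : L2T, MemSob 1 g → Tendsto (fun t => sobInner 1 (u t) g) atTop (𝓝 (sobInner 1 w g))

end

end BBM

/-!
The proof is carried out in frequency space. A real function in `H^s` is written as
`(1 - ∂ₓ²)^{-s/2} x` with `x` in `L²` (`smoothing`), and the equation, solved for `u_t`, becomes an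
ordinary differential equation `x' = field s α x` in the Hilbert space `L²`, where `α` is the
sequence of Fourier coefficients of `a`. The vector field is a bounded linear map plus a bounded
quadratic one: the quadratic term gains a derivative, and `∑ (1 + n²)⁻¹ < ∞` together with
`(1 + n²)^{s/2} ≤ C (1 + k²)^{s/2} (1 + (n - k)²)^{s/2}` gives the bilinear estimate for all `s ≥ 0`
(`quadOp`), while the damping term has a kernel dominated by a summable convolution kernel because
`a` is smooth (`dampOp`, Schur's test). `isSolution_iff` identifies distributional solutions with
integral curves of this field; it rests on `inner_field`, Parseval's identity for the spatial terms
of the weak formulation. Local existence, uniqueness and Lipschitz dependence are then the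
Picard–Lindelöf theorem for a field truncated by a radial retraction, and Gronwall's inequality.

For `s = 1` one has `⟪x, x'⟫ = -∫ a uₓ²` (`inner_field_one`). The dispersive term is skew, and
`∫ u² uₓ = 0` since the Leibniz rule for Fourier coefficients and one integration by parts turn this
integral into `-2` times itself (`fourierCoeff_deriv_mul_sq`). The same sign holds for the truncated
field, so that the truncation is never felt and solutions are global.

For the asymptotics, let `u (tᵢ)` converge weakly in `H¹` to `v₀`. The embedding into `L²` is
compact (`tendsto_sobNorm_smoothing_one`), so by Gronwall's inequality in `L²` the translates
`u (tᵢ + ·)` converge to the solution `v` with data `v₀`. The dissipation over `[tᵢ, tᵢ + 1]` tends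
to zero as the energy converges, and by the Cauchy–Schwarz inequality for the nonnegative form
`∫ a uₓ wₓ` the damping operator annihilates `v`. Hence `v` solves the undamped equation and `vₓ = 0`
where `a > 0`; testing against a bump shows that the value of `v` on an arc there does not depend
on time. Unique continuation gives that `v₀` is a constant, necessarily the conserved mean value
(`weak_limit_const`). As every subsequence has such a limit, all Fourier coefficients converge,
and boundedness in `H¹` upgrades this to weak convergence in `H¹` and strong convergence in `H^s`,
`s < 1`.
-/

open MeasureTheory Filter Topology
open scoped ENNReal NNReal ComplexConjugate InnerProductSpace

namespace BBM

noncomputable section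

/-! ### Fourier coefficients of square-integrable functions -/

/-- The normalised Haar measure of the torus. -/
abbrev haarT : Measure Torus := AddCircle.haarAddCircle

theorem memLp_ofReal_haar (f : L2T) : MemLp (fun x => ((f x : ℝ) : ℂ)) 2 haarT :=
  memLp_haarAddCircle_iff.2 (Lp.memLp f).ofReal

theorem integrable_haar_of_volume {E : Type*} [NormedAddCommGroup E] {f : Torus → E}
    (hf : Integrable f volume) : Integrable f haarT := by
  rw [AddCircle.volume_eq_smul_haarAddCircle] at hf
  exact (integrable_smul_measure (by simp [Real.pi_pos]) ENNReal.ofReal_ne_top).1 hf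

theorem fourier_two_pi_coe (n : ℤ) (x : ℝ) :
    fourier n (x : Torus) = Complex.exp (Complex.I * n * x) := by
  rw [fourier_coe_apply]
  congr 1
  have : (Real.pi : ℂ) ≠ 0 := by exact_mod_cast Real.pi_ne_zero
  push_cast
  field_simp

theorem memLp_fourier_mul {F : Torus → ℂ} (hF : MemLp F 2 haarT) (n : ℤ) :
    MemLp (fun x => fourier n x * F x) 2 haarT := by
  refine hF.of_le_mul (c := 1) ?_ (Eventually.of_forall fun x => ?_)
  · exact (map_continuous (fourier n)).aestronglyMeasurable.mul hF.1
  · rw [norm_mul, fourier_apply, Circle.norm_coe]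

/-- The Fourier coefficients of a product of square-integrable functions are the convolution of
the Fourier coefficients (Parseval's identity for `conj F` and `e^{-inx} G`). -/
theorem hasSum_fourierCoeff_mul {F G : Torus → ℂ} (hF : MemLp F 2 haarT) (hG : MemLp G 2 haarT)
    (n : ℤ) :
    HasSum (fun k => fourierCoeff F k * fourierCoeff G (n - k))
      (fourierCoeff (fun x => F x * G x) n) := by
  have hF' : MemLp (fun x => conj (F x)) 2 haarT := hF.star
  have hG' := memLp_fourier_mul hG (-n)
  have key := (fourierBasis (T := 2 * Real.pi)).hasSum_inner_mul_inner (hF'.toLp _) (hG'.toLp _)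
  have h1 : ∀ k : ℤ, inner ℂ (hF'.toLp _) ((fourierBasis (T := 2 * Real.pi)) k)
      = fourierCoeff F (-k) := by
    intro k
    rw [MeasureTheory.L2.inner_def, fourierCoeff]
    apply integral_congr_ae
    have := coeFn_fourierLp (T := 2 * Real.pi) 2 k
    filter_upwards [hF'.coeFn_toLp, this] with x hx hx2
    rw [coe_fourierBasis, hx2, hx]
    simp [-fourier_apply]
  have h2 : ∀ k : ℤ, inner ℂ ((fourierBasis (T := 2 * Real.pi)) k) (hG'.toLp _)
      = fourierCoeff G (n + k) := by
    intro k
    rw [MeasureTheory.L2.inner_def, fourierCoeff]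
    apply integral_congr_ae
    have := coeFn_fourierLp (T := 2 * Real.pi) 2 k
    filter_upwards [hG'.coeFn_toLp, this] with x hx hx2
    rw [coe_fourierBasis, hx2, hx]
    have : (-(n + k)) = -n + -k := by ring
    rw [this, fourier_add, fourier_neg (n := k)]
    simp [-fourier_apply]
    ring
  have h3 : inner ℂ (hF'.toLp _) (hG'.toLp _) = fourierCoeff (fun x => F x * G x) n := by
    rw [MeasureTheory.L2.inner_def, fourierCoeff]
    apply integral_congr_ae
    filter_upwards [hG'.coeFn_toLp, hF'.coeFn_toLp] with x hx hx2
    rw [hx, hx2]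
    simp [-fourier_apply]
    ring
  rw [h3] at key
  have := (Equiv.neg ℤ).hasSum_iff.2 key
  refine this.congr_fun fun k => ?_
  rw [Function.comp, h1, h2, Equiv.neg_apply, neg_neg, sub_eq_add_neg]

theorem norm_fourierCoeff_le {F : Torus → ℂ} (n : ℤ) :
    ‖fourierCoeff F n‖ ≤ ∫ x, ‖F x‖ ∂haarT := by
  refine (norm_integral_le_integral_norm _).trans_eq ?_
  congr 1; ext x
  rw [norm_smul, fourier_apply, Circle.norm_coe, one_mul]

theorem integrable_ofReal_haar (f : L2T) : Integrable (fun x => ((f x : ℝ) : ℂ)) haarT :=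
  (memLp_ofReal_haar f).integrable one_le_two

theorem ae_haar_of_volume {p : Torus → Prop} (h : ∀ᵐ x, p x) : ∀ᵐ x ∂haarT, p x := by
  rw [AddCircle.volume_eq_smul_haarAddCircle] at h
  exact (Measure.ae_ennreal_smul_measure_iff (by simp [Real.pi_pos])).1 h

theorem coeff_add (f g : L2T) (n : ℤ) : coeff (f + g) n = coeff f n + coeff g n := by
  have := congrFun (fourierCoeff.add (integrable_ofReal_haar f) (integrable_ofReal_haar g)) n
  rw [Pi.add_apply] at this
  rw [coeff, coeff, coeff, ← this]
  refine congrFun (fourierCoeff_congr_ae ?_) n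
  filter_upwards [ae_haar_of_volume (Lp.coeFn_add f g)] with x hx
  rw [hx]
  simp

theorem coeff_congr_ae (f : L2T) {F : Torus → ℂ} (h : ∀ᵐ x, ((f x : ℝ) : ℂ) = F x) (n : ℤ) :
    coeff f n = fourierCoeff F n :=
  congrFun (fourierCoeff_congr_ae (ae_haar_of_volume h)) n

theorem coeff_smul (r : ℝ) (f : L2T) (n : ℤ) : coeff (r • f) n = r * coeff f n := by
  rw [coeff_congr_ae (r • f) (F := fun x => (r : ℂ) * (f x : ℂ)), fourierCoeff.const_mul, coeff]
  filter_upwards [Lp.coeFn_smul r f] with x hx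
  simp [hx]

theorem coeff_neg_index (f : L2T) (n : ℤ) : coeff f (-n) = conj (coeff f n) := by
  rw [coeff, coeff, fourierCoeff, fourierCoeff, ← integral_conj]
  congr 1; ext x
  rw [neg_neg, fourier_neg]
  simp [-fourier_apply]

theorem inner_eq_integral (f g : L2T) : ⟪f, g⟫_ℝ = ∫ x : Torus, f x * g x := by
  rw [MeasureTheory.L2.inner_def]
  congr 1; ext x
  simp [mul_comm]

/-- Parseval's identity. -/
theorem hasSum_coeff_mul_conj (f g : L2T) :
    HasSum (fun n => coeff f n * conj (coeff g n)) (((2 * Real.pi)⁻¹ * ⟪f, g⟫_ℝ : ℝ) : ℂ) := by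
  have := hasSum_fourierCoeff_mul (memLp_ofReal_haar f) (memLp_ofReal_haar g) 0
  convert this using 1
  · ext n
    rw [zero_sub, ← coeff_neg_index]; rfl
  · rw [fourierCoeff, AddCircle.integral_haarAddCircle, inner_eq_integral]
    simp only [neg_zero, fourier_zero, one_smul]
    rw [Complex.ofReal_mul, ← integral_complex_ofReal]
    simp

theorem hasSum_sq_norm_coeff (f : L2T) :
    HasSum (fun n => ‖coeff f n‖ ^ 2) ((2 * Real.pi)⁻¹ * ‖f‖ ^ 2) := by
  have := hasSum_coeff_mul_conj f f
  rw [real_inner_self_eq_norm_sq] at this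
  refine Complex.hasSum_ofReal.1 ?_
  convert this using 2 with n
  rw [Complex.mul_conj, Complex.normSq_eq_norm_sq]

theorem norm_sq_eq_tsum (f : L2T) : ‖f‖ ^ 2 = 2 * Real.pi * ∑' n, ‖coeff f n‖ ^ 2 := by
  rw [(hasSum_sq_norm_coeff f).tsum_eq, mul_inv_cancel_left₀ (by positivity)]

theorem hasSum_inner (f g : L2T) :
    HasSum (fun n => (coeff f n * conj (coeff g n)).re) ((2 * Real.pi)⁻¹ * ⟪f, g⟫_ℝ) := by
  simpa using Complex.hasSum_re (hasSum_coeff_mul_conj f g)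

theorem coeff_sub (f g : L2T) (n : ℤ) : coeff (f - g) n = coeff f n - coeff g n := by
  rw [sub_eq_add_neg, coeff_add, ← neg_one_smul ℝ g, coeff_smul]; simp [sub_eq_add_neg]

theorem ext_coeff {f g : L2T} (h : ∀ n, coeff f n = coeff g n) : f = g := by
  have := norm_sq_eq_tsum (f - g)
  simp only [coeff_sub, h, sub_self, norm_zero] at this
  simpa [sub_eq_zero] using this

theorem norm_coeff_le (f : L2T) (n : ℤ) : ‖coeff f n‖ ≤ ‖f‖ := by
  have h1 := le_hasSum (hasSum_sq_norm_coeff f) n (fun _ _ => by positivity)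
  have h2 : (2 * Real.pi)⁻¹ ≤ 1 := inv_le_one_of_one_le₀ (by linarith [Real.pi_gt_three])
  refine abs_le_of_sq_le_sq' (h1.trans ?_) (norm_nonneg _) |>.2
  nlinarith [sq_nonneg ‖f‖]

/-- The `n`-th Fourier coefficient as a continuous linear functional. -/
def coeffL (n : ℤ) : L2T →L[ℝ] ℂ :=
  LinearMap.mkContinuous
    { toFun := fun f => coeff f n
      map_add' := fun f g => coeff_add f g n
      map_smul' := fun r f => by simpa using coeff_smul r f n } 1
    (fun f => by simpa using norm_coeff_le f n)

@[simp] theorem coeffL_apply (n : ℤ) (f : L2T) : coeffL n f = coeff f n := rfl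

/-- The Riesz–Fischer theorem for real-valued functions: every Hermitian square-summable sequence
is the sequence of Fourier coefficients of a real square-integrable function. -/
theorem exists_coeff_eq {c : ℤ → ℂ} (hc : ∀ n, c (-n) = conj (c n))
    (hs : Summable fun n => ‖c n‖ ^ 2) : ∃ f : L2T, ∀ n, coeff f n = c n := by
  have hmem : Memℓp c 2 := by
    refine memℓp_gen ?_
    simpa using hs
  let F : Lp ℂ 2 haarT := (fourierBasis (T := 2 * Real.pi)).repr.symm ⟨c, hmem⟩
  have hF : ∀ n, fourierCoeff F n = c n := by
    intro n
    rw [← fourierBasis_repr]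
    simp [F]
  have hFm : MemLp F 2 haarT := Lp.memLp F
  have hre : MemLp (fun x => (F x).re) 2 (volume : Measure Torus) :=
    (memLp_haarAddCircle_iff.1 hFm).re
  refine ⟨hre.toLp _, fun n => ?_⟩
  rw [coeff_congr_ae (F := fun x => (2⁻¹ : ℂ) * (F x + conj (F x)))]
  · have hadd := fourierCoeff.add (f := F) (g := fun x => conj (F x)) (hFm.integrable one_le_two)
      (MemLp.integrable (q := 2) one_le_two hFm.star)
    rw [fourierCoeff.const_mul]
    have h2 : fourierCoeff (fun x => F x + conj (F x)) n
        = c n + fourierCoeff (fun x => conj (F x)) n := by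
      rw [← hF]; exact congrFun hadd n
    have h3 : fourierCoeff (fun x => conj (F x)) n = conj (c (-n)) := by
      rw [← hF, fourierCoeff, fourierCoeff, ← integral_conj]
      congr 1; ext x
      rw [neg_neg, fourier_neg]
      simp [-fourier_apply]
    rw [h2, h3, hc]
    simp
    ring
  · filter_upwards [hre.coeFn_toLp] with x hx
    rw [hx, Complex.re_eq_add_conj]
    ring

/-! ### Operators given by their action on Fourier coefficients -/

theorem summable_mul_and_sq_tsum_le {ι : Type*} {f g : ι → ℝ} (hf : ∀ i, 0 ≤ f i)
    (hg : ∀ i, 0 ≤ g i) (hf2 : Summable fun i => f i ^ 2) (hg2 : Summable fun i => g i ^ 2) :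
    (Summable fun i => f i * g i) ∧
      (∑' i, f i * g i) ^ 2 ≤ (∑' i, f i ^ 2) * ∑' i, g i ^ 2 := by
  have h2 : (2 : ℝ).HolderConjugate 2 := Real.HolderConjugate.two_two
  have := Real.summable_and_inner_le_Lp_mul_Lq_tsum_of_nonneg h2 hf hg
    (by simpa using hf2) (by simpa using hg2)
  refine ⟨this.1, ?_⟩
  have h3 := this.2
  simp only [Real.rpow_two, ← Real.sqrt_eq_rpow] at h3
  have h0 : 0 ≤ ∑' i, f i * g i := tsum_nonneg fun i => mul_nonneg (hf i) (hg i)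
  calc _ ≤ (√(∑' i, f i ^ 2) * √(∑' i, g i ^ 2)) ^ 2 := by gcongr
    _ = _ := by
      rw [mul_pow, Real.sq_sqrt (tsum_nonneg fun i => sq_nonneg _),
        Real.sq_sqrt (tsum_nonneg fun i => sq_nonneg _)]

theorem summable_sq_norm_coeff (f : L2T) : Summable fun n => ‖coeff f n‖ ^ 2 :=
  (hasSum_sq_norm_coeff f).summable

theorem norm_le_of_tsum_le {f : L2T} {C : ℝ} (hC : 0 ≤ C)
    (h : ∑' n, ‖coeff f n‖ ^ 2 ≤ (2 * Real.pi)⁻¹ * C ^ 2) : ‖f‖ ≤ C := by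
  rw [(hasSum_sq_norm_coeff f).tsum_eq] at h
  exact abs_le_of_sq_le_sq' (le_of_mul_le_mul_left h (by positivity)) hC |>.2

/-- A linear rule for Fourier coefficients which is bounded in `ℓ²` and respects the Hermitian
symmetry defines a bounded operator. -/
theorem exists_clm_coeff (T : L2T → ℤ → ℂ) (hadd : ∀ f g n, T (f + g) n = T f n + T g n)
    (hsmul : ∀ (r : ℝ) f n, T (r • f) n = r * T f n) (hherm : ∀ f n, T f (-n) = conj (T f n))
    {C : ℝ} (hC : 0 ≤ C) (hs : ∀ f, Summable fun n => ‖T f n‖ ^ 2)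
    (hb : ∀ f, ∑' n, ‖T f n‖ ^ 2 ≤ C ^ 2 * ∑' n, ‖coeff f n‖ ^ 2) :
    ∃ A : L2T →L[ℝ] L2T, ∀ f n, coeff (A f) n = T f n := by
  choose A hA using fun f => exists_coeff_eq (hherm f) (hs f)
  refine ⟨LinearMap.mkContinuous
    { toFun := A
      map_add' := fun f g => ext_coeff fun n => by rw [hA, hadd, coeff_add, hA, hA]
      map_smul' := fun r f => ext_coeff fun n => by
        rw [hA, hsmul, RingHom.id_apply, coeff_smul, hA] } C (fun f => ?_), fun f n => hA f n⟩
  refine norm_le_of_tsum_le (by positivity) ?_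
  simp only [LinearMap.coe_mk, AddHom.coe_mk, hA]
  refine (hb f).trans_eq ?_
  rw [(hasSum_sq_norm_coeff f).tsum_eq]
  ring

/-- The Hermitian symmetry of the Fourier coefficients of a real-valued function. -/
def Herm (m : ℤ → ℂ) : Prop := ∀ n, m (-n) = conj (m n)

theorem exists_multiplier {m : ℤ → ℂ} (hm : Herm m) {C : ℝ} (hb : ∀ n, ‖m n‖ ≤ C) :
    ∃ A : L2T →L[ℝ] L2T, ∀ f n, coeff (A f) n = m n * coeff f n := by
  have hC : 0 ≤ C := (norm_nonneg _).trans (hb 0)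
  have hle : ∀ f n, ‖m n * coeff f n‖ ^ 2 ≤ C ^ 2 * ‖coeff f n‖ ^ 2 := fun f n => by
    rw [norm_mul, mul_pow]; gcongr; exact hb n
  have hs : ∀ f, Summable fun n => ‖m n * coeff f n‖ ^ 2 := fun f =>
    Summable.of_nonneg_of_le (fun n => sq_nonneg _) (hle f)
      ((summable_sq_norm_coeff f).mul_left _)
  refine exists_clm_coeff (fun f n => m n * coeff f n) (fun f g n => ?_) (fun r f n => ?_)
    (fun f n => ?_) hC hs (fun f => ?_)
  · rw [coeff_add, mul_add]
  · rw [coeff_smul]; ring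
  · rw [hm, coeff_neg_index, map_mul]
  · rw [← tsum_mul_left]
    exact (hs f).tsum_le_tsum (hle f) ((summable_sq_norm_coeff f).mul_left _)

/-- The Fourier multiplier with symbol `m` (the zero operator if the symbol does not define a
bounded operator on real-valued functions). -/
def mult (m : ℤ → ℂ) : L2T →L[ℝ] L2T :=
  open Classical in
  if h : ∃ A : L2T →L[ℝ] L2T, ∀ f n, coeff (A f) n = m n * coeff f n then h.choose else 0

theorem coeff_mult {m : ℤ → ℂ} (hm : Herm m) {C : ℝ} (hb : ∀ n, ‖m n‖ ≤ C) (f : L2T) (n : ℤ) :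
    coeff (mult m f) n = m n * coeff f n := by
  have h := exists_multiplier hm hb
  rw [mult, dif_pos h]
  exact h.choose_spec f n

/-- Schur's test for a kernel dominated by a summable convolution kernel. -/
theorem kernel_bound {K : ℤ → ℤ → ℂ} {β : ℤ → ℝ} (hβ : Summable β)
    (hK : ∀ n k, ‖K n k‖ ≤ β (n - k)) (f : L2T) :
    (∀ n, Summable fun k => K n k * coeff f k) ∧
    (Summable fun n => ‖∑' k, K n k * coeff f k‖ ^ 2) ∧
      ∑' n, ‖∑' k, K n k * coeff f k‖ ^ 2 ≤ (∑' j, β j) ^ 2 * ∑' k, ‖coeff f k‖ ^ 2 := by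
  have hβ0 : ∀ j, 0 ≤ β j := fun j => by
    have := (norm_nonneg _).trans (hK j 0); simpa using this
  set y : ℤ → ℝ := fun k => ‖coeff f k‖ ^ 2 with hy
  have hys : Summable y := summable_sq_norm_coeff f
  let e : ℤ × ℤ ≃ ℤ × ℤ :=
    { toFun := fun p => (p.1 - p.2, p.2)
      invFun := fun p => (p.1 + p.2, p.2)
      left_inv := fun p => by simp
      right_inv := fun p => by simp }
  have h1 : Summable fun p : ℤ × ℤ => β p.1 * y p.2 :=
    hβ.mul_of_nonneg hys hβ0 (fun k => sq_nonneg _)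
  have h2 : Summable fun p : ℤ × ℤ => β (p.1 - p.2) * y p.2 := e.summable_iff.2 h1
  have h3 : ∑' n, ∑' k, β (n - k) * y k = (∑' j, β j) * ∑' k, y k := by
    rw [hβ.tsum_mul_tsum hys h1, ← e.tsum_eq, ← h2.tsum_prod]
    rfl
  have hβn : ∀ n, Summable fun k => β (n - k) := fun n => (Equiv.subLeft n).summable_iff.2 hβ
  have hβt : ∀ n, ∑' k, β (n - k) = ∑' j, β j := fun n => (Equiv.subLeft n).tsum_eq β
  have hcs := fun n => summable_mul_and_sq_tsum_le (f := fun k => √(β (n - k)))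
    (g := fun k => √(β (n - k)) * ‖coeff f k‖) (fun k => Real.sqrt_nonneg _)
    (fun k => by positivity)
    (by simpa only [Real.sq_sqrt (hβ0 _)] using hβn n)
    (by simpa only [mul_pow, Real.sq_sqrt (hβ0 _)] using h2.prod_factor n)
  simp only [mul_pow, Real.sq_sqrt (hβ0 _), ← mul_assoc, Real.mul_self_sqrt (hβ0 _), hβt] at hcs
  have hle : ∀ n k, ‖K n k * coeff f k‖ ≤ β (n - k) * ‖coeff f k‖ := fun n k => by
    rw [norm_mul]; gcongr; exact hK n k
  have hsn : ∀ n, Summable fun k => ‖K n k * coeff f k‖ := fun n =>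
    Summable.of_nonneg_of_le (fun k => norm_nonneg _) (hle n) (hcs n).1
  have hb : ∀ n, ‖∑' k, K n k * coeff f k‖ ^ 2 ≤ (∑' j, β j) * ∑' k, β (n - k) * y k := by
    intro n
    refine le_trans ?_ (hcs n).2
    gcongr
    exact (norm_tsum_le_tsum_norm (hsn n)).trans ((hsn n).tsum_le_tsum (hle n) (hcs n).1)
  have hs2 : Summable fun n => (∑' j, β j) * ∑' k, β (n - k) * y k := h2.prod.mul_left _
  have hs3 := Summable.of_nonneg_of_le (fun n => sq_nonneg _) hb hs2
  refine ⟨fun n => (hsn n).of_norm, hs3, (hs3.tsum_le_tsum hb hs2).trans_eq ?_⟩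
  rw [tsum_mul_left, h3]
  ring

theorem exists_kernelOp {K : ℤ → ℤ → ℂ} (hKh : ∀ n k, K (-n) (-k) = conj (K n k)) {β : ℤ → ℝ}
    (hβ : Summable β) (hK : ∀ n k, ‖K n k‖ ≤ β (n - k)) :
    ∃ A : L2T →L[ℝ] L2T, ∀ f n, coeff (A f) n = ∑' k, K n k * coeff f k := by
  have hβ0 : ∀ j, 0 ≤ β j := fun j => by
    have := (norm_nonneg _).trans (hK j 0); simpa using this
  refine exists_clm_coeff (fun f n => ∑' k, K n k * coeff f k) (fun f g n => ?_)
    (fun r f n => ?_) (fun f n => ?_) (tsum_nonneg hβ0)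
    (fun f => (kernel_bound hβ hK f).2.1) (fun f => (kernel_bound hβ hK f).2.2)
  · rw [← ((kernel_bound hβ hK f).1 n).tsum_add ((kernel_bound hβ hK g).1 n)]
    simp only [coeff_add, mul_add]
  · rw [← tsum_mul_left]
    simp only [coeff_smul]
    congr 1; ext k; ring
  · rw [Complex.conj_tsum, ← (Equiv.neg ℤ).tsum_eq]
    simp only [Equiv.neg_apply, hKh, coeff_neg_index, map_mul]

/-- The operator `f ↦ g` with `ĝ(n) = ∑ₖ K n k f̂(k)` (zero if the kernel does not define a bounded
operator on real-valued functions). -/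
def kernelOp (K : ℤ → ℤ → ℂ) : L2T →L[ℝ] L2T :=
  open Classical in
  if h : ∃ A : L2T →L[ℝ] L2T, ∀ f n, coeff (A f) n = ∑' k, K n k * coeff f k then h.choose else 0

theorem coeff_kernelOp {K : ℤ → ℤ → ℂ} (hKh : ∀ n k, K (-n) (-k) = conj (K n k)) {β : ℤ → ℝ}
    (hβ : Summable β) (hK : ∀ n k, ‖K n k‖ ≤ β (n - k)) (f : L2T) (n : ℤ) :
    coeff (kernelOp K f) n = ∑' k, K n k * coeff f k := by
  have h := exists_kernelOp hKh hβ hK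
  rw [kernelOp, dif_pos h]
  exact h.choose_spec f n

theorem bilin_bound {K : ℤ → ℤ → ℂ} {κ : ℤ → ℝ} (hK : ∀ n k, ‖K n k‖ ≤ κ n) (f g : L2T) (n : ℤ) :
    (Summable fun k => K n k * coeff f k * coeff g (n - k)) ∧
      ‖∑' k, K n k * coeff f k * coeff g (n - k)‖ ≤ κ n * ((2 * Real.pi)⁻¹ * (‖f‖ * ‖g‖)) := by
  have hκ : 0 ≤ κ n := (norm_nonneg _).trans (hK n 0)
  have hg := (Equiv.subLeft n).summable_iff.2 (summable_sq_norm_coeff g)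
  have hcs := summable_mul_and_sq_tsum_le (fun k => norm_nonneg (coeff f k))
    (fun k => norm_nonneg (coeff g (n - k))) (summable_sq_norm_coeff f) hg
  have hgt := (Equiv.subLeft n).tsum_eq fun k => ‖coeff g k‖ ^ 2
  simp only [Equiv.subLeft_apply] at hgt
  rw [hgt, (hasSum_sq_norm_coeff f).tsum_eq, (hasSum_sq_norm_coeff g).tsum_eq] at hcs
  have h1 : ∑' k, ‖coeff f k‖ * ‖coeff g (n - k)‖ ≤ (2 * Real.pi)⁻¹ * (‖f‖ * ‖g‖) := by
    refine abs_le_of_sq_le_sq' (hcs.2.trans_eq (by ring)) (by positivity) |>.2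
  have hle : ∀ k, ‖K n k * coeff f k * coeff g (n - k)‖
      ≤ κ n * (‖coeff f k‖ * ‖coeff g (n - k)‖) := fun k => by
    rw [norm_mul, norm_mul, mul_assoc]; gcongr; exact hK n k
  have hs : Summable fun k => ‖K n k * coeff f k * coeff g (n - k)‖ :=
    Summable.of_nonneg_of_le (fun k => norm_nonneg _) hle (hcs.1.mul_left _)
  refine ⟨hs.of_norm, (norm_tsum_le_tsum_norm hs).trans ?_⟩
  refine (hs.tsum_le_tsum hle (hcs.1.mul_left _)).trans ?_
  rw [tsum_mul_left]
  gcongr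

theorem exists_kernelBilin {K : ℤ → ℤ → ℂ} (hKh : ∀ n k, K (-n) (-k) = conj (K n k)) {κ : ℤ → ℝ}
    (hκ : Summable fun n => κ n ^ 2) (hK : ∀ n k, ‖K n k‖ ≤ κ n) :
    ∃ Q : L2T →L[ℝ] L2T →L[ℝ] L2T, ∀ f g n,
      coeff (Q f g) n = ∑' k, K n k * coeff f k * coeff g (n - k) := by
  have hb := fun f g => bilin_bound hK f g
  have hb2 : ∀ f g n, ‖∑' k, K n k * coeff f k * coeff g (n - k)‖ ^ 2
      ≤ κ n ^ 2 * ((2 * Real.pi)⁻¹ * (‖f‖ * ‖g‖)) ^ 2 := fun f g n => by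
    rw [← mul_pow]; gcongr; exact (hb f g n).2
  have hs := fun f g : L2T => Summable.of_nonneg_of_le (fun n => sq_nonneg _) (hb2 f g)
    (hκ.mul_right _)
  have hherm : ∀ (f g : L2T) (n : ℤ), ∑' k, K (-n) k * coeff f k * coeff g (-n - k)
      = conj (∑' k, K n k * coeff f k * coeff g (n - k)) := fun f g n => by
    rw [Complex.conj_tsum, ← (Equiv.neg ℤ).tsum_eq]
    congr 1; ext k
    have : -n - -k = -(n - k) := by ring
    simp only [Equiv.neg_apply, hKh, coeff_neg_index, map_mul, this]
  choose Q hQ using fun f g => exists_coeff_eq (hherm f g) (hs f g)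
  let B : L2T →ₗ[ℝ] L2T →ₗ[ℝ] L2T := LinearMap.mk₂ ℝ Q
    (fun f f' g => ext_coeff fun n => by
      rw [coeff_add, hQ, hQ, hQ, ← (hb f g n).1.tsum_add (hb f' g n).1]
      congr 1; ext k; rw [coeff_add]; ring)
    (fun r f g => ext_coeff fun n => by
      rw [coeff_smul, hQ, hQ, ← tsum_mul_left]
      congr 1; ext k; rw [coeff_smul]; ring)
    (fun f g g' => ext_coeff fun n => by
      rw [coeff_add, hQ, hQ, hQ, ← (hb f g n).1.tsum_add (hb f g' n).1]
      congr 1; ext k; rw [coeff_add]; ring)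
    (fun r f g => ext_coeff fun n => by
      rw [coeff_smul, hQ, hQ, ← tsum_mul_left]
      congr 1; ext k; rw [coeff_smul]; ring)
  refine ⟨LinearMap.mkContinuous₂ B (√(∑' n, κ n ^ 2)) fun f g => ?_, fun f g n => hQ f g n⟩
  refine norm_le_of_tsum_le (by positivity) ?_
  have h0 : 0 ≤ ∑' n, κ n ^ 2 := tsum_nonneg fun n => sq_nonneg _
  have hle := (hs f g).tsum_le_tsum (hb2 f g) (hκ.mul_right _)
  rw [tsum_mul_right] at hle
  simp only [B, LinearMap.mk₂_apply, hQ]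
  refine hle.trans ?_
  rw [mul_assoc (√_), mul_pow (√_), Real.sq_sqrt h0, mul_pow (2 * Real.pi)⁻¹]
  have h2 : (2 * Real.pi)⁻¹ ≤ 1 := inv_le_one_of_one_le₀ (by linarith [Real.pi_gt_three])
  have h3 : (0 : ℝ) ≤ (2 * Real.pi)⁻¹ := by positivity
  have h4 : ((2 * Real.pi)⁻¹) ^ 2 ≤ (2 * Real.pi)⁻¹ := by nlinarith
  calc _ = ((2 * Real.pi)⁻¹) ^ 2 * ((∑' n, κ n ^ 2) * (‖f‖ * ‖g‖) ^ 2) := by ring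
    _ ≤ _ := by gcongr

/-- The bilinear operator `(f, g) ↦ h` with `ĥ(n) = ∑ₖ K n k f̂(k) ĝ(n - k)` (zero if the kernel
does not define a bounded operator on real-valued functions). -/
def kernelBilin (K : ℤ → ℤ → ℂ) : L2T →L[ℝ] L2T →L[ℝ] L2T :=
  open Classical in
  if h : ∃ Q : L2T →L[ℝ] L2T →L[ℝ] L2T, ∀ f g n,
      coeff (Q f g) n = ∑' k, K n k * coeff f k * coeff g (n - k) then h.choose else 0

theorem coeff_kernelBilin {K : ℤ → ℤ → ℂ} (hKh : ∀ n k, K (-n) (-k) = conj (K n k)) {κ : ℤ → ℝ}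
    (hκ : Summable fun n => κ n ^ 2) (hK : ∀ n k, ‖K n k‖ ≤ κ n) (f g : L2T) (n : ℤ) :
    coeff (kernelBilin K f g) n = ∑' k, K n k * coeff f k * coeff g (n - k) := by
  have h := exists_kernelBilin hKh hκ hK
  rw [kernelBilin, dif_pos h]
  exact h.choose_spec f g n

/-! ### Sobolev weights and the vector field of the damped equation -/

/-- The symbol `1 + n²` of `1 - ∂ₓ²`. -/
def jap (n : ℤ) : ℝ := 1 + (n : ℝ) ^ 2

theorem one_le_jap (n : ℤ) : 1 ≤ jap n := by unfold jap; nlinarith [sq_nonneg (n : ℝ)]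

theorem jap_pos (n : ℤ) : 0 < jap n := zero_lt_one.trans_le (one_le_jap n)

theorem jap_neg (n : ℤ) : jap (-n) = jap n := by simp [jap]

theorem jap_le (n k : ℤ) : jap n ≤ 2 * jap (n - k) * jap k := by
  unfold jap
  push_cast
  nlinarith [sq_nonneg ((n : ℝ) - 2 * k), sq_nonneg (((n : ℝ) - k) * k)]

theorem abs_le_jap_rpow (n : ℤ) : |(n : ℝ)| ≤ jap n ^ (1 / 2 : ℝ) := by
  rw [← Real.sqrt_eq_rpow, ← Real.sqrt_sq_eq_abs]
  exact Real.sqrt_le_sqrt (by unfold jap; linarith)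

theorem summable_inv_jap : Summable fun n => (jap n)⁻¹ := by
  have h1 : Summable fun n : ℤ => 1 / (n : ℝ) ^ 2 := Real.summable_one_div_int_pow.2 one_lt_two
  refine Summable.of_norm_bounded_eventually h1 ?_
  filter_upwards [(Set.finite_singleton (0 : ℤ)).compl_mem_cofinite] with n hn
  have hn' : (n : ℝ) ≠ 0 := by exact_mod_cast hn
  rw [Real.norm_of_nonneg (inv_nonneg.2 (jap_pos n).le), one_div]
  unfold jap
  gcongr
  linarith

/-- The symbol `(1 + n²)^{s/2}` of `(1 - ∂ₓ²)^{s/2}`. -/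
def wt (s : ℝ) (n : ℤ) : ℝ := jap n ^ (s / 2)

theorem wt_pos (s : ℝ) (n : ℤ) : 0 < wt s n := Real.rpow_pos_of_pos (jap_pos n) _

theorem wt_ne (s : ℝ) (n : ℤ) : (wt s n : ℂ) ≠ 0 := by exact_mod_cast (wt_pos s n).ne'

theorem wt_neg (s : ℝ) (n : ℤ) : wt s (-n) = wt s n := by rw [wt, jap_neg, wt]

theorem wt_zero (n : ℤ) : wt 0 n = 1 := by simp [wt]

theorem one_le_wt {s : ℝ} (hs : 0 ≤ s) (n : ℤ) : 1 ≤ wt s n :=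
  Real.one_le_rpow (one_le_jap n) (by positivity)

theorem wt_sq (s : ℝ) (n : ℤ) : wt s n ^ 2 = jap n ^ s := by
  rw [wt, ← Real.rpow_natCast, ← Real.rpow_mul (jap_pos n).le]
  congr 1
  push_cast
  ring

theorem wt_le {s : ℝ} (hs : 0 ≤ s) (n k : ℤ) :
    wt s n ≤ (2 : ℝ) ^ (s / 2) * (wt s k * wt s (n - k)) := by
  unfold wt
  have h1 := (jap_pos k).le
  have h2 := (jap_pos (n - k)).le
  rw [← Real.mul_rpow h1 h2, ← Real.mul_rpow zero_le_two (by positivity)]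
  exact Real.rpow_le_rpow (jap_pos n).le ((jap_le n k).trans_eq (by ring)) (by positivity)

theorem jap_rpow_div_le (p : ℝ) (n k : ℤ) :
    jap n ^ p * jap k ^ (-p) ≤ (2 * jap (n - k)) ^ |p| := by
  have hn := jap_pos n
  have hk := jap_pos k
  rcases le_total 0 p with hp | hp
  · rw [abs_of_nonneg hp, Real.rpow_neg hk.le, ← div_eq_mul_inv, ← Real.div_rpow hn.le hk.le]
    refine Real.rpow_le_rpow (by positivity) ?_ hp
    rw [div_le_iff₀ hk]
    exact jap_le n k
  · rw [abs_of_nonpos hp, mul_comm]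
    nth_rw 2 [← neg_neg p]
    rw [Real.rpow_neg hn.le, ← div_eq_mul_inv, ← Real.div_rpow hk.le hn.le]
    refine Real.rpow_le_rpow (by positivity) ?_ (by linarith)
    rw [div_le_iff₀ hn, ← jap_neg (n - k), neg_sub]
    exact jap_le k n

/-- The operator `(1 - ∂ₓ²)^{-s/2}`, an isomorphism from `L²` onto `H^s`. -/
def smoothing (s : ℝ) : L2T →L[ℝ] L2T := mult fun n => ((wt s n)⁻¹ : ℝ)

theorem coeff_smoothing {s : ℝ} (hs : 0 ≤ s) (x : L2T) (n : ℤ) :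
    coeff (smoothing s x) n = (wt s n : ℂ)⁻¹ * coeff x n := by
  rw [smoothing, coeff_mult (C := 1)]
  · push_cast; rfl
  · intro n
    simp [wt_neg]
  · intro n
    rw [Complex.norm_real, Real.norm_of_nonneg (inv_nonneg.2 (wt_pos s n).le)]
    exact inv_le_one_of_one_le₀ (one_le_wt hs n)

theorem wt_mul_coeff_smoothing {s : ℝ} (hs : 0 ≤ s) (x : L2T) (n : ℤ) :
    wt s n * coeff (smoothing s x) n = coeff x n := by
  rw [coeff_smoothing hs, mul_inv_cancel_left₀ (wt_ne s n)]

theorem smoothing_injective {s : ℝ} (hs : 0 ≤ s) : Function.Injective (smoothing s) := by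
  intro x y h
  refine ext_coeff fun n => ?_
  rw [← wt_mul_coeff_smoothing hs x, ← wt_mul_coeff_smoothing hs y, h]

theorem smoothing_zero (x : L2T) : smoothing 0 x = x :=
  ext_coeff fun n => by rw [coeff_smoothing le_rfl, wt_zero]; simp

/-- The normalisation factor between the `L²` norm and the `ℓ²` norm of the coefficients. -/
def nrm : ℝ := √((2 * Real.pi)⁻¹)

theorem nrm_pos : 0 < nrm := Real.sqrt_pos.2 (by positivity)

theorem nrm_sq : nrm ^ 2 = (2 * Real.pi)⁻¹ := Real.sq_sqrt (by positivity)

theorem wt_sq_mul {s : ℝ} (f : L2T) (n : ℤ) :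
    ‖coeff f n‖ ^ 2 * (1 + (n : ℝ) ^ 2) ^ s = ‖(wt s n : ℂ) * coeff f n‖ ^ 2 := by
  rw [norm_mul, mul_pow, Complex.norm_real, Real.norm_of_nonneg (wt_pos s n).le, wt_sq, mul_comm]
  rfl

theorem sobNorm_smoothing {s : ℝ} (hs : 0 ≤ s) (x : L2T) :
    sobNorm s (smoothing s x) = ENNReal.ofReal (nrm * ‖x‖) := by
  have h : ∑' n : ℤ, ENNReal.ofReal (‖coeff (smoothing s x) n‖ ^ 2 * (1 + (n : ℝ) ^ 2) ^ s)
      = ENNReal.ofReal ((nrm * ‖x‖) ^ 2) := by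
    simp only [wt_sq_mul, wt_mul_coeff_smoothing hs]
    rw [← ENNReal.ofReal_tsum_of_nonneg (fun n => sq_nonneg _) (summable_sq_norm_coeff x),
      (hasSum_sq_norm_coeff x).tsum_eq, mul_pow, nrm_sq]
  have h0 : 0 ≤ nrm * ‖x‖ := mul_nonneg nrm_pos.le (norm_nonneg x)
  rw [sobNorm, h, ENNReal.ofReal_rpow_of_nonneg (sq_nonneg _) (by norm_num),
    ← Real.sqrt_eq_rpow, Real.sqrt_sq h0]

theorem exists_smoothing_eq {s : ℝ} (hs : 0 ≤ s) {f : L2T} (hf : MemSob s f) :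
    ∃ x, smoothing s x = f := by
  have h1 : ∑' n : ℤ, ENNReal.ofReal (‖coeff f n‖ ^ 2 * (1 + (n : ℝ) ^ 2) ^ s) ≠ ∞ := by
    intro h
    rw [MemSob, sobNorm, h] at hf
    simp at hf
  simp only [wt_sq_mul] at h1
  have h2 : Summable fun n => ‖(wt s n : ℂ) * coeff f n‖ ^ 2 := by
    have := ENNReal.summable_toReal h1
    simpa only [ENNReal.toReal_ofReal (sq_nonneg _)] using this
  obtain ⟨x, hx⟩ := exists_coeff_eq (c := fun n => (wt s n : ℂ) * coeff f n)
    (fun n => by rw [wt_neg, coeff_neg_index, map_mul, Complex.conj_ofReal]) h2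
  refine ⟨x, ext_coeff fun n => ?_⟩
  rw [coeff_smoothing hs, hx, inv_mul_cancel_left₀ (wt_ne s n)]

theorem memSob_smoothing {s : ℝ} (hs : 0 ≤ s) (x : L2T) : MemSob s (smoothing s x) := by
  rw [MemSob, sobNorm_smoothing hs]; exact ENNReal.ofReal_lt_top

/-- A sequence decaying faster than every power. -/
def RapidDecay (c : ℤ → ℂ) : Prop := ∀ p : ℝ, Summable fun j => jap j ^ p * ‖c j‖

/-- The symbol `-in / (1 + n²)` of `-(1 - ∂ₓ²)⁻¹ ∂ₓ`. -/
def dispSym (n : ℤ) : ℂ := -(Complex.I * n) / (jap n : ℂ)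

theorem dispSym_neg (n : ℤ) : dispSym (-n) = conj (dispSym n) := by
  simp [dispSym, jap_neg]

theorem norm_dispSym_le (n : ℤ) : ‖dispSym n‖ ≤ jap n ^ (-(1 / 2) : ℝ) := by
  rw [dispSym, norm_div, norm_neg, norm_mul, Complex.norm_I, one_mul, Complex.norm_intCast,
    Complex.norm_real, Real.norm_of_nonneg (jap_pos n).le, div_le_iff₀ (jap_pos n)]
  nth_rw 2 [← Real.rpow_one (jap n)]
  rw [← Real.rpow_add (jap_pos n)]
  exact (abs_le_jap_rpow n).trans_eq (by norm_num)

theorem norm_dispSym_le_one (n : ℤ) : ‖dispSym n‖ ≤ 1 :=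
  (norm_dispSym_le n).trans (Real.rpow_le_one_of_one_le_of_nonpos (one_le_jap n) (by norm_num))

/-- The operator `-(1 - ∂ₓ²)⁻¹ ∂ₓ`, which commutes with `(1 - ∂ₓ²)^{s/2}`. -/
def dispOp : L2T →L[ℝ] L2T := mult dispSym

theorem coeff_dispOp (x : L2T) (n : ℤ) : coeff (dispOp x) n = dispSym n * coeff x n :=
  coeff_mult dispSym_neg norm_dispSym_le_one x n

/-- The kernel of the damping operator `-(1 - ∂ₓ²)⁻¹ ∂ₓ (a ∂ₓ ·)`, for `a` with Fourier
coefficients `α`, conjugated with `(1 - ∂ₓ²)^{s/2}`. -/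
def dampKer (s : ℝ) (α : ℤ → ℂ) (n k : ℤ) : ℂ :=
  (wt s n : ℂ) * (n / (jap n : ℂ)) * k * α (n - k) * (wt s k : ℂ)⁻¹

theorem dampKer_neg (s : ℝ) {α : ℤ → ℂ} (hα : Herm α) (n k : ℤ) :
    dampKer s α (-n) (-k) = conj (dampKer s α n k) := by
  have : -n - -k = -(n - k) := by ring
  simp only [dampKer, wt_neg, jap_neg, this, hα (n - k)]
  simp
  ring

theorem norm_dampKer_le (s : ℝ) (α : ℤ → ℂ) (n k : ℤ) :
    ‖dampKer s α n k‖ ≤ (2 * jap (n - k)) ^ |(s - 1) / 2| * ‖α (n - k)‖ := by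
  have hn := jap_pos n
  have hk := jap_pos k
  have h1 : wt s n * (|(n : ℝ)| / jap n) ≤ jap n ^ ((s - 1) / 2) := by
    rw [← mul_div_assoc, div_le_iff₀ hn]
    calc wt s n * |(n : ℝ)| ≤ wt s n * jap n ^ (1 / 2 : ℝ) := by
          have := (wt_pos s n).le
          gcongr; exact abs_le_jap_rpow n
      _ = jap n ^ ((s - 1) / 2) * jap n ^ (1 : ℝ) := by
          rw [wt, ← Real.rpow_add hn, ← Real.rpow_add hn]; congr 1; ring
      _ = _ := by rw [Real.rpow_one]
  have h2 : |(k : ℝ)| * (wt s k)⁻¹ ≤ jap k ^ (-((s - 1) / 2)) := by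
    rw [wt, ← Real.rpow_neg hk.le]
    calc |(k : ℝ)| * jap k ^ (-(s / 2)) ≤ jap k ^ (1 / 2 : ℝ) * jap k ^ (-(s / 2)) := by
          gcongr; exact abs_le_jap_rpow k
      _ = _ := by rw [← Real.rpow_add hk]; congr 1; ring
  have h3 : ‖dampKer s α n k‖
      = (wt s n * (|(n : ℝ)| / jap n)) * (|(k : ℝ)| * (wt s k)⁻¹) * ‖α (n - k)‖ := by
    simp only [dampKer, norm_mul, norm_div, norm_inv, Complex.norm_real, Complex.norm_intCast,
      Real.norm_of_nonneg hn.le, Real.norm_of_nonneg (wt_pos _ _).le]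
    ring
  rw [h3]
  gcongr
  refine le_trans ?_ (jap_rpow_div_le _ n k)
  have := (wt_pos s k).le
  gcongr

/-- The damping operator `-(1 - ∂ₓ²)⁻¹ ∂ₓ (a ∂ₓ ·)`, conjugated with `(1 - ∂ₓ²)^{s/2}`. -/
def dampOp (s : ℝ) (α : ℤ → ℂ) : L2T →L[ℝ] L2T := kernelOp (dampKer s α)

theorem coeff_dampOp (s : ℝ) {α : ℤ → ℂ} (hα : Herm α) (hd : RapidDecay α) (x : L2T) (n : ℤ) :
    coeff (dampOp s α x) n = ∑' k, dampKer s α n k * coeff x k := by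
  refine coeff_kernelOp (β := fun j => (2 * jap j) ^ |(s - 1) / 2| * ‖α j‖)
    (fun n k => dampKer_neg s hα n k) ?_ (norm_dampKer_le s α) x n
  refine ((hd |(s - 1) / 2|).mul_left ((2 : ℝ) ^ |(s - 1) / 2|)).congr fun j => ?_
  rw [Real.mul_rpow zero_le_two (jap_pos j).le]
  ring

/-- The kernel of `(u, v) ↦ -½ (1 - ∂ₓ²)⁻¹ ∂ₓ (u v)`, conjugated with `(1 - ∂ₓ²)^{s/2}`. -/
def quadKer (s : ℝ) (n k : ℤ) : ℂ :=
  (wt s n : ℂ) * (dispSym n / 2) * (wt s k : ℂ)⁻¹ * (wt s (n - k) : ℂ)⁻¹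

theorem quadKer_neg (s : ℝ) (n k : ℤ) : quadKer s (-n) (-k) = conj (quadKer s n k) := by
  have : -n - -k = -(n - k) := by ring
  simp only [quadKer, this, wt_neg, dispSym_neg]
  simp [Complex.conj_ofNat]

theorem norm_quadKer_le {s : ℝ} (hs : 0 ≤ s) (n k : ℤ) :
    ‖quadKer s n k‖ ≤ (2 : ℝ) ^ (s / 2) * jap n ^ (-(1 / 2) : ℝ) := by
  have hk := wt_pos s k
  have hnk := wt_pos s (n - k)
  have h1 : wt s n * ((wt s k)⁻¹ * (wt s (n - k))⁻¹) ≤ (2 : ℝ) ^ (s / 2) := by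
    rw [← mul_inv, ← div_eq_mul_inv, div_le_iff₀ (by positivity)]
    exact wt_le hs n k
  have h2 : ‖quadKer s n k‖
      = (wt s n * ((wt s k)⁻¹ * (wt s (n - k))⁻¹)) * (‖dispSym n‖ / 2) := by
    simp only [quadKer, norm_mul, norm_div, norm_inv, Complex.norm_real, Complex.norm_ofNat,
      Real.norm_of_nonneg (wt_pos _ _).le]
    ring
  rw [h2]
  gcongr
  linarith [norm_dispSym_le n, norm_nonneg (dispSym n)]

/-- The bilinear map `(u, v) ↦ -½ (1 - ∂ₓ²)⁻¹ ∂ₓ (u v)`, conjugated with `(1 - ∂ₓ²)^{s/2}`.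
It gains one derivative, so that by the Cauchy–Schwarz inequality in frequency space it is bounded
for every `s ≥ 0`. -/
def quadOp (s : ℝ) : L2T →L[ℝ] L2T →L[ℝ] L2T := kernelBilin (quadKer s)

theorem coeff_quadOp {s : ℝ} (hs : 0 ≤ s) (x y : L2T) (n : ℤ) :
    coeff (quadOp s x y) n = ∑' k, quadKer s n k * coeff x k * coeff y (n - k) := by
  refine coeff_kernelBilin (quadKer_neg s) ?_ (norm_quadKer_le hs) x y n
  refine (summable_inv_jap.mul_left (((2 : ℝ) ^ (s / 2)) ^ 2)).congr fun n => ?_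
  rw [mul_pow, ← Real.rpow_natCast (jap n ^ _), ← Real.rpow_mul (jap_pos n).le]
  norm_num [Real.rpow_neg_one]

/-- The right-hand side of the damped equation, solved for the time derivative and conjugated with
`(1 - ∂ₓ²)^{s/2}`; the numbers `α n` are the Fourier coefficients of the damping coefficient. -/
def field (s : ℝ) (α : ℤ → ℂ) (x : L2T) : L2T := dispOp x + quadOp s x x - dampOp s α x

theorem smoothing_field {s : ℝ} (hs : 0 ≤ s) {α : ℤ → ℂ} (hα : Herm α) (hd : RapidDecay α)
    (x : L2T) : smoothing s (field s α x) = field 0 α (smoothing s x) := by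
  refine ext_coeff fun n => ?_
  simp only [coeff_smoothing hs, field, coeff_sub, coeff_add, coeff_dispOp, coeff_quadOp hs,
    coeff_quadOp le_rfl, coeff_dampOp _ hα hd, mul_sub, mul_add, ← tsum_mul_left, quadKer, dampKer,
    wt_zero]
  congr 2
  · ring
  · congr 1; ext k
    field_simp [wt_ne s n]
    simp
  · ext k
    field_simp [wt_ne s n]

/-- The vector field is Lipschitz continuous on balls, being the sum of bounded linear operators
and a bounded quadratic map. -/
theorem exists_lipschitz_field (s : ℝ) (α : ℤ → ℂ) {R : ℝ} (hR : 0 ≤ R) :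
    ∃ K : ℝ≥0, LipschitzOnWith K (field s α) (Metric.closedBall 0 R) := by
  refine ⟨(‖dispOp‖ + 2 * ‖quadOp s‖ * R + ‖dampOp s α‖).toNNReal, ?_⟩
  refine LipschitzOnWith.of_dist_le_mul fun x hx y hy => ?_
  rw [mem_closedBall_zero_iff] at hx hy
  rw [dist_eq_norm, dist_eq_norm, Real.coe_toNNReal _ (by positivity)]
  have h : field s α x - field s α y = dispOp (x - y)
      + (quadOp s x (x - y) + quadOp s (x - y) y) - dampOp s α (x - y) := by
    simp only [field, map_sub, sub_apply]
    abel
  rw [h]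
  refine (norm_sub_le _ _).trans ?_
  have h1 := norm_add_le (dispOp (x - y)) (quadOp s x (x - y) + quadOp s (x - y) y)
  have h2 := norm_add_le (quadOp s x (x - y)) (quadOp s (x - y) y)
  have h3 := dispOp.le_opNorm (x - y)
  have h4 := (dampOp s α).le_opNorm (x - y)
  have h5 : ‖quadOp s x (x - y)‖ ≤ ‖quadOp s‖ * R * ‖x - y‖ :=
    ((quadOp s).le_opNorm₂ _ _).trans (by gcongr)
  have h6 : ‖quadOp s (x - y) y‖ ≤ ‖quadOp s‖ * ‖x - y‖ * R :=
    ((quadOp s).le_opNorm₂ _ _).trans (by gcongr)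
  nlinarith

theorem continuous_field (s : ℝ) (α : ℤ → ℂ) : Continuous (field s α) := by
  have : Continuous fun x => quadOp s x x := (quadOp s).continuous₂.comp
    (continuous_id.prodMk continuous_id)
  exact (dispOp.continuous.add this).sub (dampOp s α).continuous

/-! ### Smooth periodic functions -/

namespace SmoothPeriodic

variable {φ ψ : ℝ → ℝ}

theorem deriv (h : SmoothPeriodic φ) : SmoothPeriodic (deriv φ) := by
  refine ⟨(contDiff_infty_iff_deriv.1 h.1).2, fun x => ?_⟩
  rw [← deriv_comp_add_const]
  congr 1
  ext y
  exact h.2 y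

theorem differentiable (h : SmoothPeriodic φ) : Differentiable ℝ φ :=
  h.1.differentiable (by simp)

theorem continuous (h : SmoothPeriodic φ) : Continuous φ := h.1.continuous

theorem sub (h : SmoothPeriodic φ) (h' : SmoothPeriodic ψ) :
    SmoothPeriodic (fun x => φ x - ψ x) := ⟨h.1.sub h'.1, h.2.sub h'.2⟩

theorem cos_int_mul (n : ℤ) : SmoothPeriodic (fun x => Real.cos (n * x)) := by
  refine ⟨Real.contDiff_cos.comp (contDiff_const.mul contDiff_id), fun x => ?_⟩
  simp only [mul_add]
  exact Real.cos_add_int_mul_two_pi _ _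

theorem sin_int_mul (n : ℤ) : SmoothPeriodic (fun x => Real.sin (n * x)) := by
  refine ⟨Real.contDiff_sin.comp (contDiff_const.mul contDiff_id), fun x => ?_⟩
  simp only [mul_add]
  exact Real.sin_add_int_mul_two_pi _ _

theorem zero : SmoothPeriodic fun _ => (0 : ℝ) := ⟨contDiff_const, fun _ => rfl⟩

/-- A smooth periodic function as a continuous function on the torus. -/
def lift (h : SmoothPeriodic φ) : C(Torus, ℝ) :=
  ⟨h.2.lift, continuous_coinduced_dom.2 h.continuous⟩

@[simp] theorem lift_coe (h : SmoothPeriodic φ) (x : ℝ) : h.lift (x : Torus) = φ x := rfl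

end SmoothPeriodic

/-- The Fourier coefficients of a `2π`-periodic function on the line. -/
def pcoeff (φ : ℝ → ℝ) (n : ℤ) : ℂ :=
  (1 / (2 * Real.pi)) • ∫ x in (0 : ℝ)..(2 * Real.pi), fourier (-n) (x : Torus) • (φ x : ℂ)

theorem fourierCoeff_lift {φ : ℝ → ℝ} (h : SmoothPeriodic φ) (n : ℤ) :
    fourierCoeff (fun x => (h.lift x : ℂ)) n = pcoeff φ n := by
  rw [fourierCoeff_eq_intervalIntegral _ _ 0, zero_add]
  rfl

theorem pcoeff_zero (n : ℤ) : pcoeff (fun _ => 0) n = 0 := by simp [pcoeff]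

theorem hasDerivAt_fourier_two_pi (n : ℤ) (x : ℝ) :
    HasDerivAt (fun y : ℝ => (fourier n (y : Torus) : ℂ))
      (Complex.I * n * fourier n (x : Torus)) x := by
  convert _root_.hasDerivAt_fourier (2 * Real.pi) n x using 1
  have : (Real.pi : ℂ) ≠ 0 := by exact_mod_cast Real.pi_ne_zero
  push_cast
  field_simp

theorem pcoeff_deriv {φ : ℝ → ℝ} (h : SmoothPeriodic φ) (n : ℤ) :
    pcoeff (deriv φ) n = Complex.I * n * pcoeff φ n := by
  have hcf : ∀ n : ℤ, Continuous fun x : ℝ => (fourier n (x : Torus) : ℂ) := fun n =>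
    (map_continuous (fourier n)).comp (AddCircle.continuous_mk' _)
  have key := intervalIntegral.integral_mul_deriv_eq_deriv_mul (a := 0) (b := 2 * Real.pi)
    (u := fun x : ℝ => (fourier (-n) (x : Torus) : ℂ)) (v := fun x => (φ x : ℂ))
    (u' := fun x => Complex.I * (-n : ℤ) * fourier (-n) (x : Torus))
    (v' := fun x => ((deriv φ x : ℝ) : ℂ))
    (fun x _ => hasDerivAt_fourier_two_pi _ x)
    (fun x _ => (h.differentiable x).hasDerivAt.ofReal_comp)
    ((continuous_const.mul (hcf _)).intervalIntegrable _ _)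
    ((Complex.continuous_ofReal.comp h.deriv.continuous).intervalIntegrable _ _)
  have hper : φ (2 * Real.pi) = φ 0 := by simpa using h.2 0
  have hf : (fourier (-n) ((2 * Real.pi : ℝ) : Torus) : ℂ) = fourier (-n) ((0 : ℝ) : Torus) := by
    rw [AddCircle.coe_period]; rfl
  rw [hf, hper, sub_self, zero_sub] at key
  simp only [pcoeff, smul_eq_mul]
  rw [key]
  simp only [mul_assoc, intervalIntegral.integral_const_mul]
  simp
  ring

theorem pcoeff_sub {φ ψ : ℝ → ℝ} (h : SmoothPeriodic φ) (h' : SmoothPeriodic ψ) (n : ℤ) :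
    pcoeff (fun x => φ x - ψ x) n = pcoeff φ n - pcoeff ψ n := by
  have hcf : Continuous fun x : ℝ => (fourier (-n) (x : Torus) : ℂ) :=
    (map_continuous (fourier _)).comp (AddCircle.continuous_mk' _)
  have hi : ∀ {φ : ℝ → ℝ}, SmoothPeriodic φ → IntervalIntegrable
      (fun x => (fourier (-n) (x : Torus) : ℂ) • (φ x : ℂ)) volume 0 (2 * Real.pi) := fun h =>
    (hcf.smul (Complex.continuous_ofReal.comp h.continuous)).intervalIntegrable _ _
  rw [pcoeff, pcoeff, pcoeff, ← smul_sub, ← intervalIntegral.integral_sub (hi h) (hi h')]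
  simp only [Complex.ofReal_sub, smul_sub]

theorem pcoeff_sub_deriv_deriv {φ : ℝ → ℝ} (h : SmoothPeriodic φ) (n : ℤ) :
    pcoeff (fun x => φ x - deriv (deriv φ) x) n = jap n * pcoeff φ n := by
  rw [pcoeff_sub h h.deriv.deriv, pcoeff_deriv h.deriv, pcoeff_deriv h, jap]
  push_cast
  linear_combination (-(n : ℂ) ^ 2 * pcoeff φ n) * Complex.I_sq

theorem exists_norm_pcoeff_le {φ : ℝ → ℝ} (h : SmoothPeriodic φ) :
    ∃ C, ∀ n, ‖pcoeff φ n‖ ≤ C := by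
  refine ⟨∫ x, ‖(h.lift x : ℂ)‖ ∂haarT, fun n => ?_⟩
  rw [← fourierCoeff_lift h]
  exact norm_fourierCoeff_le n

theorem exists_jap_pow_mul_pcoeff_le (N : ℕ) :
    ∀ {φ : ℝ → ℝ}, SmoothPeriodic φ → ∃ C, ∀ n, jap n ^ N * ‖pcoeff φ n‖ ≤ C := by
  induction N with
  | zero => intro φ h; simpa using exists_norm_pcoeff_le h
  | succ N ih =>
    intro φ h
    obtain ⟨C, hC⟩ := ih (h.sub h.deriv.deriv)
    refine ⟨C, fun n => (le_of_eq ?_).trans (hC n)⟩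
    rw [pcoeff_sub_deriv_deriv h, norm_mul, Complex.norm_real,
      Real.norm_of_nonneg (jap_pos n).le]
    ring

theorem rapidDecay_pcoeff {φ : ℝ → ℝ} (h : SmoothPeriodic φ) : RapidDecay (pcoeff φ) := by
  intro p
  obtain ⟨N, hN⟩ := exists_nat_ge (p + 1)
  obtain ⟨C, hC⟩ := exists_jap_pow_mul_pcoeff_le N h
  refine Summable.of_nonneg_of_le (fun n => by have := jap_pos n; positivity) (fun n => ?_)
    (summable_inv_jap.mul_left C)
  have hj := jap_pos n
  rw [← div_eq_mul_inv, le_div_iff₀ hj]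
  calc jap n ^ p * ‖pcoeff φ n‖ * jap n = jap n ^ (p + 1) * ‖pcoeff φ n‖ := by
        rw [Real.rpow_add hj, Real.rpow_one]; ring
    _ ≤ jap n ^ (N : ℝ) * ‖pcoeff φ n‖ := by
        gcongr; exact one_le_jap n
    _ ≤ C := by rw [Real.rpow_natCast]; exact hC n

theorem RapidDecay.summable_norm {c : ℤ → ℂ} (h : RapidDecay c) : Summable fun n => ‖c n‖ := by
  simpa using h 0

theorem herm_pcoeff {φ : ℝ → ℝ} (h : SmoothPeriodic φ) : Herm (pcoeff φ) := by
  intro n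
  rw [← fourierCoeff_lift h, ← fourierCoeff_lift h, fourierCoeff, fourierCoeff, ← integral_conj]
  congr 1; ext x
  rw [neg_neg, fourier_neg]
  simp [-fourier_apply]

/-- A smooth periodic function as an element of `L²`. -/
def SmoothPeriodic.toL2 {φ : ℝ → ℝ} (h : SmoothPeriodic φ) : L2T :=
  ContinuousMap.toLp (E := ℝ) 2 volume ℝ h.lift

theorem coeFn_toL2 {φ : ℝ → ℝ} (h : SmoothPeriodic φ) : ∀ᵐ x, h.toL2 x = h.lift x :=
  ContinuousMap.coeFn_toLp (𝕜 := ℝ) volume h.lift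

theorem coeff_toL2 {φ : ℝ → ℝ} (h : SmoothPeriodic φ) (n : ℤ) :
    coeff h.toL2 n = pcoeff φ n := by
  rw [← fourierCoeff_lift h]
  refine coeff_congr_ae _ ?_ n
  filter_upwards [coeFn_toL2 h] with x hx
  rw [hx]

theorem integral_torus {E : Type*} [NormedAddCommGroup E] [NormedSpace ℝ E] (F : Torus → E) :
    ∫ x in (0 : ℝ)..(2 * Real.pi), F (x : Torus) = ∫ x, F x := by
  have := AddCircle.intervalIntegral_preimage (2 * Real.pi) 0 F
  rwa [zero_add] at this

theorem integral_mul_smooth (f : L2T) {φ : ℝ → ℝ} (h : SmoothPeriodic φ) :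
    ∫ x in (0 : ℝ)..(2 * Real.pi), f (x : Torus) * φ x = ⟪f, h.toL2⟫_ℝ := by
  rw [inner_eq_integral]
  have := integral_torus fun x => f x * h.lift x
  simp only [SmoothPeriodic.lift_coe] at this
  rw [this]
  refine integral_congr_ae ?_
  filter_upwards [coeFn_toL2 h] with x hx
  rw [hx]

/-- Parseval's identity for an integrable function and a smooth one. -/
theorem hasSum_pcoeff_mul {F : Torus → ℝ} (hF : Integrable F) {φ : ℝ → ℝ}
    (h : SmoothPeriodic φ) :
    HasSum (fun n => pcoeff φ n * fourierCoeff (fun x => (F x : ℂ)) (-n))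
      (((2 * Real.pi)⁻¹ * ∫ x in (0 : ℝ)..(2 * Real.pi), F (x : Torus) * φ x : ℝ) : ℂ) := by
  let Φ : C(Torus, ℂ) := ⟨fun x => (h.lift x : ℂ), Complex.continuous_ofReal.comp h.lift.continuous⟩
  have hΦ : ∀ n, fourierCoeff Φ n = pcoeff φ n := fourierCoeff_lift h
  have hsum : Summable (fourierCoeff Φ) := by
    refine Summable.of_norm ?_
    simpa only [hΦ] using (rapidDecay_pcoeff h).summable_norm
  have hpt := has_pointwise_sum_fourier_series_of_summable hsum
  have hFi : Integrable (fun x => (F x : ℂ)) haarT := (integrable_haar_of_volume hF).ofReal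
  have hint : ∀ n : ℤ,
      Integrable (fun x => (fourierCoeff Φ n • fourier n x) * (F x : ℂ)) haarT := by
    intro n
    refine ((hFi.fourier_smul n).smul (fourierCoeff Φ n)).congr (Eventually.of_forall fun x => ?_)
    simp [mul_assoc, -fourier_apply]
  have key := hasSum_integral_of_summable_integral_norm hint (by
    have : ∀ n, ∫ x, ‖(fourierCoeff Φ n • fourier n x) * (F x : ℂ)‖ ∂haarT
        = ‖fourierCoeff Φ n‖ * ∫ x, ‖(F x : ℂ)‖ ∂haarT := by
      intro n
      rw [← integral_const_mul]
      congr 1; ext x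
      rw [norm_mul, norm_smul, fourier_apply, Circle.norm_coe, mul_one]
    simp only [this]
    exact hsum.norm.mul_right _)
  have h2 : ∫ x, ∑' n, (fourierCoeff Φ n • fourier n x) * (F x : ℂ) ∂haarT
      = (((2 * Real.pi)⁻¹ * ∫ x in (0 : ℝ)..(2 * Real.pi), F (x : Torus) * φ x : ℝ) : ℂ) := by
    have h1 : ∀ x, ∑' n, (fourierCoeff Φ n • fourier n x) * (F x : ℂ)
        = ((F x * h.lift x : ℝ) : ℂ) := by
      intro x
      rw [tsum_mul_right, (hpt x).tsum_eq]
      simp [Φ, mul_comm]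
    rw [integral_congr_ae (Eventually.of_forall h1), AddCircle.integral_haarAddCircle,
      integral_complex_ofReal, ← integral_torus]
    simp
  rw [h2] at key
  refine key.congr_fun fun n => ?_
  rw [← hΦ, fourierCoeff.eq_1 (fun x => (F x : ℂ)), ← integral_const_mul]
  congr 1; ext x
  simp [mul_assoc, -fourier_apply]

/-! ### The distributional formulation as an ordinary differential equation -/

theorem Integrable.mul_lift {F : Torus → ℝ} (hF : Integrable F) {φ : ℝ → ℝ}
    (h : SmoothPeriodic φ) : Integrable fun x => F x * h.lift x := by
  refine hF.mul_bdd (c := ‖h.lift‖) h.lift.continuous.aestronglyMeasurable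
    (Eventually.of_forall fun x => h.lift.norm_coe_le_norm x)

theorem integrable_L2T (f : L2T) : Integrable f := (Lp.memLp f).integrable one_le_two

theorem integrable_sq_L2T (f : L2T) : Integrable fun x => f x ^ 2 := (Lp.memLp f).integrable_sq

theorem memLp_lift_haar {φ : ℝ → ℝ} (h : SmoothPeriodic φ) :
    MemLp (fun x => ((h.lift x : ℝ) : ℂ)) 2 haarT := by
  have : MemLp h.lift 2 (volume : Measure Torus) := ContinuousMap.memLp volume ℝ h.lift
  exact memLp_haarAddCircle_iff.2 this.ofReal

theorem hasSum_coeff_mul_lift (f : L2T) {φ : ℝ → ℝ} (h : SmoothPeriodic φ) (n : ℤ) :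
    HasSum (fun k => coeff f k * pcoeff φ (n - k))
      (fourierCoeff (fun x => ((f x : ℝ) : ℂ) * (h.lift x : ℂ)) n) := by
  have := hasSum_fourierCoeff_mul (memLp_ofReal_haar f) (memLp_lift_haar h) n
  simp only [fourierCoeff_lift] at this
  exact this

theorem jap_mul_coeff_field {a : ℝ → ℝ} (ha : SmoothPeriodic a) (f : L2T) (m : ℤ) :
    (jap m : ℂ) * coeff (field 0 (pcoeff a) f) m =
      -(Complex.I * m) * fourierCoeff
        (fun x : Torus => ((f x + f x ^ 2 / 2 + f x * ha.deriv.lift x : ℝ) : ℂ)) m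
      - (m : ℂ) ^ 2 * fourierCoeff (fun x : Torus => ((f x * ha.lift x : ℝ) : ℂ)) m := by
  have hj : (jap m : ℂ) ≠ 0 := by exact_mod_cast (jap_pos m).ne'
  have q₁ := hasSum_fourierCoeff_mul (memLp_ofReal_haar f) (memLp_ofReal_haar f) m
  have q₂ := hasSum_coeff_mul_lift f ha.deriv m
  have q₃ := hasSum_coeff_mul_lift f ha m
  have i₁ : Integrable (fun x => ((f x : ℝ) : ℂ)) haarT := integrable_ofReal_haar f
  have i₂ : Integrable (fun x => 2⁻¹ * (((f x : ℝ) : ℂ) * ((f x : ℝ) : ℂ))) haarT := by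
    have := (integrable_haar_of_volume (integrable_sq_L2T f)).ofReal (𝕜 := ℂ)
    refine (this.const_mul 2⁻¹).congr (Eventually.of_forall fun x => ?_)
    simp [sq]
  have i₃ : Integrable (fun x => ((f x : ℝ) : ℂ) * (ha.deriv.lift x : ℂ)) haarT := by
    have := (integrable_haar_of_volume
      (Integrable.mul_lift (integrable_L2T f) ha.deriv)).ofReal (𝕜 := ℂ)
    refine this.congr (Eventually.of_forall fun x => ?_)
    simp
  have hadd : fourierCoeff
      (fun x : Torus => ((f x + f x ^ 2 / 2 + f x * ha.deriv.lift x : ℝ) : ℂ)) m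
      = coeff f m + 2⁻¹ * fourierCoeff (fun x => ((f x : ℝ) : ℂ) * ((f x : ℝ) : ℂ)) m
        + fourierCoeff (fun x => ((f x : ℝ) : ℂ) * (ha.deriv.lift x : ℂ)) m := by
    rw [← fourierCoeff.const_mul, coeff]
    have e₁ := congrFun (fourierCoeff.add i₁ i₂) m
    have e₂ := congrFun (fourierCoeff.add (i₁.add i₂) i₃) m
    rw [Pi.add_apply, e₁, Pi.add_apply] at e₂
    rw [← e₂]
    congr 1; ext x
    simp only [Pi.add_apply]
    push_cast
    ring
  have hmul : (fun x : Torus => ((f x * ha.lift x : ℝ) : ℂ))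
      = fun x => ((f x : ℝ) : ℂ) * (ha.lift x : ℂ) := by
    ext x; push_cast; rfl
  have hquad : (jap m : ℂ) * ∑' k, quadKer 0 m k * coeff f k * coeff f (m - k)
      = -(Complex.I * m) * (2⁻¹ * fourierCoeff (fun x => ((f x : ℝ) : ℂ) * ((f x : ℝ) : ℂ)) m) := by
    rw [← q₁.tsum_eq, ← tsum_mul_left, ← tsum_mul_left, ← tsum_mul_left]
    congr 1; ext k
    simp only [quadKer, wt_zero, dispSym, coeff]
    field_simp
    simp
  have hdamp : (jap m : ℂ) * ∑' k, dampKer 0 (pcoeff a) m k * coeff f k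
      = (Complex.I * m) * fourierCoeff (fun x => ((f x : ℝ) : ℂ) * (ha.deriv.lift x : ℂ)) m
        + (m : ℂ) ^ 2 * fourierCoeff (fun x => ((f x : ℝ) : ℂ) * (ha.lift x : ℂ)) m := by
    rw [← ((q₂.mul_left (Complex.I * m)).add (q₃.mul_left ((m : ℂ) ^ 2))).tsum_eq, ← tsum_mul_left]
    congr 1; ext k
    rw [pcoeff_deriv ha]
    simp only [dampKer, wt_zero]
    field_simp
    push_cast
    linear_combination (-(m * (m - k) * coeff f k * pcoeff a (m - k)) : ℂ) * Complex.I_sq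
  rw [hadd, hmul, field, coeff_sub, coeff_add, coeff_dispOp, coeff_quadOp le_rfl,
    coeff_dampOp _ (herm_pcoeff ha) (rapidDecay_pcoeff ha), mul_sub, mul_add, hquad, hdamp, dispSym]
  field_simp
  ring

/-- The vector field represents, against test functions of the form `φ - φ''`, the spatial terms of
the weak formulation. -/
theorem inner_field {a φ : ℝ → ℝ} (ha : SmoothPeriodic a) (h : SmoothPeriodic φ) (f : L2T) :
    ⟪field 0 (pcoeff a) f, (h.sub h.deriv.deriv).toL2⟫_ℝ =
      ∫ x in (0 : ℝ)..(2 * Real.pi),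
        ((f (x : Torus) + f (x : Torus) ^ 2 / 2) * deriv φ x +
          f (x : Torus) * deriv (fun y => a y * deriv φ y) x) := by
  set F₁ : Torus → ℝ := fun x => f x + f x ^ 2 / 2 + f x * ha.deriv.lift x with hF₁
  set F₂ : Torus → ℝ := fun x => f x * ha.lift x with hF₂
  have i₁ : Integrable fun x : Torus => f x + f x ^ 2 / 2 :=
    (integrable_L2T f).add ((integrable_sq_L2T f).div_const 2)
  have i₂ : Integrable fun x : Torus => f x * ha.deriv.lift x :=
    Integrable.mul_lift (integrable_L2T f) ha.deriv
  have hi₁ : Integrable F₁ := i₁.add i₂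
  have hi₂ : Integrable F₂ := Integrable.mul_lift (integrable_L2T f) ha
  have hsplit : (∫ x in (0 : ℝ)..(2 * Real.pi),
        ((f (x : Torus) + f (x : Torus) ^ 2 / 2) * deriv φ x +
          f (x : Torus) * deriv (fun y => a y * deriv φ y) x))
      = (∫ x in (0 : ℝ)..(2 * Real.pi), F₁ (x : Torus) * deriv φ x)
        + ∫ x in (0 : ℝ)..(2 * Real.pi), F₂ (x : Torus) * deriv (deriv φ) x := by
    have e₁ := integral_torus fun x => F₁ x * h.deriv.lift x
    have e₂ := integral_torus fun x => F₂ x * h.deriv.deriv.lift x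
    have e₃ := integral_torus fun x => F₁ x * h.deriv.lift x + F₂ x * h.deriv.deriv.lift x
    rw [integral_add (Integrable.mul_lift hi₁ h.deriv) (Integrable.mul_lift hi₂ h.deriv.deriv),
      ← e₁, ← e₂] at e₃
    simp only [SmoothPeriodic.lift_coe] at e₃
    rw [← e₃]
    congr 1; ext x
    have hd : deriv (fun y => a y * deriv φ y) x
        = deriv a x * deriv φ x + a x * deriv (deriv φ) x :=
      ((ha.differentiable x).hasDerivAt.mul (h.deriv.differentiable x).hasDerivAt).deriv
    rw [hd]
    simp only [hF₁, hF₂, SmoothPeriodic.lift_coe]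
    ring
  have s₁ := hasSum_pcoeff_mul hi₁ h.deriv
  have s₂ := hasSum_pcoeff_mul hi₂ h.deriv.deriv
  have s₃ := hasSum_coeff_mul_conj (field 0 (pcoeff a) f) (h.sub h.deriv.deriv).toL2
  have s₄ := (Equiv.neg ℤ).hasSum_iff.2 s₃
  have hterm : ∀ n : ℤ, ((fun n => coeff (field 0 (pcoeff a) f) n *
      conj (coeff (h.sub h.deriv.deriv).toL2 n)) ∘ Equiv.neg ℤ) n
      = pcoeff (deriv φ) n * fourierCoeff (fun x => (F₁ x : ℂ)) (-n)
        + pcoeff (deriv (deriv φ)) n * fourierCoeff (fun x => (F₂ x : ℂ)) (-n) := by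
    intro n
    simp only [Function.comp, Equiv.neg_apply]
    rw [coeff_neg_index (h.sub h.deriv.deriv).toL2, Complex.conj_conj, coeff_toL2,
      pcoeff_sub_deriv_deriv h, pcoeff_deriv h.deriv, pcoeff_deriv h]
    have : (jap (-n) : ℂ) * coeff (field 0 (pcoeff a) f) (-n)
        = -(Complex.I * (-n : ℤ)) * fourierCoeff (fun x => (F₁ x : ℂ)) (-n)
          - ((-n : ℤ) : ℂ) ^ 2 * fourierCoeff (fun x => (F₂ x : ℂ)) (-n) :=
      jap_mul_coeff_field ha f (-n)
    rw [jap_neg] at this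
    push_cast at this
    linear_combination pcoeff φ n * this
      - (pcoeff φ n * (n : ℂ) ^ 2 * fourierCoeff (fun x => (F₂ x : ℂ)) (-n)) * Complex.I_sq
  have key := s₄.unique ((s₁.add s₂).congr_fun hterm)
  rw [hsplit]
  have hpi : (2 * Real.pi)⁻¹ ≠ 0 := by positivity
  rw [← Complex.ofReal_add, Complex.ofReal_inj, ← mul_add] at key
  exact mul_left_cancel₀ hpi key

theorem deriv_deriv_cos_int_mul (n : ℤ) :
    deriv (deriv fun x : ℝ => Real.cos (n * x)) = fun x => -((n : ℝ) ^ 2 * Real.cos (n * x)) := by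
  have h1 : deriv (fun x : ℝ => Real.cos (n * x)) = fun x => -((n : ℝ) * Real.sin (n * x)) := by
    ext x
    have := ((hasDerivAt_id x).const_mul (n : ℝ)).cos
    simp only [id, mul_one] at this
    rw [this.deriv]; ring
  ext x
  rw [h1]
  have := (((hasDerivAt_id x).const_mul (n : ℝ)).sin.const_mul (n : ℝ)).neg
  simp only [id, mul_one] at this
  refine (HasDerivAt.deriv this).trans ?_
  ring

theorem deriv_deriv_sin_int_mul (n : ℤ) :
    deriv (deriv fun x : ℝ => Real.sin (n * x)) = fun x => -((n : ℝ) ^ 2 * Real.sin (n * x)) := by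
  have h1 : deriv (fun x : ℝ => Real.sin (n * x)) = fun x => (n : ℝ) * Real.cos (n * x) := by
    ext x
    have := ((hasDerivAt_id x).const_mul (n : ℝ)).sin
    simp only [id, mul_one] at this
    rw [this.deriv]; ring
  ext x
  rw [h1]
  have := ((hasDerivAt_id x).const_mul (n : ℝ)).cos.const_mul (n : ℝ)
  simp only [id, mul_one] at this
  rw [HasDerivAt.deriv this]; ring

theorem fourier_re_im (n : ℤ) (x : Torus) :
    (fourier (-n) x).re = (SmoothPeriodic.cos_int_mul n).lift x ∧
      (fourier (-n) x).im = -(SmoothPeriodic.sin_int_mul n).lift x := by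
  induction x using QuotientAddGroup.induction_on with
  | H x =>
    have h1 : (fourier (-n) (x : Torus) : ℂ) = Complex.exp ((-(n * x) : ℝ) * Complex.I) := by
      rw [fourier_two_pi_coe]; congr 1; push_cast; ring
    rw [h1, Complex.exp_ofReal_mul_I_re, Complex.exp_ofReal_mul_I_im, Real.cos_neg, Real.sin_neg]
    exact ⟨rfl, rfl⟩

/-- The functions `φ - φ''` with `φ` smooth span a dense subspace of `L²`. -/
theorem eq_zero_of_inner_test {f : L2T}
    (hf : ∀ (φ : ℝ → ℝ) (h : SmoothPeriodic φ), ⟪f, (h.sub h.deriv.deriv).toL2⟫_ℝ = 0) :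
    f = 0 := by
  have hpos : ∀ n : ℤ, (1 + (n : ℝ) ^ 2) ≠ 0 := fun n => (jap_pos n).ne'
  have hc : ∀ n : ℤ, ∫ x : Torus, f x * (SmoothPeriodic.cos_int_mul n).lift x = 0 := by
    intro n
    have h := hf _ (SmoothPeriodic.cos_int_mul n)
    rw [← integral_mul_smooth, deriv_deriv_cos_int_mul] at h
    have e := integral_torus fun x => f x * (SmoothPeriodic.cos_int_mul n).lift x
    rw [← e]
    refine (mul_eq_zero.1 ?_).resolve_left (hpos n)
    rw [← intervalIntegral.integral_const_mul, ← h]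
    congr 1; ext x
    simp only [SmoothPeriodic.lift_coe]
    ring
  have hs : ∀ n : ℤ, ∫ x : Torus, f x * (SmoothPeriodic.sin_int_mul n).lift x = 0 := by
    intro n
    have h := hf _ (SmoothPeriodic.sin_int_mul n)
    rw [← integral_mul_smooth, deriv_deriv_sin_int_mul] at h
    have e := integral_torus fun x => f x * (SmoothPeriodic.sin_int_mul n).lift x
    rw [← e]
    refine (mul_eq_zero.1 ?_).resolve_left (hpos n)
    rw [← intervalIntegral.integral_const_mul, ← h]
    congr 1; ext x
    simp only [SmoothPeriodic.lift_coe]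
    ring
  refine ext_coeff fun n => ?_
  have h0 : coeff (0 : L2T) n = 0 := (coeffL n).map_zero
  have hint : Integrable (fun x => fourier (-n) x • ((f x : ℝ) : ℂ)) haarT :=
    (integrable_ofReal_haar f).fourier_smul (-n)
  rw [h0]
  apply Complex.ext
  · have := integral_re hint
    simp only [RCLike.re_to_complex] at this
    rw [coeff, fourierCoeff, ← this, AddCircle.integral_haarAddCircle]
    have h2 : ∀ x : Torus, (fourier (-n) x • ((f x : ℝ) : ℂ)).re
        = f x * (SmoothPeriodic.cos_int_mul n).lift x := fun x => by
      rw [← (fourier_re_im n x).1]; simp [-fourier_apply, mul_comm]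
    rw [integral_congr_ae (Eventually.of_forall h2), hc]
    simp
  · have := integral_im hint
    simp only [RCLike.im_to_complex] at this
    rw [coeff, fourierCoeff, ← this, AddCircle.integral_haarAddCircle]
    have h2 : ∀ x : Torus, (fourier (-n) x • ((f x : ℝ) : ℂ)).im
        = -(f x * (SmoothPeriodic.sin_int_mul n).lift x) := fun x => by
      rw [← mul_neg, ← (fourier_re_im n x).2]; simp [-fourier_apply, mul_comm]
    rw [integral_congr_ae (Eventually.of_forall h2), integral_neg, hs]
    simp

/-- A continuous curve `x` in `L²` is a mild solution on `[0, T]` of the equation conjugated with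
`(1 - ∂ₓ²)^{s/2}`. -/
def IsCurve (s : ℝ) (α : ℤ → ℂ) (T : ℝ) (x : ℝ → L2T) : Prop :=
  Continuous x ∧ ∀ t ∈ Set.Icc 0 T, x t = x 0 + ∫ τ in (0 : ℝ)..t, field s α (x τ)

theorem inner_field_integral {s : ℝ} (hs : 0 ≤ s) {a φ : ℝ → ℝ} (ha : SmoothPeriodic a)
    (h : SmoothPeriodic φ) {x : ℝ → L2T} (hx : Continuous x) (t : ℝ) :
    ⟪smoothing s (∫ τ in (0 : ℝ)..t, field s (pcoeff a) (x τ)), (h.sub h.deriv.deriv).toL2⟫_ℝ =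
      ∫ τ in (0 : ℝ)..t, ∫ y in (0 : ℝ)..(2 * Real.pi),
        ((smoothing s (x τ) (y : Torus) + smoothing s (x τ) (y : Torus) ^ 2 / 2) * deriv φ y +
          smoothing s (x τ) (y : Torus) * deriv (fun z => a z * deriv φ z) y) := by
  have hc : Continuous fun τ => field s (pcoeff a) (x τ) := (continuous_field s _).comp hx
  have h1 := ((innerSL ℝ (h.sub h.deriv.deriv).toL2).comp (smoothing s)).intervalIntegral_comp_comm
    (hc.intervalIntegrable (μ := volume) 0 t)
  rw [real_inner_comm]
  change ((innerSL ℝ (h.sub h.deriv.deriv).toL2).comp (smoothing s)) _ = _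
  rw [← h1]
  congr 1; ext τ
  rw [← inner_field ha h, ← smoothing_field hs (herm_pcoeff ha) (rapidDecay_pcoeff ha),
    real_inner_comm]
  rfl

theorem sobNorm_smoothing_sub {s : ℝ} (hs : 0 ≤ s) (x y : L2T) :
    sobNorm s (smoothing s x - smoothing s y) = ENNReal.ofReal (nrm * ‖x - y‖) := by
  rw [← map_sub, sobNorm_smoothing hs]

theorem isSolution_iff {s : ℝ} (hs : 0 ≤ s) {a : ℝ → ℝ} (ha : SmoothPeriodic a) {T : ℝ}
    (hT : 0 ≤ T) {u₀ : L2T} {u : ℝ → L2T} :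
    IsSolution a s T u₀ u ↔ u 0 = u₀ ∧ ∃ x, IsCurve s (pcoeff a) T x ∧
      ∀ t ∈ Set.Icc 0 T, u t = smoothing s (x t) := by
  have hsub : ∀ {t}, t ∈ Set.Icc 0 T → Set.uIcc 0 t ⊆ Set.Icc 0 T := fun {t} ht => by
    rw [Set.uIcc_of_le ht.1]; exact Set.Icc_subset_Icc_right ht.2
  have h0T : (0 : ℝ) ∈ Set.Icc 0 T := ⟨le_rfl, hT⟩
  -- the integrand of the weak formulation only sees the curve on `[0, T]`
  have hcongr : ∀ {x : ℝ → L2T} {φ : ℝ → ℝ} {t : ℝ}, t ∈ Set.Icc 0 T →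
      (∀ t ∈ Set.Icc 0 T, u t = smoothing s (x t)) →
      (∫ τ in (0 : ℝ)..t, ∫ y in (0 : ℝ)..(2 * Real.pi),
        ((u τ (y : Torus) + u τ (y : Torus) ^ 2 / 2) * deriv φ y +
          u τ (y : Torus) * deriv (fun z => a z * deriv φ z) y)) =
      ∫ τ in (0 : ℝ)..t, ∫ y in (0 : ℝ)..(2 * Real.pi),
        ((smoothing s (x τ) (y : Torus) + smoothing s (x τ) (y : Torus) ^ 2 / 2) * deriv φ y +
          smoothing s (x τ) (y : Torus) * deriv (fun z => a z * deriv φ z) y) := by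
    intro x φ t ht hux
    refine intervalIntegral.integral_congr fun τ hτ => ?_
    simp only [hux τ (hsub ht hτ)]
  constructor
  · rintro ⟨⟨hmem, hcont⟩, h0, heq⟩
    refine ⟨h0, ?_⟩
    choose! y hy using fun t (ht : t ∈ Set.Icc 0 T) => exists_smoothing_eq hs (hmem t ht)
    have hyc : ContinuousOn y (Set.Icc 0 T) := by
      intro t₀ ht₀
      rw [ContinuousWithinAt, tendsto_iff_norm_sub_tendsto_zero]
      have h1 : Tendsto (fun t => ENNReal.ofReal (nrm * ‖y t - y t₀‖)) (𝓝[Set.Icc 0 T] t₀)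
          (𝓝 0) := by
        refine (hcont t₀ ht₀).congr' ?_
        filter_upwards [self_mem_nhdsWithin] with t ht
        rw [← hy t ht, ← hy t₀ ht₀, sobNorm_smoothing_sub hs]
      have h2 := (ENNReal.tendsto_toReal ENNReal.zero_ne_top).comp h1
      have h3 := h2.const_mul nrm⁻¹
      simp only [ENNReal.toReal_zero, mul_zero] at h3
      refine h3.congr fun t => ?_
      rw [Function.comp, ENNReal.toReal_ofReal (mul_nonneg nrm_pos.le (norm_nonneg _)),
        inv_mul_cancel_left₀ nrm_pos.ne']
    let x : ℝ → L2T := Set.IccExtend hT (fun t : Set.Icc 0 T => y t)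
    have hx : Continuous x := hyc.domRestrict.Icc_extend'
    have hxu : ∀ t ∈ Set.Icc 0 T, u t = smoothing s (x t) := fun t ht => by
      rw [← hy t ht]; simp only [x]; rw [Set.IccExtend_of_mem _ _ ht]
    refine ⟨x, ⟨hx, fun t ht => ?_⟩, hxu⟩
    refine sub_eq_zero.1 (smoothing_injective hs ?_)
    rw [map_zero]
    refine eq_zero_of_inner_test fun φ h => ?_
    have e := heq φ h t ht
    rw [hcongr ht hxu, ← inner_field_integral hs ha h hx, ← h0] at e
    rw [integral_mul_smooth (u t) (h.sub h.deriv.deriv),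
      integral_mul_smooth (u 0) (h.sub h.deriv.deriv)] at e
    rw [map_sub, map_add, ← hxu t ht, ← hxu 0 h0T, inner_sub_left, inner_add_left, e, sub_self]
  · rintro ⟨h0, x, ⟨hx, heq⟩, hxu⟩
    refine ⟨⟨fun t ht => ?_, fun t₀ ht₀ => ?_⟩, h0, fun φ h t ht => ?_⟩
    · rw [hxu t ht]; exact memSob_smoothing hs _
    · have h1 : Tendsto (fun t => ENNReal.ofReal (nrm * ‖x t - x t₀‖)) (𝓝[Set.Icc 0 T] t₀)
          (𝓝 0) := by
        have : Continuous fun t => ENNReal.ofReal (nrm * ‖x t - x t₀‖) :=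
          ENNReal.continuous_ofReal.comp (by fun_prop)
        have := (this.tendsto t₀).mono_left (nhdsWithin_le_nhds (s := Set.Icc 0 T))
        simpa using this
      refine h1.congr' ?_
      filter_upwards [self_mem_nhdsWithin] with t ht
      rw [hxu t ht, hxu t₀ ht₀, sobNorm_smoothing_sub hs]
    · rw [hcongr ht hxu, ← inner_field_integral hs ha h hx, ← h0,
        integral_mul_smooth (u t) (h.sub h.deriv.deriv),
        integral_mul_smooth (u 0) (h.sub h.deriv.deriv), hxu t ht, hxu 0 h0T, ← inner_add_left,
        ← map_add, ← heq t ht]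

/-! ### Ordinary differential equations in Banach spaces -/

section ODE

variable {E : Type*} [NormedAddCommGroup E]

theorem hasDerivWithinAt_of_integral_eq [NormedSpace ℝ E] [CompleteSpace E] {x v : ℝ → E} {T : ℝ}
    (hv : Continuous v) (hx : ∀ t ∈ Set.Icc 0 T, x t = x 0 + ∫ τ in (0 : ℝ)..t, v τ) {t : ℝ}
    (ht : t ∈ Set.Ico 0 T) : HasDerivWithinAt x (v t) (Set.Ici t) t := by
  have h : HasDerivAt (fun t => x 0 + ∫ τ in (0 : ℝ)..t, v τ) (v t) t :=
    (hv.integral_hasStrictDerivAt 0 t).hasDerivAt.const_add _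
  refine h.hasDerivWithinAt.congr_of_eventuallyEq ?_ (hx t ⟨ht.1, ht.2.le⟩)
  filter_upwards [Ico_mem_nhdsGE ht.2] with r hr
  exact hx r ⟨ht.1.trans hr.1, hr.2.le⟩

/-- Global existence for a bounded and globally Lipschitz continuous vector field. -/
theorem exists_integral_curve [NormedSpace ℝ E] [CompleteSpace E] {V : E → E} {K L : ℝ≥0}
    (hV : LipschitzWith K V) (hL : ∀ y, ‖V y‖ ≤ L) (x₀ : E) {T : ℝ} (hT : 0 ≤ T) :
    ∃ x : ℝ → E, Continuous x ∧ x 0 = x₀ ∧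
      ∀ t ∈ Set.Icc 0 T, x t = x 0 + ∫ τ in (0 : ℝ)..t, V (x τ) := by
  let t₀ : Set.Icc 0 T := ⟨0, le_rfl, hT⟩
  have hf : IsPicardLindelof (fun _ => V) t₀ x₀ (L * T.toNNReal) 0 L K :=
    { lipschitzOnWith := fun _ _ => hV.lipschitzOnWith
      continuousOn := fun _ _ => continuousOn_const
      norm_le := fun _ _ y _ => hL y
      mul_max_le := by simp [t₀, hT] }
  have hx₀ : x₀ ∈ Metric.closedBall x₀ ((0 : ℝ≥0) : ℝ) := by simp
  obtain ⟨α, hα⟩ := ODE.FunSpace.exists_isFixedPt_next hf hx₀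
  have h := (ODE.FunSpace.isFixedPt_next_iff hf hx₀).1 hα
  have h0 : α.compProj 0 = x₀ := by
    rw [α.compProj_of_mem ⟨le_rfl, hT⟩]
    exact α.apply_of_zero
  refine ⟨α.compProj, α.continuous_compProj, h0, fun t ht => ?_⟩
  rw [h0, α.compProj_of_mem ht, h ⟨t, ht⟩, ODE.picard_apply]

theorem norm_sq_eq_of_integral_eq [InnerProductSpace ℝ E] [CompleteSpace E] {x v : ℝ → E} {T : ℝ}
    (hv : Continuous v) (hx : ∀ t ∈ Set.Icc 0 T, x t = x 0 + ∫ τ in (0 : ℝ)..t, v τ)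
    {t : ℝ} (ht : t ∈ Set.Icc 0 T) :
    ‖x t‖ ^ 2 = ‖x 0‖ ^ 2 + ∫ τ in (0 : ℝ)..t, 2 * ⟪x τ, v τ⟫_ℝ := by
  set z : ℝ → E := fun t => x 0 + ∫ τ in (0 : ℝ)..t, v τ with hz
  have hd : ∀ t, HasDerivAt z (v t) t := fun t =>
    (hv.integral_hasStrictDerivAt 0 t).hasDerivAt.const_add _
  have hzc : Continuous z := continuous_iff_continuousAt.2 fun t => (hd t).continuousAt
  have hd2 : ∀ t, HasDerivAt (fun t => ‖z t‖ ^ 2) (2 * ⟪z t, v t⟫_ℝ) t := fun t => (hd t).norm_sq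
  have hint := intervalIntegral.integral_eq_sub_of_hasDerivAt (a := 0) (b := t)
    (fun τ _ => hd2 τ) ((continuous_const.mul (hzc.inner hv)).intervalIntegrable _ _)
  have h0 : z 0 = x 0 := by simp [hz]
  have hxz : ∀ τ ∈ Set.uIcc 0 t, x τ = z τ := fun τ hτ => by
    rw [Set.uIcc_of_le ht.1] at hτ
    exact hx τ ⟨hτ.1, hτ.2.trans ht.2⟩
  have hcongr : ∫ τ in (0 : ℝ)..t, 2 * ⟪x τ, v τ⟫_ℝ = ∫ τ in (0 : ℝ)..t, 2 * ⟪z τ, v τ⟫_ℝ :=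
    intervalIntegral.integral_congr fun τ hτ => by simp only [hxz τ hτ]
  rw [hcongr, hint, h0, hxz t Set.right_mem_uIcc]
  ring

/-- The radial retraction onto the closed ball of radius `R`. -/
def retract [NormedSpace ℝ E] (R : ℝ) (x : E) : E := (R / max R ‖x‖) • x

variable [NormedSpace ℝ E] {R : ℝ}

theorem retract_of_norm_le (hR : 0 < R) {x : E} (hx : ‖x‖ ≤ R) : retract R x = x := by
  rw [retract, max_eq_left hx, div_self hR.ne', one_smul]

theorem norm_retract_le (hR : 0 < R) (x : E) : ‖retract R x‖ ≤ R := by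
  have hm : 0 < max R ‖x‖ := lt_max_of_lt_left hR
  rw [retract, norm_smul, Real.norm_of_nonneg (by positivity), div_mul_eq_mul_div, div_le_iff₀ hm]
  gcongr
  exact le_max_right _ _

theorem lipschitzWith_retract (hR : 0 < R) : LipschitzWith 2 (retract R : E → E) := by
  refine LipschitzWith.of_dist_le_mul fun x y => ?_
  have hx : 0 < max R ‖x‖ := lt_max_of_lt_left hR
  have hy : 0 < max R ‖y‖ := lt_max_of_lt_left hR
  rw [dist_eq_norm, dist_eq_norm]
  have h : retract R x - retract R y
      = (R / max R ‖x‖) • (x - y) + (R / max R ‖x‖ - R / max R ‖y‖) • y := by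
    simp only [retract, smul_sub, sub_smul]; abel
  have h1 : R / max R ‖x‖ ≤ 1 := (div_le_one hx).2 (le_max_left _ _)
  have h2 : |max R ‖y‖ - max R ‖x‖| ≤ ‖x - y‖ := by
    refine (abs_max_sub_max_le_max _ _ _ _).trans ?_
    rw [sub_self, abs_zero, norm_sub_rev]
    exact max_le (norm_nonneg _) (abs_norm_sub_norm_le _ _)
  have h3 : |R / max R ‖x‖ - R / max R ‖y‖| * ‖y‖ ≤ ‖x - y‖ := by
    have : R / max R ‖x‖ - R / max R ‖y‖
        = (R / max R ‖x‖) * ((max R ‖y‖ - max R ‖x‖) / max R ‖y‖) := by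
      field_simp
    rw [this, abs_mul, abs_of_pos (div_pos hR hx), abs_div, abs_of_pos hy, mul_assoc,
      div_mul_eq_mul_div |max R ‖y‖ - max R ‖x‖|]
    have h4 : |max R ‖y‖ - max R ‖x‖| * ‖y‖ / max R ‖y‖ ≤ ‖x - y‖ := by
      rw [div_le_iff₀ hy]
      exact mul_le_mul h2 (le_max_right _ _) (norm_nonneg _) (norm_nonneg _)
    exact (mul_le_mul h1 h4 (by positivity) zero_le_one).trans_eq (one_mul _)
  rw [h]
  refine (norm_add_le _ _).trans ?_
  rw [norm_smul, norm_smul, Real.norm_of_nonneg (div_pos hR hx).le, Real.norm_eq_abs]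
  have h5 := mul_le_mul_of_nonneg_right h1 (norm_nonneg (x - y))
  rw [NNReal.coe_ofNat]
  linarith

end ODE

/-! ### Well-posedness -/

/-- Gronwall's inequality for two solutions that stay in a common ball. -/
theorem IsCurve.dist_le {s : ℝ} {α : ℤ → ℂ} {T R : ℝ} {K : ℝ≥0}
    (hK : LipschitzOnWith K (field s α) (Metric.closedBall 0 R)) {x y : ℝ → L2T}
    (hx : IsCurve s α T x) (hy : IsCurve s α T y) (hxR : ∀ t ∈ Set.Icc 0 T, ‖x t‖ ≤ R)
    (hyR : ∀ t ∈ Set.Icc 0 T, ‖y t‖ ≤ R) {t : ℝ} (ht : t ∈ Set.Icc 0 T) :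
    ‖x t - y t‖ ≤ ‖x 0 - y 0‖ * Real.exp (K * T) := by
  have h := dist_le_of_trajectories_ODE_of_mem (v := fun _ => field s α)
    (s := fun _ => Metric.closedBall 0 R) (K := K) (a := 0) (b := T) (f := x) (g := y)
    (δ := dist (x 0) (y 0))
    (fun _ _ => hK) hx.1.continuousOn
    (fun t ht => hasDerivWithinAt_of_integral_eq ((continuous_field s α).comp hx.1) hx.2 ht)
    (fun t ht => mem_closedBall_zero_iff.2 (hxR t ⟨ht.1, ht.2.le⟩)) hy.1.continuousOn
    (fun t ht => hasDerivWithinAt_of_integral_eq ((continuous_field s α).comp hy.1) hy.2 ht)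
    (fun t ht => mem_closedBall_zero_iff.2 (hyR t ⟨ht.1, ht.2.le⟩)) le_rfl t ht
  rw [dist_eq_norm, dist_eq_norm, sub_zero] at h
  refine h.trans ?_
  gcongr
  exact ht.2

theorem IsCurve.exists_bound {s : ℝ} {α : ℤ → ℂ} {T : ℝ} {x : ℝ → L2T} (hx : IsCurve s α T x) :
    ∃ R, ∀ t ∈ Set.Icc 0 T, ‖x t‖ ≤ R :=
  isCompact_Icc.exists_bound_of_continuousOn hx.1.continuousOn

theorem IsCurve.eqOn {s : ℝ} {α : ℤ → ℂ} {T : ℝ} {x y : ℝ → L2T} (hx : IsCurve s α T x)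
    (hy : IsCurve s α T y) (h0 : x 0 = y 0) {t : ℝ} (ht : t ∈ Set.Icc 0 T) : x t = y t := by
  obtain ⟨R₁, hR₁⟩ := hx.exists_bound
  obtain ⟨R₂, hR₂⟩ := hy.exists_bound
  have hR : 0 ≤ max R₁ R₂ := ((norm_nonneg _).trans (hR₁ t ht)).trans (le_max_left _ _)
  obtain ⟨K, hK⟩ := exists_lipschitz_field s α hR
  have := hx.dist_le hK hy (fun t ht => (hR₁ t ht).trans (le_max_left _ _))
    (fun t ht => (hR₂ t ht).trans (le_max_right _ _)) ht
  rw [h0, sub_self, norm_zero, zero_mul] at this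
  exact sub_eq_zero.1 (norm_le_zero_iff.1 this)

theorem norm_le_of_sobNorm_le {s : ℝ} (hs : 0 ≤ s) {ρ : ℝ≥0} {x : L2T}
    (h : sobNorm s (smoothing s x) ≤ ρ) : ‖x‖ ≤ ρ / nrm := by
  rw [sobNorm_smoothing hs, ENNReal.ofReal_le_iff_le_toReal ENNReal.coe_ne_top] at h
  rw [le_div_iff₀ nrm_pos, mul_comm]
  exact h

/-- Well-posedness on a ball follows from the existence of solutions with a uniform bound. -/
theorem wellPosedOnBall_of_exists {s : ℝ} (hs : 0 ≤ s) {a : ℝ → ℝ} (ha : SmoothPeriodic a)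
    {ρ : ℝ≥0} {T R : ℝ} (hT : 0 ≤ T)
    (hex : ∀ x₀ : L2T, ‖x₀‖ ≤ ρ / nrm → ∃ x, IsCurve s (pcoeff a) T x ∧ x 0 = x₀ ∧
      ∀ t ∈ Set.Icc 0 T, ‖x t‖ ≤ R) : WellPosedOnBall a s ρ T := by
  have h0T : (0 : ℝ) ∈ Set.Icc 0 T := ⟨le_rfl, hT⟩
  have hR : 0 ≤ R := by
    obtain ⟨x, -, -, hx⟩ := hex 0 (by rw [norm_zero]; have := nrm_pos; positivity)
    exact (norm_nonneg _).trans (hx 0 h0T)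
  refine ⟨fun u₀ hu₀ => ?_, fun u₀ hu₀ u v hu hv t ht => ?_, ?_⟩
  · obtain ⟨x₀, rfl⟩ := exists_smoothing_eq hs (hu₀.trans_lt ENNReal.coe_lt_top)
    obtain ⟨x, hx, hx0, -⟩ := hex x₀ (norm_le_of_sobNorm_le hs hu₀)
    exact ⟨fun t => smoothing s (x t), (isSolution_iff hs ha hT).2
      ⟨by simp only [hx0], x, hx, fun _ _ => rfl⟩⟩
  · obtain ⟨hu0, x, hx, hux⟩ := (isSolution_iff hs ha hT).1 hu
    obtain ⟨hv0, y, hy, hvy⟩ := (isSolution_iff hs ha hT).1 hv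
    have h0 : x 0 = y 0 := smoothing_injective hs (by
      rw [← hux 0 h0T, ← hvy 0 h0T, hu0, hv0])
    rw [hux t ht, hvy t ht, hx.eqOn hy h0 ht]
  · obtain ⟨K, hK⟩ := exists_lipschitz_field s (pcoeff a) hR
    -- by uniqueness every solution obeys the bound of the one that is known to exist
    have hbound : ∀ {u₀ : L2T} {u : ℝ → L2T}, sobNorm s u₀ ≤ ρ → IsSolution a s T u₀ u →
        ∃ x, IsCurve s (pcoeff a) T x ∧ (∀ t ∈ Set.Icc 0 T, u t = smoothing s (x t)) ∧
          ∀ t ∈ Set.Icc 0 T, ‖x t‖ ≤ R := by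
      intro u₀ u hu₀ hu
      obtain ⟨hu0, x, hx, hux⟩ := (isSolution_iff hs ha hT).1 hu
      rw [← hu0, hux 0 h0T] at hu₀
      obtain ⟨y, hy, hy0, hyR⟩ := hex (x 0) (norm_le_of_sobNorm_le hs hu₀)
      exact ⟨x, hx, hux, fun t ht => by rw [hx.eqOn hy hy0.symm ht]; exact hyR t ht⟩
    refine ⟨(Real.exp (K * T)).toNNReal, fun u₀ v₀ hu₀ hv₀ u v hu hv t ht => ?_⟩
    obtain ⟨x, hx, hux, hxR⟩ := hbound hu₀ hu
    obtain ⟨y, hy, hvy, hyR⟩ := hbound hv₀ hv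
    rw [← hu.2.1, ← hv.2.1, hux t ht, hvy t ht, hux 0 h0T, hvy 0 h0T, sobNorm_smoothing_sub hs,
      sobNorm_smoothing_sub hs]
    change _ ≤ ENNReal.ofReal _ * _
    rw [← ENNReal.ofReal_mul (Real.exp_nonneg _)]
    refine ENNReal.ofReal_le_ofReal ?_
    have := hx.dist_le hK hy hxR hyR ht
    have := mul_le_mul_of_nonneg_left this nrm_pos.le
    linarith

/-- Solutions of the equation truncated outside a ball exist for all times. -/
theorem exists_truncated_curve (s : ℝ) (α : ℤ → ℂ) {R : ℝ} (hR : 0 < R) :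
    ∃ M : ℝ, 0 ≤ M ∧ (∀ y, ‖field s α (retract R y)‖ ≤ M) ∧
      ∀ (x₀ : L2T) {T : ℝ}, 0 ≤ T → ∃ x : ℝ → L2T, Continuous x ∧ x 0 = x₀ ∧
        ∀ t ∈ Set.Icc 0 T, x t = x 0 + ∫ τ in (0 : ℝ)..t, field s α (retract R (x τ)) := by
  obtain ⟨K, hK⟩ := exists_lipschitz_field s α hR.le
  have hmem : ∀ y : L2T, retract R y ∈ Metric.closedBall (0 : L2T) R := fun y =>
    mem_closedBall_zero_iff.2 (norm_retract_le hR y)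
  have hM : ∀ y, ‖field s α (retract R y)‖ ≤ ‖field s α 0‖ + K * R := by
    intro y
    have h := hK.dist_le_mul _ (hmem y) 0 (by simp [hR.le])
    rw [dist_eq_norm, dist_zero_right] at h
    have h2 := norm_sub_norm_le (field s α (retract R y)) (field s α 0)
    have h3 := mul_le_mul_of_nonneg_left (norm_retract_le hR y) K.coe_nonneg
    linarith
  refine ⟨‖field s α 0‖ + K * R, by positivity, hM, fun x₀ T hT => ?_⟩
  have hlip : LipschitzWith (K * 2) fun y => field s α (retract R y) := by
    rw [← lipschitzOnWith_univ]
    exact hK.comp (lipschitzWith_retract hR).lipschitzOnWith fun y _ => hmem y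
  exact exists_integral_curve hlip (L := (‖field s α 0‖ + K * R).toNNReal)
    (fun y => (hM y).trans (Real.le_coe_toNNReal _)) x₀ hT

theorem isCurve_of_truncated {s : ℝ} {α : ℤ → ℂ} {R T : ℝ} (hR : 0 < R) {x : ℝ → L2T}
    (hx : Continuous x)
    (heq : ∀ t ∈ Set.Icc 0 T, x t = x 0 + ∫ τ in (0 : ℝ)..t, field s α (retract R (x τ)))
    (hxR : ∀ t ∈ Set.Icc 0 T, ‖x t‖ ≤ R) : IsCurve s α T x := by
  refine ⟨hx, fun t ht => (heq t ht).trans ?_⟩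
  congr 1
  refine intervalIntegral.integral_congr fun τ hτ => ?_
  rw [Set.uIcc_of_le ht.1] at hτ
  simp only [retract_of_norm_le hR (hxR τ ⟨hτ.1, hτ.2.trans ht.2⟩)]

theorem exists_wellPosedOnBall {s : ℝ} (hs : 0 ≤ s) {a : ℝ → ℝ} (ha : SmoothPeriodic a)
    (ρ : ℝ≥0) : ∃ T : ℝ, 0 < T ∧ WellPosedOnBall a s ρ T := by
  have hρ : 0 ≤ ρ / nrm := div_nonneg ρ.coe_nonneg nrm_pos.le
  have hR : 0 < ρ / nrm + 1 := by positivity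
  obtain ⟨M, hM0, hM, hex⟩ := exists_truncated_curve s (pcoeff a) hR
  have hT : 0 < 1 / (M + 1) := by positivity
  refine ⟨1 / (M + 1), hT, wellPosedOnBall_of_exists hs ha (R := ρ / nrm + 1) hT.le
    fun x₀ hx₀ => ?_⟩
  obtain ⟨x, hx, hx0, heq⟩ := hex x₀ hT.le
  have hb : ∀ t ∈ Set.Icc 0 (1 / (M + 1)), ‖x t‖ ≤ ρ / nrm + 1 := by
    intro t ht
    rw [heq t ht, hx0]
    have h1 := intervalIntegral.norm_integral_le_of_norm_le_const (a := 0) (b := t)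
      (f := fun τ => field s (pcoeff a) (retract (ρ / nrm + 1) (x τ))) (fun τ _ => hM (x τ))
    rw [sub_zero, abs_of_nonneg ht.1] at h1
    have h2 : M * t ≤ 1 := by
      calc M * t ≤ (M + 1) * (1 / (M + 1)) := by
            apply mul_le_mul _ ht.2 ht.1 (by positivity); linarith
        _ = 1 := by field_simp
    exact (norm_add_le _ _).trans (by linarith)
  exact ⟨x, isCurve_of_truncated hR hx heq hb, hx0, hb⟩

/-! ### The energy identity in `H¹` -/

theorem wt_one_sq (n : ℤ) : wt 1 n ^ 2 = jap n := by rw [wt_sq, Real.rpow_one]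

theorem abs_le_wt_one (n : ℤ) : |(n : ℝ)| ≤ wt 1 n := abs_le_jap_rpow n

/-- The operator `∂ₓ (1 - ∂ₓ²)^{-1/2}`: the derivative of `smoothing 1 x`. -/
def derivOp : L2T →L[ℝ] L2T := mult fun n => Complex.I * n * (wt 1 n : ℂ)⁻¹

theorem coeff_derivOp (x : L2T) (n : ℤ) :
    coeff (derivOp x) n = Complex.I * n * coeff (smoothing 1 x) n := by
  rw [derivOp, coeff_mult (C := 1), coeff_smoothing zero_le_one, mul_assoc]
  · intro n; simp [wt_neg]
  · intro n
    rw [norm_mul, norm_mul, Complex.norm_I, one_mul, Complex.norm_intCast, norm_inv,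
      Complex.norm_real, Real.norm_of_nonneg (wt_pos 1 n).le, ← div_eq_mul_inv,
      div_le_one (wt_pos 1 n)]
    exact abs_le_wt_one n

theorem isWeakDeriv_of_coeff {f g : L2T} (h : ∀ n, coeff g n = Complex.I * n * coeff f n) :
    IsWeakDeriv f g := by
  intro φ hφ
  rw [integral_mul_smooth f hφ.deriv, integral_mul_smooth g hφ]
  have h1 := hasSum_coeff_mul_conj f hφ.deriv.toL2
  have h2 := (hasSum_coeff_mul_conj g hφ.toL2).neg
  have h3 := h1.unique (h2.congr_fun fun n => by
    rw [coeff_toL2, coeff_toL2, pcoeff_deriv hφ, h]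
    simp
    ring)
  rw [← Complex.ofReal_neg, Complex.ofReal_inj, ← mul_neg] at h3
  exact mul_left_cancel₀ (by positivity) h3

theorem isWeakDeriv_smoothing (x : L2T) : IsWeakDeriv (smoothing 1 x) (derivOp x) :=
  isWeakDeriv_of_coeff (coeff_derivOp x)

theorem ae_volume_of_haar {p : Torus → Prop} (h : ∀ᵐ x ∂haarT, p x) : ∀ᵐ x, p x := by
  rw [AddCircle.volume_eq_smul_haarAddCircle]
  exact (Measure.smul_absolutelyContinuous (c := ENNReal.ofReal (2 * Real.pi))).ae_le h

/-- A function with absolutely summable Fourier coefficients agrees almost everywhere with the sum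
of its Fourier series, a continuous function. -/
theorem exists_continuous_rep {f : L2T} (hf : Summable fun n => ‖coeff f n‖) :
    ∃ g : C(Torus, ℂ), (∀ᵐ y, ((f y : ℝ) : ℂ) = g y) ∧
      ∀ y, HasSum (fun n => coeff f n * fourier n y) (g y) := by
  have hs : Summable fun n => coeff f n • (fourier n : C(Torus, ℂ)) := by
    refine Summable.of_norm ?_
    simpa only [norm_smul, fourier_norm, mul_one] using hf
  refine ⟨∑' n, coeff f n • (fourier n : C(Torus, ℂ)), ?_, fun y => ?_⟩
  · have h1 := hs.hasSum.mapL (ContinuousMap.toLp (E := ℂ) 2 haarT ℂ)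
    have h2 := hasSum_fourier_series_L2 ((memLp_ofReal_haar f).toLp _)
    have h3 : ∀ n, fourierCoeff ((memLp_ofReal_haar f).toLp _) n = coeff f n := fun n =>
      congrFun (fourierCoeff_congr_ae (memLp_ofReal_haar f).coeFn_toLp) n
    simp only [h3] at h2
    have h4 := h2.unique (h1.congr_fun fun n => by simp)
    refine ae_volume_of_haar ?_
    have h5 := ContinuousMap.coeFn_toLp (𝕜 := ℂ) (p := 2) haarT
      (∑' n, coeff f n • (fourier n : C(Torus, ℂ)))
    rw [← h4] at h5
    filter_upwards [h5, (memLp_ofReal_haar f).coeFn_toLp] with y hy hy2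
    rw [← hy, hy2]
  · have := hs.hasSum.mapL (ContinuousMap.evalCLM ℂ y)
    simpa [-fourier_apply] using this

theorem summable_norm_coeff_smoothing_one (x : L2T) :
    Summable fun n => ‖coeff (smoothing 1 x) n‖ := by
  have h := (summable_mul_and_sq_tsum_le (f := fun n => (wt 1 n)⁻¹) (g := fun n => ‖coeff x n‖)
    (fun n => inv_nonneg.2 (wt_pos 1 n).le) (fun n => norm_nonneg _)
    (by simpa only [inv_pow, wt_one_sq] using summable_inv_jap) (summable_sq_norm_coeff x)).1
  refine h.congr fun n => ?_
  rw [coeff_smoothing zero_le_one, norm_mul, norm_inv, Complex.norm_real,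
    Real.norm_of_nonneg (wt_pos 1 n).le]

theorem exists_ae_bound_smoothing_one (x : L2T) :
    ∃ C, ∀ᵐ y ∂haarT, ‖((smoothing 1 x y : ℝ) : ℂ)‖ ≤ C := by
  obtain ⟨g, hg, -⟩ := exists_continuous_rep (summable_norm_coeff_smoothing_one x)
  refine ⟨‖g‖, ae_haar_of_volume ?_⟩
  filter_upwards [hg] with y hy
  rw [hy]
  exact g.norm_coe_le_norm y

theorem memLp_smoothing_one_mul (x : L2T) {F : Torus → ℂ} (hF : MemLp F 2 haarT) :
    MemLp (fun y => ((smoothing 1 x y : ℝ) : ℂ) * F y) 2 haarT := by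
  obtain ⟨C, hC⟩ := exists_ae_bound_smoothing_one x
  refine hF.of_le_mul (c := C) ((memLp_ofReal_haar _).1.mul hF.1) ?_
  filter_upwards [hC] with y hy
  rw [norm_mul]
  gcongr

theorem inner_dispOp (x : L2T) : ⟪x, dispOp x⟫_ℝ = 0 := by
  have h := hasSum_inner x (dispOp x)
  have h0 : ∀ n, (coeff x n * conj (coeff (dispOp x) n)).re = 0 := fun n => by
    have : coeff x n * conj (coeff (dispOp x) n)
        = ((n / jap n * Complex.normSq (coeff x n) : ℝ) : ℂ) * Complex.I := by
      rw [coeff_dispOp, map_mul, mul_left_comm, Complex.mul_conj, dispSym]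
      simp
      ring
    rw [this, Complex.re_ofReal_mul, Complex.I_re, mul_zero]
  simp only [h0] at h
  have := h.unique hasSum_zero
  exact (mul_eq_zero.1 this).resolve_left (by positivity)

/-- For `u` in `H¹` the integral of `u² uₓ` vanishes: integrating by parts in frequency space turns
it into `-2` times itself. -/
theorem fourierCoeff_deriv_mul_sq (x : L2T) :
    fourierCoeff (fun y => ((derivOp x y : ℝ) : ℂ) *
      (((smoothing 1 x y : ℝ) : ℂ) * ((smoothing 1 x y : ℝ) : ℂ))) 0 = 0 := by
  set f : Torus → ℂ := fun y => ((smoothing 1 x y : ℝ) : ℂ) with hf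
  set p : Torus → ℂ := fun y => ((derivOp x y : ℝ) : ℂ) with hp
  have mf : MemLp f 2 haarT := memLp_ofReal_haar _
  have mp : MemLp p 2 haarT := memLp_ofReal_haar _
  have mff : MemLp (fun y => f y * f y) 2 haarT := memLp_smoothing_one_mul x mf
  have mfp : MemLp (fun y => f y * p y) 2 haarT := memLp_smoothing_one_mul x mp
  have hpc : ∀ n, fourierCoeff p n = Complex.I * n * fourierCoeff f n := coeff_derivOp x
  -- the Leibniz rule `(u²)ₓ = 2 u uₓ`
  have hleib : ∀ n : ℤ, Complex.I * n * fourierCoeff (fun y => f y * f y) n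
      = 2 * fourierCoeff (fun y => f y * p y) n := by
    intro n
    have h1 := hasSum_fourierCoeff_mul mf mp n
    have h2 := hasSum_fourierCoeff_mul mp mf n
    have h3 := (hasSum_fourierCoeff_mul mf mf n).mul_left (Complex.I * n)
    have hcomm : (fun y => p y * f y) = fun y => f y * p y := by ext y; ring
    rw [hcomm] at h2
    refine Eq.trans ?_ (two_mul _).symm
    refine h3.unique ((h1.add h2).congr_fun fun k => ?_)
    rw [hpc, hpc]
    push_cast
    ring
  have h1 := hasSum_fourierCoeff_mul mp mff 0
  have h2 := (hasSum_fourierCoeff_mul mf mfp 0).mul_left (-2)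
  have h3 := h1.unique (h2.congr_fun fun n => by
    have := hleib (0 - n)
    push_cast at this
    rw [hpc]
    linear_combination (-fourierCoeff f n) * this)
  have hcomm : (fun y => f y * (f y * p y)) = fun y => p y * (f y * f y) := by ext y; ring
  rw [hcomm] at h3
  linear_combination (1 / 3) * h3

theorem inner_quadOp (x : L2T) : ⟪x, quadOp 1 x x⟫_ℝ = 0 := by
  set f : Torus → ℂ := fun y => ((smoothing 1 x y : ℝ) : ℂ) with hf
  set p : Torus → ℂ := fun y => ((derivOp x y : ℝ) : ℂ) with hp
  have mf : MemLp f 2 haarT := memLp_ofReal_haar _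
  have mp : MemLp p 2 haarT := memLp_ofReal_haar _
  have mff : MemLp (fun y => f y * f y) 2 haarT := memLp_smoothing_one_mul x mf
  have hq : ∀ n, coeff (quadOp 1 x x) n
      = (wt 1 n : ℂ) * (dispSym n / 2) * fourierCoeff (fun y => f y * f y) n := by
    intro n
    rw [coeff_quadOp zero_le_one, ← (hasSum_fourierCoeff_mul mf mf n).tsum_eq, ← tsum_mul_left]
    congr 1; ext k
    have h1 : fourierCoeff f k = (wt 1 k : ℂ)⁻¹ * coeff x k := coeff_smoothing zero_le_one x k
    have h2 : fourierCoeff f (n - k) = (wt 1 (n - k) : ℂ)⁻¹ * coeff x (n - k) :=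
      coeff_smoothing zero_le_one x _
    rw [h1, h2, quadKer]
    ring
  have h1 := hasSum_coeff_mul_conj x (quadOp 1 x x)
  have h2 := (hasSum_fourierCoeff_mul mp mff 0).mul_left (1 / 2)
  rw [fourierCoeff_deriv_mul_sq x, mul_zero] at h2
  have h3 := h1.unique (h2.congr_fun fun n => by
    have hpc : fourierCoeff p n = Complex.I * n * ((wt 1 n : ℂ)⁻¹ * coeff x n) := by
      rw [← coeff_smoothing zero_le_one]; exact coeff_derivOp x n
    rw [← coeff_neg_index, hq, zero_sub, hpc, wt_neg, dispSym, jap_neg, ← wt_one_sq]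
    have := wt_ne 1 n
    push_cast
    field_simp)
  rw [← Complex.ofReal_zero, Complex.ofReal_inj] at h3
  exact (mul_eq_zero.1 h3).resolve_left (by positivity)

/-- The damping operator on `H¹` represents the bilinear form `∫ a uₓ vₓ`. -/
theorem inner_dampOp {a : ℝ → ℝ} (ha : SmoothPeriodic a) (x y : L2T) :
    ⟪dampOp 1 (pcoeff a) x, y⟫_ℝ =
      ∫ z in (0 : ℝ)..(2 * Real.pi), a z * (derivOp x (z : Torus) * derivOp y (z : Torus)) := by
  set A : Torus → ℂ := fun z => ((ha.lift z : ℝ) : ℂ) with hA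
  set p : Torus → ℂ := fun z => ((derivOp x z : ℝ) : ℂ) with hp
  set q : Torus → ℂ := fun z => ((derivOp y z : ℝ) : ℂ) with hq
  have mp : MemLp p 2 haarT := memLp_ofReal_haar _
  have mq : MemLp q 2 haarT := memLp_ofReal_haar _
  have mA : MemLp A 2 haarT := memLp_lift_haar ha
  have mpA : MemLp (fun z => p z * A z) 2 haarT := by
    refine mp.of_le_mul (c := ‖ha.lift‖) (mp.1.mul mA.1) (Eventually.of_forall fun z => ?_)
    rw [norm_mul, mul_comm]
    gcongr
    simpa [hA] using ha.lift.norm_coe_le_norm z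
  have hpc : ∀ n, fourierCoeff p n = Complex.I * n * ((wt 1 n : ℂ)⁻¹ * coeff x n) := fun n => by
    rw [← coeff_smoothing zero_le_one]; exact coeff_derivOp x n
  have hqc : ∀ n, fourierCoeff q n = Complex.I * n * ((wt 1 n : ℂ)⁻¹ * coeff y n) := fun n => by
    rw [← coeff_smoothing zero_le_one]; exact coeff_derivOp y n
  have h1 := hasSum_coeff_mul_conj (dampOp 1 (pcoeff a) x) y
  have h2 := hasSum_fourierCoeff_mul mpA mq 0
  have h3 := h1.unique (h2.congr_fun fun n => by
    rw [zero_sub, hqc, coeff_neg_index, wt_neg, coeff_dampOp _ (herm_pcoeff ha)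
      (rapidDecay_pcoeff ha), ← (hasSum_fourierCoeff_mul mp mA n).tsum_eq, ← tsum_mul_right,
      ← tsum_mul_right]
    congr 1; ext k
    have hAk : fourierCoeff A (n - k) = pcoeff a (n - k) := fourierCoeff_lift ha _
    rw [hpc, hAk, dampKer, ← wt_one_sq]
    have := wt_ne 1 n
    have := wt_ne 1 k
    push_cast
    field_simp
    rw [Complex.I_sq]
    ring)
  have h4 : fourierCoeff (fun z => p z * A z * q z) 0 = (((2 * Real.pi)⁻¹ *
      ∫ z in (0 : ℝ)..(2 * Real.pi),
        a z * (derivOp x (z : Torus) * derivOp y (z : Torus)) : ℝ) : ℂ) := by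
    have e := integral_torus fun z => ha.lift z * (derivOp x z * derivOp y z)
    simp only [SmoothPeriodic.lift_coe] at e
    rw [e, fourierCoeff, AddCircle.integral_haarAddCircle, Complex.ofReal_mul,
      ← integral_complex_ofReal, Complex.real_smul]
    congr 1
    congr 1; ext z
    simp only [neg_zero, fourier_zero, one_smul]
    simp only [hp, hA, hq]
    push_cast
    ring
  rw [h4, Complex.ofReal_inj] at h3
  exact mul_left_cancel₀ (by positivity) h3

theorem inner_dampOp_comm {a : ℝ → ℝ} (ha : SmoothPeriodic a) (x y : L2T) :
    ⟪dampOp 1 (pcoeff a) x, y⟫_ℝ = ⟪x, dampOp 1 (pcoeff a) y⟫_ℝ := by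
  rw [real_inner_comm _ x, inner_dampOp ha, inner_dampOp ha]
  congr 1; ext z; ring

theorem inner_dampOp_nonneg {a : ℝ → ℝ} (ha : SmoothPeriodic a) (ha0 : ∀ x, 0 ≤ a x) (x : L2T) :
    0 ≤ ⟪dampOp 1 (pcoeff a) x, x⟫_ℝ := by
  rw [inner_dampOp ha]
  exact intervalIntegral.integral_nonneg Real.two_pi_pos.le fun z _ =>
    mul_nonneg (ha0 z) (mul_self_nonneg _)

/-- The transport terms conserve the `H¹` norm, which is therefore dissipated by the damping
only. -/
theorem inner_field_one {α : ℤ → ℂ} (x : L2T) :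
    ⟪x, field 1 α x⟫_ℝ = -⟪dampOp 1 α x, x⟫_ℝ := by
  rw [field, inner_sub_right, inner_add_right, inner_dispOp, inner_quadOp, real_inner_comm]
  ring

theorem IsCurve.norm_sq {α : ℤ → ℂ} {T : ℝ} {x : ℝ → L2T} (hx : IsCurve 1 α T x) {t : ℝ}
    (ht : t ∈ Set.Icc 0 T) :
    ‖x t‖ ^ 2 = ‖x 0‖ ^ 2 - 2 * ∫ τ in (0 : ℝ)..t, ⟪dampOp 1 α (x τ), x τ⟫_ℝ := by
  rw [norm_sq_eq_of_integral_eq ((continuous_field 1 α).comp hx.1) hx.2 ht, sub_eq_add_neg,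
    ← mul_neg, ← intervalIntegral.integral_neg, ← intervalIntegral.integral_const_mul]
  simp only [Function.comp, inner_field_one]

theorem continuous_inner_dampOp (α : ℤ → ℂ) {x : ℝ → L2T} (hx : Continuous x) :
    Continuous fun τ => ⟪dampOp 1 α (x τ), x τ⟫_ℝ :=
  ((dampOp 1 α).continuous.comp hx).inner hx

theorem IsCurve.norm_sq_antitone {a : ℝ → ℝ} (ha : SmoothPeriodic a) (ha0 : ∀ x, 0 ≤ a x) {T : ℝ}
    {x : ℝ → L2T} (hx : IsCurve 1 (pcoeff a) T x) :
    AntitoneOn (fun t => ‖x t‖ ^ 2) (Set.Icc 0 T) := by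
  intro t ht r hr htr
  have hi := fun c d => (continuous_inner_dampOp (pcoeff a) hx.1).intervalIntegrable
    (μ := volume) c d
  have h := intervalIntegral.integral_add_adjacent_intervals (hi 0 t) (hi t r)
  have h2 : 0 ≤ ∫ τ in t..r, ⟪dampOp 1 (pcoeff a) (x τ), x τ⟫_ℝ :=
    intervalIntegral.integral_nonneg htr fun τ _ => inner_dampOp_nonneg ha ha0 _
  simp only [hx.norm_sq ht, hx.norm_sq hr]
  linarith

theorem IsCurve.norm_antitone {a : ℝ → ℝ} (ha : SmoothPeriodic a) (ha0 : ∀ x, 0 ≤ a x) {T : ℝ}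
    {x : ℝ → L2T} (hx : IsCurve 1 (pcoeff a) T x) :
    AntitoneOn (fun t => ‖x t‖) (Set.Icc 0 T) := fun _ ht _ hr htr =>
  abs_le_of_sq_le_sq' (hx.norm_sq_antitone ha ha0 ht hr htr) (norm_nonneg _) |>.2

/-- Global existence in `H¹`: the dissipation keeps solutions of the truncated equation inside the
ball where the truncation has no effect. -/
theorem exists_isCurve_one {a : ℝ → ℝ} (ha : SmoothPeriodic a) (ha0 : ∀ x, 0 ≤ a x) {R T : ℝ}
    (hT : 0 ≤ T) {x₀ : L2T} (hx₀ : ‖x₀‖ ≤ R) :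
    ∃ x, IsCurve 1 (pcoeff a) T x ∧ x 0 = x₀ ∧ ∀ t ∈ Set.Icc 0 T, ‖x t‖ ≤ R := by
  have hR : 0 < R + 1 := by linarith [norm_nonneg x₀]
  obtain ⟨M, -, -, hex⟩ := exists_truncated_curve 1 (pcoeff a) hR
  obtain ⟨x, hx, hx0, heq⟩ := hex x₀ hT
  have hneg : ∀ y : L2T, ⟪y, field 1 (pcoeff a) (retract (R + 1) y)⟫_ℝ ≤ 0 := by
    intro y
    have hm : 0 < max (R + 1) ‖y‖ := lt_max_of_lt_left hR
    have h1 : (R + 1) / max (R + 1) ‖y‖ * ⟪y, field 1 (pcoeff a) (retract (R + 1) y)⟫_ℝ ≤ 0 := by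
      rw [← real_inner_smul_left]
      change ⟪retract (R + 1) y, _⟫_ℝ ≤ 0
      rw [inner_field_one]
      linarith [inner_dampOp_nonneg ha ha0 (retract (R + 1) y)]
    exact nonpos_of_mul_nonpos_right h1 (div_pos hR hm)
  have hc : Continuous fun τ => field 1 (pcoeff a) (retract (R + 1) (x τ)) :=
    (continuous_field 1 _).comp ((lipschitzWith_retract hR).continuous.comp hx)
  have hb : ∀ t ∈ Set.Icc 0 T, ‖x t‖ ≤ R := by
    intro t ht
    have h := norm_sq_eq_of_integral_eq hc heq ht
    have h2 : ∫ τ in (0 : ℝ)..t, 2 * ⟪x τ, field 1 (pcoeff a) (retract (R + 1) (x τ))⟫_ℝ ≤ 0 := by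
      rw [intervalIntegral.integral_of_le ht.1]
      exact integral_nonpos fun τ => mul_nonpos_of_nonneg_of_nonpos zero_le_two (hneg (x τ))
    rw [hx0] at h
    exact (abs_le_of_sq_le_sq' (by linarith) (norm_nonneg _) |>.2).trans hx₀
  exact ⟨x, isCurve_of_truncated hR hx heq fun t ht => (hb t ht).trans (by linarith), hx0, hb⟩

theorem wellPosedOnBall_one {a : ℝ → ℝ} (ha : SmoothPeriodic a) (ha0 : ∀ x, 0 ≤ a x) (ρ : ℝ≥0)
    {T : ℝ} (hT : 0 ≤ T) : WellPosedOnBall a 1 ρ T :=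
  wellPosedOnBall_of_exists zero_le_one ha hT fun _ hx₀ => exists_isCurve_one ha ha0 hT hx₀

theorem IsCurve.mono {s : ℝ} {α : ℤ → ℂ} {T T' : ℝ} {x : ℝ → L2T} (hx : IsCurve s α T x)
    (h : T' ≤ T) : IsCurve s α T' x := ⟨hx.1, fun t ht => hx.2 t ⟨ht.1, ht.2.trans h⟩⟩

theorem exists_global_solution {a : ℝ → ℝ} (ha : SmoothPeriodic a) (ha0 : ∀ x, 0 ≤ a x)
    {u₀ : L2T} (hu₀ : MemSob 1 u₀) :
    ∃ u : ℝ → L2T, ∀ T : ℝ, 0 < T → IsSolution a 1 T u₀ u := by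
  obtain ⟨x₀, rfl⟩ := exists_smoothing_eq zero_le_one hu₀
  choose! x hx hx0 _ using fun T (hT : 0 ≤ T) => exists_isCurve_one ha ha0 hT (le_refl ‖x₀‖)
  have hcons : ∀ {t T : ℝ}, 0 ≤ t → t ≤ T → x t t = x T t := by
    intro t T h0 hT
    exact (hx t h0).eqOn ((hx T (h0.trans hT)).mono hT) (by rw [hx0 t h0, hx0 T (h0.trans hT)])
      ⟨h0, le_rfl⟩
  refine ⟨fun t => smoothing 1 (x t t), fun T hT => ?_⟩
  refine (isSolution_iff zero_le_one ha hT.le).2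
    ⟨by simp only [hx0 0 le_rfl], x T, hx T hT.le, fun t ht => ?_⟩
  simp only [hcons ht.1 ht.2]

theorem constFn_eq_toL2 (c : ℝ) (h : SmoothPeriodic fun _ => c) : constFn c = h.toL2 := by
  refine Lp.ext ?_
  filter_upwards [Lp.coeFn_const (p := 2) (μ := (volume : Measure Torus)) c, coeFn_toL2 h]
    with y hy hy2
  rw [constFn, hy, hy2]
  induction y using QuotientAddGroup.induction_on with
  | H y => rfl

theorem coeff_constFn (c : ℝ) (n : ℤ) : coeff (constFn c) n = if n = 0 then (c : ℂ) else 0 := by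
  have h : SmoothPeriodic fun _ => c := ⟨contDiff_const, fun _ => rfl⟩
  rw [constFn_eq_toL2 c h, coeff_toL2]
  split_ifs with hn
  · subst hn
    have : (Real.pi : ℂ) ≠ 0 := by exact_mod_cast Real.pi_ne_zero
    simp [pcoeff]
    field_simp
  · have h1 := pcoeff_deriv h n
    have h2 : deriv (fun _ : ℝ => c) = fun _ => 0 := by ext; simp
    rw [h2, pcoeff_zero, eq_comm] at h1
    refine (mul_eq_zero.1 h1).resolve_left ?_
    simp [hn]

theorem smoothing_constFn {s : ℝ} (hs : 0 ≤ s) (c : ℝ) : smoothing s (constFn c) = constFn c := by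
  refine ext_coeff fun n => ?_
  rw [coeff_smoothing hs, coeff_constFn]
  split_ifs with hn
  · subst hn; simp [wt, jap]
  · simp

theorem coeff_zero_eq_mean (f : L2T) : coeff f 0 = mean f := by
  rw [coeff, fourierCoeff, AddCircle.integral_haarAddCircle, mean, Complex.ofReal_mul,
    ← integral_complex_ofReal, Complex.real_smul]
  simp

/-- The mean value is conserved. -/
theorem IsCurve.coeff_zero {s : ℝ} (hs : 0 ≤ s) {a : ℝ → ℝ} (ha : SmoothPeriodic a) {T : ℝ}
    {x : ℝ → L2T} (hx : IsCurve s (pcoeff a) T x) {t : ℝ} (ht : t ∈ Set.Icc 0 T) :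
    coeff (x t) 0 = coeff (x 0) 0 := by
  have h0 : ∀ y, coeff (field s (pcoeff a) y) 0 = 0 := fun y => by
    rw [field, coeff_sub, coeff_add, coeff_dispOp, coeff_quadOp hs,
      coeff_dampOp _ (herm_pcoeff ha) (rapidDecay_pcoeff ha)]
    simp [dispSym, quadKer, dampKer]
  have hc : Continuous fun τ => field s (pcoeff a) (x τ) := (continuous_field s _).comp hx.1
  have h1 := (coeffL 0).intervalIntegral_comp_comm (hc.intervalIntegrable (μ := volume) 0 t)
  simp only [coeffL_apply, h0, intervalIntegral.integral_zero] at h1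
  rw [hx.2 t ht, coeff_add, ← h1, add_zero]

theorem inner_constFn (x : L2T) (c : ℝ) :
    ⟪x, constFn c⟫_ℝ = 2 * Real.pi * (c * (coeff x 0).re) := by
  have h1 := hasSum_inner x (constFn c)
  have h2 := hasSum_single (f := fun n => (coeff x n * conj (coeff (constFn c) n)).re) 0
    (fun n hn => by simp [coeff_constFn, hn])
  have h3 := h1.unique h2
  rw [coeff_constFn, if_pos rfl, Complex.conj_ofReal, mul_comm (coeff x 0),
    Complex.re_ofReal_mul] at h3
  rw [← h3, mul_inv_cancel_left₀ (by positivity)]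

/-- The energy inequality and the dissipation identity for solutions in `H¹`. -/
theorem dissipation {a : ℝ → ℝ} (ha : SmoothPeriodic a) (ha0 : ∀ x, 0 ≤ a x) {u₀ : L2T} {T : ℝ}
    {u : ℝ → L2T} (hT : 0 < T) (hu : IsSolution a 1 T u₀ u) (c : ℝ) :
    AntitoneOn (fun t => sobNorm 1 (u t - constFn c)) (Set.Icc 0 T) ∧
      AntitoneOn (fun t => sobNorm 1 (u t)) (Set.Icc 0 T) ∧
      ∃ ux : ℝ → L2T,
        (∀ t ∈ Set.Icc 0 T, IsWeakDeriv (u t) (ux t)) ∧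
        IntervalIntegrable
          (fun t => ∫ x in (0 : ℝ)..(2 * Real.pi), a x * ux t (x : Torus) ^ 2) volume 0 T ∧
        ∀ t ∈ Set.Icc 0 T,
          (1 / 2) * (sobNorm 1 (u t)).toReal ^ 2 - (1 / 2) * (sobNorm 1 u₀).toReal ^ 2 +
            (2 * Real.pi)⁻¹ * (∫ τ in (0 : ℝ)..t, ∫ x in (0 : ℝ)..(2 * Real.pi),
              a x * ux τ (x : Torus) ^ 2) = 0 := by
  obtain ⟨hu0, x, hx, hux⟩ := (isSolution_iff zero_le_one ha hT.le).1 hu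
  have h0T : (0 : ℝ) ∈ Set.Icc 0 T := ⟨le_rfl, hT.le⟩
  have hsq : ∀ y : L2T, ∫ z in (0 : ℝ)..(2 * Real.pi), a z * derivOp y (z : Torus) ^ 2
      = ⟪dampOp 1 (pcoeff a) y, y⟫_ℝ := fun y => by
    rw [inner_dampOp ha]; simp only [sq]
  refine ⟨fun t ht r hr htr => ?_, fun t ht r hr htr => ?_, fun t => derivOp (x t),
    fun t ht => ?_, ?_, fun t ht => ?_⟩
  · simp only
    rw [hux t ht, hux r hr, ← smoothing_constFn zero_le_one c, sobNorm_smoothing_sub zero_le_one,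
      sobNorm_smoothing_sub zero_le_one]
    refine ENNReal.ofReal_le_ofReal (mul_le_mul_of_nonneg_left ?_ nrm_pos.le)
    refine abs_le_of_sq_le_sq' ?_ (norm_nonneg _) |>.2
    have := hx.norm_sq_antitone ha ha0 ht hr htr
    simp only at this
    rw [norm_sub_sq_real, norm_sub_sq_real, inner_constFn, inner_constFn,
      hx.coeff_zero zero_le_one ha ht, hx.coeff_zero zero_le_one ha hr]
    linarith
  · simp only
    rw [hux t ht, hux r hr, sobNorm_smoothing zero_le_one, sobNorm_smoothing zero_le_one]
    exact ENNReal.ofReal_le_ofReal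
      (mul_le_mul_of_nonneg_left (hx.norm_antitone ha ha0 ht hr htr) nrm_pos.le)
  · rw [hux t ht]; exact isWeakDeriv_smoothing _
  · simp only [hsq]
    exact (continuous_inner_dampOp _ hx.1).intervalIntegrable _ _
  · simp only [hsq]
    rw [hux t ht, ← hu0, hux 0 h0T, sobNorm_smoothing zero_le_one, sobNorm_smoothing zero_le_one,
      ENNReal.toReal_ofReal (mul_nonneg nrm_pos.le (norm_nonneg _)),
      ENNReal.toReal_ofReal (mul_nonneg nrm_pos.le (norm_nonneg _)), mul_pow, mul_pow, nrm_sq,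
      hx.norm_sq ht]
    ring

/-! ### Weak convergence and compactness -/

theorem sobNorm_smoothing_one (s : ℝ) (y : L2T) :
    sobNorm s (smoothing 1 y)
      = (∑' n, ENNReal.ofReal (jap n ^ (s - 1) * ‖coeff y n‖ ^ 2)) ^ (1 / 2 : ℝ) := by
  rw [sobNorm]
  congr 2; ext n
  congr 1
  rw [coeff_smoothing zero_le_one, norm_mul, mul_pow, norm_inv, Complex.norm_real,
    Real.norm_of_nonneg (wt_pos 1 n).le, inv_pow, wt_one_sq, Real.rpow_sub (jap_pos n),
    Real.rpow_one]
  change _ * jap n ^ s = _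
  ring

theorem tendsto_jap_cofinite : Tendsto jap cofinite atTop := by
  have h := summable_inv_jap.tendsto_cofinite_zero
  have h2 : Tendsto (fun n => (jap n)⁻¹) cofinite (𝓝[>] 0) :=
    tendsto_nhdsWithin_iff.2 ⟨h, Eventually.of_forall fun n => inv_pos.2 (jap_pos n)⟩
  refine h2.inv_tendsto_nhdsGT_zero.congr fun n => ?_
  simp

/-- Bounded sequences in `H¹` whose Fourier coefficients tend to zero converge to zero in `H^s` for
every `s < 1`: low frequencies tend to zero, high frequencies are uniformly small. -/
theorem tendsto_sobNorm_smoothing_one {ι : Type*} {l : Filter ι} {y : ι → L2T} {M : ℝ}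
    (hM : ∀ᶠ i in l, ‖y i‖ ≤ M) (hy : ∀ n, Tendsto (fun i => coeff (y i) n) l (𝓝 0)) {s : ℝ}
    (hs : s < 1) : Tendsto (fun i => sobNorm s (smoothing 1 (y i))) l (𝓝 0) := by
  have key : Tendsto (fun i => ∑' n, ENNReal.ofReal (jap n ^ (s - 1) * ‖coeff (y i) n‖ ^ 2)) l
      (𝓝 0) := by
    rw [ENNReal.tendsto_nhds_zero]
    intro ε hε
    rcases eq_or_ne ε ∞ with rfl | hεt
    · simp
    have hε' : 0 < ε.toReal := ENNReal.toReal_pos hε.ne' hεt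
    have hjap : Tendsto (fun n => jap n ^ (s - 1)) cofinite (𝓝 0) := by
      have := (tendsto_rpow_neg_atTop (by linarith : 0 < 1 - s)).comp tendsto_jap_cofinite
      simpa [Function.comp_def] using this
    set η : ℝ := ε.toReal / (2 * (M ^ 2 + 1)) with hη
    have hη0 : 0 < η := by positivity
    have hfin : {n | ¬ jap n ^ (s - 1) < η}.Finite :=
      hjap.eventually (gt_mem_nhds hη0)
    set F := hfin.toFinset with hF
    have hsum : Tendsto (fun i => ∑ n ∈ F, jap n ^ (s - 1) * ‖coeff (y i) n‖ ^ 2) l (𝓝 0) := by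
      have := tendsto_finsetSum F fun n _ =>
        (((hy n).norm.pow 2).const_mul (jap n ^ (s - 1)))
      simpa using this
    filter_upwards [hM, hsum.eventually (gt_mem_nhds (half_pos hε'))] with i hi hi2
    have hle : ∀ n, jap n ^ (s - 1) * ‖coeff (y i) n‖ ^ 2 ≤
        (if n ∈ F then jap n ^ (s - 1) * ‖coeff (y i) n‖ ^ 2 else 0)
          + η * ‖coeff (y i) n‖ ^ 2 := by
      intro n
      split_ifs with hn
      · have : 0 ≤ η * ‖coeff (y i) n‖ ^ 2 := by positivity
        linarith
      · have : jap n ^ (s - 1) < η := by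
          by_contra h
          exact hn (hfin.mem_toFinset.2 h)
        rw [zero_add]
        gcongr
    have hs1 : HasSum (fun n => (if n ∈ F then jap n ^ (s - 1) * ‖coeff (y i) n‖ ^ 2 else 0)
        + η * ‖coeff (y i) n‖ ^ 2)
        ((∑ n ∈ F, jap n ^ (s - 1) * ‖coeff (y i) n‖ ^ 2)
          + η * ((2 * Real.pi)⁻¹ * ‖y i‖ ^ 2)) := by
      refine HasSum.add ?_ ((hasSum_sq_norm_coeff (y i)).mul_left η)
      have := hasSum_sum_of_ne_finset_zero (s := F) (L := .unconditional ℤ)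
        (f := fun n => if n ∈ F then jap n ^ (s - 1) * ‖coeff (y i) n‖ ^ 2 else 0)
        (fun n hn => if_neg hn)
      rwa [Finset.sum_congr rfl fun n hn => if_pos hn] at this
    have hnn : ∀ n, 0 ≤ jap n ^ (s - 1) * ‖coeff (y i) n‖ ^ 2 := fun n => by
      have := jap_pos n; positivity
    have hs2 := Summable.of_nonneg_of_le hnn hle hs1.summable
    rw [← ENNReal.ofReal_tsum_of_nonneg hnn hs2]
    refine (ENNReal.ofReal_le_iff_le_toReal hεt).2 ?_
    refine (hs2.tsum_le_tsum hle hs1.summable).trans ?_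
    rw [hs1.tsum_eq]
    have h2 : (2 * Real.pi)⁻¹ ≤ 1 := inv_le_one_of_one_le₀ (by linarith [Real.pi_gt_three])
    have h3 : ‖y i‖ ^ 2 ≤ M ^ 2 := by gcongr
    have h4 : (2 * Real.pi)⁻¹ * ‖y i‖ ^ 2 ≤ M ^ 2 + 1 := by nlinarith [sq_nonneg ‖y i‖]
    have h5 : η * (M ^ 2 + 1) = ε.toReal / 2 := by rw [hη]; field_simp
    nlinarith
  have := key.ennrpow_const (1 / 2)
  simp only [sobNorm_smoothing_one]
  simpa using this

theorem tendsto_norm_smoothing_one {ι : Type*} {l : Filter ι} {y : ι → L2T} {M : ℝ}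
    (hM : ∀ᶠ i in l, ‖y i‖ ≤ M) (hy : ∀ n, Tendsto (fun i => coeff (y i) n) l (𝓝 0)) :
    Tendsto (fun i => ‖smoothing 1 (y i)‖) l (𝓝 0) := by
  have h := tendsto_sobNorm_smoothing_one hM hy zero_lt_one
  have h2 := ((ENNReal.tendsto_toReal ENNReal.zero_ne_top).comp h).const_mul nrm⁻¹
  simp only [ENNReal.toReal_zero, mul_zero] at h2
  refine h2.congr fun i => ?_
  have := sobNorm_smoothing le_rfl (smoothing 1 (y i))
  rw [smoothing_zero] at this
  rw [Function.comp, this, ENNReal.toReal_ofReal (mul_nonneg nrm_pos.le (norm_nonneg _)),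
    inv_mul_cancel_left₀ nrm_pos.ne']

theorem inner_smoothing_comm {s : ℝ} (hs : 0 ≤ s) (x y : L2T) :
    ⟪smoothing s x, y⟫_ℝ = ⟪x, smoothing s y⟫_ℝ := by
  have h1 := hasSum_coeff_mul_conj (smoothing s x) y
  have h2 := hasSum_coeff_mul_conj x (smoothing s y)
  have h3 := h1.unique (h2.congr_fun fun n => by
    rw [coeff_smoothing hs, coeff_smoothing hs, map_mul, map_inv₀, Complex.conj_ofReal]; ring)
  rw [Complex.ofReal_inj] at h3
  exact mul_left_cancel₀ (by positivity) h3

theorem denseRange_smoothing {s : ℝ} (hs : 0 ≤ s) : DenseRange (smoothing s) := by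
  have h : ((smoothing s).range).topologicalClosure = ⊤ := by
    rw [Submodule.topologicalClosure_eq_top_iff, Submodule.eq_bot_iff]
    intro y hy
    refine smoothing_injective hs ?_
    rw [map_zero, ← inner_self_eq_zero (𝕜 := ℝ), inner_smoothing_comm hs, real_inner_comm]
    exact hy _ ⟨smoothing s y, rfl⟩
  have h2 := (Submodule.dense_iff_topologicalClosure_eq_top).2 h
  exact h2

/-- Bounded sequences converge weakly if their Fourier coefficients converge. -/
theorem tendsto_inner_of_coeff {ι : Type*} {l : Filter ι} {y : ι → L2T} {z : L2T} {M : ℝ}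
    (hM : ∀ᶠ i in l, ‖y i‖ ≤ M) (hy : ∀ n, Tendsto (fun i => coeff (y i) n) l (𝓝 (coeff z n)))
    (h : L2T) : Tendsto (fun i => ⟪y i, h⟫_ℝ) l (𝓝 ⟪z, h⟫_ℝ) := by
  have hM' : ∀ᶠ i in l, ‖y i - z‖ ≤ M + ‖z‖ := hM.mono fun i hi =>
    (norm_sub_le _ _).trans (by linarith)
  have hy' : ∀ n, Tendsto (fun i => coeff (y i - z) n) l (𝓝 0) := fun n => by
    simp only [coeff_sub]
    simpa using (hy n).sub_const (coeff z n)
  have hs := tendsto_norm_smoothing_one hM' hy'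
  rw [tendsto_iff_norm_sub_tendsto_zero]
  simp only [← inner_sub_left]
  rw [Metric.tendsto_nhds]
  intro ε hε
  rcases l.eq_or_neBot with rfl | hl
  · simp
  have hMz : 0 ≤ M + ‖z‖ := by
    obtain ⟨i, hi⟩ := hM'.exists
    exact (norm_nonneg _).trans hi
  obtain ⟨g, hg⟩ := (denseRange_smoothing zero_le_one).exists_dist_lt h
    (by positivity : 0 < ε / (2 * (M + ‖z‖ + 1)))
  have hsg := hs.mul_const ‖g‖
  rw [zero_mul] at hsg
  filter_upwards [hM', hsg.eventually (gt_mem_nhds (half_pos hε))] with i hi hi2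
  rw [dist_zero_right, norm_norm]
  have e : ⟪y i - z, h⟫_ℝ = ⟪y i - z, h - smoothing 1 g⟫_ℝ + ⟪smoothing 1 (y i - z), g⟫_ℝ := by
    rw [inner_smoothing_comm zero_le_one, ← inner_add_right, sub_add_cancel]
  rw [e]
  refine (norm_add_le _ _).trans_lt ?_
  have h1 := norm_inner_le_norm (𝕜 := ℝ) (y i - z) (h - smoothing 1 g)
  have h2 := norm_inner_le_norm (𝕜 := ℝ) (smoothing 1 (y i - z)) g
  rw [dist_eq_norm] at hg
  have h3 : ‖y i - z‖ * ‖h - smoothing 1 g‖ ≤ (M + ‖z‖ + 1) * (ε / (2 * (M + ‖z‖ + 1))) :=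
    mul_le_mul (by linarith) hg.le (norm_nonneg _) (by linarith)
  have h4 : (M + ‖z‖ + 1) * (ε / (2 * (M + ‖z‖ + 1))) = ε / 2 := by field_simp
  linarith

/-- Bounded sequences have subsequences with convergent Fourier coefficients. -/
theorem exists_subseq_tendsto_coeff {y : ℕ → L2T} {M : ℝ} (hM : ∀ i, ‖y i‖ ≤ M) :
    ∃ (z : L2T) (φ : ℕ → ℕ), StrictMono φ ∧ ‖z‖ ≤ M ∧
      ∀ n, Tendsto (fun i => coeff (y (φ i)) n) atTop (𝓝 (coeff z n)) := by
  have hM0 : 0 ≤ M := (norm_nonneg _).trans (hM 0)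
  have hcpt : IsCompact (Set.univ.pi fun _ : ℤ => Metric.closedBall (0 : ℂ) M) :=
    isCompact_univ_pi fun _ => isCompact_closedBall _ _
  obtain ⟨c, -, φ, hφ, hc⟩ := hcpt.tendsto_subseq (x := fun i => coeff (y i)) fun i n _ => by
    rw [mem_closedBall_zero_iff]
    exact (norm_coeff_le _ _).trans (hM i)
  have hcn : ∀ n, Tendsto (fun i => coeff (y (φ i)) n) atTop (𝓝 (c n)) := fun n =>
    (tendsto_pi_nhds.1 hc) n
  have hherm : ∀ n, c (-n) = conj (c n) := fun n => by
    refine tendsto_nhds_unique (hcn (-n)) ?_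
    simp only [coeff_neg_index]
    exact (Complex.continuous_conj.tendsto _).comp (hcn n)
  -- Fatou's lemma for series
  have hfin : ∀ F : Finset ℤ, ∑ n ∈ F, ‖c n‖ ^ 2 ≤ (2 * Real.pi)⁻¹ * M ^ 2 := fun F => by
    refine le_of_tendsto (tendsto_finsetSum F fun n _ => (hcn n).norm.pow 2)
      (Eventually.of_forall fun i => ?_)
    refine (sum_le_hasSum F (fun _ _ => sq_nonneg _) (hasSum_sq_norm_coeff (y (φ i)))).trans ?_
    gcongr
    exact hM _
  have hs : Summable fun n => ‖c n‖ ^ 2 := summable_of_sum_le (fun _ => sq_nonneg _) hfin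
  obtain ⟨z, hz⟩ := exists_coeff_eq hherm hs
  refine ⟨z, φ, hφ, norm_le_of_tsum_le hM0 ?_, fun n => by rw [hz]; exact hcn n⟩
  simp only [hz]
  exact hs.tsum_le_of_sum_le hfin

/-! ### Local constancy -/

/-- The open arc of the torus covered by the interval `(α, β)`. -/
def arc (α β : ℝ) : Set Torus := (fun x : ℝ => (x : Torus)) '' Set.Ioo α β

theorem isOpen_arc (α β : ℝ) : IsOpen (arc α β) :=
  QuotientAddGroup.isOpenMap_coe _ isOpen_Ioo

theorem coe_mem_arc_iff {α β z : ℝ} (hβ : β ≤ α + 2 * Real.pi)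
    (hz : z ∈ Set.Ioo α (α + 2 * Real.pi)) : (z : Torus) ∈ arc α β ↔ z < β := by
  constructor
  · rintro ⟨y, hy, hyz⟩
    have h : ((z - y : ℝ) : Torus) = 0 := by
      rw [AddCircle.coe_sub, ← hyz, sub_self]
    obtain ⟨k, hk⟩ := (AddCircle.coe_eq_zero_iff _).1 h
    rw [zsmul_eq_mul] at hk
    have hpi := Real.pi_pos
    have h1 : (k : ℝ) < 1 := by
      by_contra hc
      have : 1 * (2 * Real.pi) ≤ k * (2 * Real.pi) := by gcongr; exact not_lt.1 hc
      linarith [hz.2, hy.1]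
    have h2 : (-1 : ℝ) < k := by
      by_contra hc
      have : k * (2 * Real.pi) ≤ (-1) * (2 * Real.pi) := by gcongr; exact not_lt.1 hc
      linarith [hz.1, hy.2]
    have h3 : k = 0 := by
      have h1' : k < 1 := by exact_mod_cast h1
      have h2' : -1 < k := by exact_mod_cast h2
      omega
    rw [h3] at hk
    simp only [Int.cast_zero, zero_mul] at hk
    linarith [hy.2]
  · intro h
    exact ⟨z, ⟨hz.1, h⟩, rfl⟩

theorem fourierCoeff_indicator_arc {α β : ℝ} (hαβ : α ≤ β) (hβ : β ≤ α + 2 * Real.pi) (n : ℤ) :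
    fourierCoeff ((arc α β).indicator fun _ => (1 : ℂ)) n
      = (1 / (2 * Real.pi)) • ∫ x in α..β, (fourier (-n) (x : Torus) : ℂ) := by
  rw [fourierCoeff_eq_intervalIntegral _ _ α]
  congr 1
  have hcf : Continuous fun x : ℝ => (fourier (-n) (x : Torus) : ℂ) :=
    (map_continuous (fourier _)).comp (AddCircle.continuous_mk' _)
  have hnull : ∀ c : ℝ, ∀ᵐ x : ℝ, x ≠ c := fun c => by
    simp [ae_iff, measure_singleton]
  have e1 : ∫ x in α..β, (fourier (-n) (x : Torus) : ℂ)
        • (arc α β).indicator (fun _ => (1 : ℂ)) (x : Torus)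
      = ∫ x in α..β, (fourier (-n) (x : Torus) : ℂ) := by
    refine intervalIntegral.integral_congr_ae ?_
    filter_upwards [hnull β] with x hx hxm
    rw [Set.uIoc_of_le hαβ] at hxm
    rw [Set.indicator_of_mem, smul_eq_mul, mul_one]
    exact ⟨x, ⟨hxm.1, lt_of_le_of_ne hxm.2 hx⟩, rfl⟩
  have h2 : ∀ᵐ x : ℝ, x ∈ Set.uIoc β (α + 2 * Real.pi) →
      (fourier (-n) (x : Torus) : ℂ) • (arc α β).indicator (fun _ => (1 : ℂ)) (x : Torus) = 0 := by
    filter_upwards [hnull (α + 2 * Real.pi)] with x hx hxm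
    rw [Set.uIoc_of_le hβ] at hxm
    rw [Set.indicator_of_notMem, smul_zero]
    rw [coe_mem_arc_iff hβ ⟨hαβ.trans_lt hxm.1, lt_of_le_of_ne hxm.2 hx⟩]
    exact not_lt.2 hxm.1.le
  have e2 : ∫ x in β..(α + 2 * Real.pi), (fourier (-n) (x : Torus) : ℂ)
        • (arc α β).indicator (fun _ => (1 : ℂ)) (x : Torus) = 0 := by
    rw [intervalIntegral.integral_congr_ae (g := fun _ => 0) h2, intervalIntegral.integral_zero]
  have i1 : IntervalIntegrable (fun x : ℝ => (fourier (-n) (x : Torus) : ℂ)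
        • (arc α β).indicator (fun _ => (1 : ℂ)) (x : Torus)) volume α β := by
    refine (hcf.intervalIntegrable α β).congr_ae ?_
    rw [EventuallyEq, ae_restrict_iff' measurableSet_uIoc]
    filter_upwards [hnull β] with x hx hxm
    rw [Set.uIoc_of_le hαβ] at hxm
    rw [Set.indicator_of_mem, smul_eq_mul, mul_one]
    exact ⟨x, ⟨hxm.1, lt_of_le_of_ne hxm.2 hx⟩, rfl⟩
  have i2 : IntervalIntegrable (fun x : ℝ => (fourier (-n) (x : Torus) : ℂ)
        • (arc α β).indicator (fun _ => (1 : ℂ)) (x : Torus)) volume β (α + 2 * Real.pi) := by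
    refine (intervalIntegrable_const (c := (0 : ℂ))).congr_ae ?_
    rw [EventuallyEq, ae_restrict_iff' measurableSet_uIoc]
    filter_upwards [h2] with x hx hxm
    exact (hx hxm).symm
  rw [← intervalIntegral.integral_add_adjacent_intervals i1 i2, e1, e2, add_zero]

/-- An `H¹` function whose derivative vanishes on an arc is constant there. The increment of the
Fourier series over a subarc is, by Parseval's identity, the integral of the derivative over it. -/
theorem exists_const_of_deriv_eq_zero {x : L2T} {α β : ℝ} (hβ : β ≤ α + 2 * Real.pi)
    (hx : ∀ᵐ y : Torus, y ∈ arc α β → derivOp x y = 0) :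
    ∃ C : ℝ, ∀ᵐ y : Torus, y ∈ arc α β → smoothing 1 x y = C := by
  obtain ⟨g, hg, hgs⟩ := exists_continuous_rep (summable_norm_coeff_smoothing_one x)
  have hinc : ∀ α' β' : ℝ, α < α' → α' ≤ β' → β' < β → g (β' : Torus) = g (α' : Torus) := by
    intro α' β' hα' h' hβ'
    have hi : MemLp ((arc α' β').indicator fun _ => (1 : ℂ)) 2 haarT :=
      memLp_indicator_const 2 (isOpen_arc _ _).measurableSet _ (Or.inr (measure_ne_top _ _))
    have h1 := hasSum_fourierCoeff_mul (memLp_ofReal_haar (derivOp x)) hi 0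
    have h0 : fourierCoeff (fun y => ((derivOp x y : ℝ) : ℂ) *
        (arc α' β').indicator (fun _ => (1 : ℂ)) y) 0 = 0 := by
      rw [fourierCoeff, integral_eq_zero_of_ae]
      filter_upwards [ae_haar_of_volume hx] with y hy
      by_cases hm : y ∈ arc α' β'
      · rw [hy ((Set.image_mono (Set.Ioo_subset_Ioo hα'.le hβ'.le)) hm)]
        simp
      · rw [Set.indicator_of_notMem hm]
        simp
    rw [h0] at h1
    have h2 := ((hgs (β' : Torus)).sub (hgs (α' : Torus))).mul_left (2 * Real.pi : ℂ)⁻¹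
    have h3 := h1.unique (h2.congr_fun fun n => by
      have hpc : fourierCoeff (fun y => ((derivOp x y : ℝ) : ℂ)) n
          = Complex.I * n * coeff (smoothing 1 x) n := coeff_derivOp x n
      have hint := intervalIntegral.integral_eq_sub_of_hasDerivAt (a := α') (b := β')
        (f := fun y : ℝ => (fourier n (y : Torus) : ℂ))
        (f' := fun y : ℝ => Complex.I * n * (fourier n (y : Torus) : ℂ))
        (fun y _ => hasDerivAt_fourier_two_pi n y)
        ((continuous_const.mul ((map_continuous (fourier n)).comp
          (AddCircle.continuous_mk' _))).intervalIntegrable _ _)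
      rw [intervalIntegral.integral_const_mul] at hint
      rw [hpc, zero_sub, fourierCoeff_indicator_arc h' (by linarith), neg_neg, Complex.real_smul]
      push_cast
      rw [← mul_sub, ← hint]
      ring)
    have hpi : (2 * Real.pi : ℂ)⁻¹ ≠ 0 := by
      have : (Real.pi : ℂ) ≠ 0 := by exact_mod_cast Real.pi_ne_zero
      simp [this]
    exact sub_eq_zero.1 ((mul_eq_zero.1 h3.symm).resolve_left hpi)
  refine ⟨(g (((α + β) / 2 : ℝ) : Torus)).re, ?_⟩
  filter_upwards [hg] with y hy hym
  obtain ⟨r, hr, rfl⟩ := hym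
  rw [← Complex.ofReal_re (smoothing 1 x _), hy]
  congr 1
  have hαβ := hr.1.trans hr.2
  rcases le_total r ((α + β) / 2) with h | h
  · exact (hinc _ _ hr.1 h (by linarith)).symm
  · exact hinc _ _ (by linarith) h hr.2

/-- A smooth periodic bump, positive exactly where `|x - x₀| < r` modulo `2π`. -/
def bump (x₀ r : ℝ) (x : ℝ) : ℝ := expNegInvGlue (Real.cos (x - x₀) - Real.cos r)

theorem smoothPeriodic_bump (x₀ r : ℝ) : SmoothPeriodic (bump x₀ r) := by
  refine ⟨expNegInvGlue.contDiff.comp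
    ((Real.contDiff_cos.comp (contDiff_id.sub contDiff_const)).sub contDiff_const), fun x => ?_⟩
  rw [bump, bump, add_sub_right_comm, Real.cos_add_two_pi]

theorem coe_mem_arc_of_cos_lt {x₀ r x : ℝ} (hr : 0 < r)
    (h : Real.cos r < Real.cos (x - x₀)) : (x : Torus) ∈ arc (x₀ - r) (x₀ + r) := by
  have hpi := Real.two_pi_pos
  set θ := toIocMod hpi (-Real.pi) (x - x₀) with hθ
  have hmem := toIocMod_mem_Ioc hpi (-Real.pi) (x - x₀)
  have hx : θ + toIocDiv hpi (-Real.pi) (x - x₀) • (2 * Real.pi) = x - x₀ :=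
    toIocMod_add_toIocDiv_zsmul hpi _ _
  have hcos : Real.cos (x - x₀) = Real.cos |θ| := by
    rw [← hx, zsmul_eq_mul, Real.cos_add_int_mul_two_pi, Real.cos_abs]
  have hθπ : |θ| ≤ Real.pi := abs_le.2 ⟨hmem.1.le, by have := hmem.2; linarith⟩
  have hlt : |θ| < r := by
    by_contra hc
    have := Real.cos_le_cos_of_nonneg_of_le_pi hr.le hθπ (not_lt.1 hc)
    rw [hcos] at h
    linarith
  rw [abs_lt] at hlt
  refine ⟨x₀ + θ, ⟨by linarith, by linarith⟩, ?_⟩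
  have hx2 : x = x₀ + θ + toIocDiv hpi (-Real.pi) (x - x₀) • (2 * Real.pi) := by linarith
  conv_rhs => rw [hx2]
  rw [AddCircle.coe_add, AddCircle.coe_zsmul, AddCircle.coe_period, smul_zero, add_zero]

theorem bump_support {x₀ r x : ℝ} (hr : 0 < r) (hr2 : r < Real.pi)
    (hx : (x : Torus) ∉ arc (x₀ - r) (x₀ + r)) :
    bump x₀ (r / 2) =ᶠ[𝓝 x] fun _ => 0 := by
  have h1 : Real.cos (x - x₀) ≤ Real.cos r := by
    by_contra h
    exact hx (coe_mem_arc_of_cos_lt hr (not_le.1 h))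
  have h2 : Real.cos r < Real.cos (r / 2) :=
    Real.cos_lt_cos_of_nonneg_of_le_pi (by positivity) hr2.le (by linarith)
  have h3 : Continuous fun y => Real.cos (y - x₀) := by fun_prop
  filter_upwards [h3.continuousAt.eventually (gt_mem_nhds (h1.trans_lt h2))] with y hy
  exact expNegInvGlue.zero_of_nonpos (by linarith)

theorem integral_bump_pos (x₀ : ℝ) {r : ℝ} (hr : 0 < r) (hr2 : r < Real.pi) :
    0 < ∫ x in (0 : ℝ)..(2 * Real.pi), bump x₀ r x := by
  have h := (smoothPeriodic_bump x₀ r).2.intervalIntegral_add_eq 0 x₀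
  rw [zero_add] at h
  rw [h]
  have hpi := Real.two_pi_pos
  refine intervalIntegral.integral_pos (by linarith)
    (smoothPeriodic_bump x₀ r).continuous.continuousOn
    (fun x _ => expNegInvGlue.nonneg _) ⟨x₀, ⟨le_rfl, by linarith⟩, ?_⟩
  refine expNegInvGlue.pos_of_pos ?_
  rw [sub_self, Real.cos_zero]
  have := Real.cos_lt_cos_of_nonneg_of_le_pi le_rfl hr2.le hr
  rw [Real.cos_zero] at this
  linarith

theorem integral_deriv_eq_zero {φ : ℝ → ℝ} (h : SmoothPeriodic φ) :
    ∫ x in (0 : ℝ)..(2 * Real.pi), deriv φ x = 0 := by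
  rw [intervalIntegral.integral_deriv_eq_sub (fun x _ => h.differentiable x)
    (h.deriv.continuous.intervalIntegrable _ _)]
  have := h.2 0
  rw [zero_add] at this
  rw [this, sub_self]

/-- Integrals against a smooth function only see the values on its support. -/
theorem integral_mul_eq_of_support {F : Torus → ℝ} {c : ℝ} {S : Set Torus} {φ : ℝ → ℝ}
    (h : SmoothPeriodic φ) (hφ : ∀ x : ℝ, (x : Torus) ∉ S → φ x = 0)
    (hF : ∀ᵐ y : Torus, y ∈ S → F y = c) :
    ∫ x in (0 : ℝ)..(2 * Real.pi), F (x : Torus) * φ x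
      = c * ∫ x in (0 : ℝ)..(2 * Real.pi), φ x := by
  rw [← intervalIntegral.integral_const_mul]
  have e1 := integral_torus fun y => F y * h.lift y
  have e2 := integral_torus fun y => c * h.lift y
  simp only [SmoothPeriodic.lift_coe] at e1 e2
  rw [e1, e2]
  refine integral_congr_ae ?_
  filter_upwards [hF] with y hy
  by_cases hyS : y ∈ S
  · rw [hy hyS]
  · induction y using QuotientAddGroup.induction_on with
    | H y =>
      have : h.lift (y : Torus) = 0 := hφ y hyS
      simp only [this, mul_zero]

/-- A solution of the undamped equation which, at each time, is constant in space on an arc is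
constant in time there. -/
theorem const_in_time {T x₀ r : ℝ} (hr : 0 < r) (hr2 : r < Real.pi) {v₀ : L2T} {v : ℝ → L2T}
    (hv : IsSolution (fun _ => 0) 1 T v₀ v) {C : ℝ → ℝ}
    (hC : ∀ t ∈ Set.Icc 0 T, ∀ᵐ y : Torus, y ∈ arc (x₀ - r) (x₀ + r) → v t y = C t) {t : ℝ}
    (ht : t ∈ Set.Icc 0 T) : C t = C 0 := by
  have hφ := smoothPeriodic_bump x₀ (r / 2)
  have h0T : (0 : ℝ) ∈ Set.Icc 0 T := ⟨le_rfl, ht.1.trans ht.2⟩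
  have hd : ∀ x : ℝ, (x : Torus) ∉ arc (x₀ - r) (x₀ + r) → deriv (bump x₀ (r / 2)) x = 0 :=
    fun x hx => by rw [(bump_support hr hr2 hx).deriv_eq, deriv_const]
  have hdd : ∀ x : ℝ, (x : Torus) ∉ arc (x₀ - r) (x₀ + r) →
      bump x₀ (r / 2) x - deriv (deriv (bump x₀ (r / 2))) x = 0 := fun x hx => by
    have h1 := bump_support hr hr2 hx
    rw [h1.eq_of_nhds, h1.deriv.deriv_eq]
    simp
  have hint : ∫ x in (0 : ℝ)..(2 * Real.pi),
      (bump x₀ (r / 2) x - deriv (deriv (bump x₀ (r / 2))) x)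
      = ∫ x in (0 : ℝ)..(2 * Real.pi), bump x₀ (r / 2) x := by
    rw [intervalIntegral.integral_sub (hφ.continuous.intervalIntegrable _ _)
      (hφ.deriv.deriv.continuous.intervalIntegrable _ _), integral_deriv_eq_zero hφ.deriv, sub_zero]
  have heq := hv.2.2 _ hφ t ht
  have hzero : ∀ τ ∈ Set.uIcc 0 t, ∫ x in (0 : ℝ)..(2 * Real.pi),
      ((v τ (x : Torus) + v τ (x : Torus) ^ 2 / 2) * deriv (bump x₀ (r / 2)) x +
        v τ (x : Torus) * deriv (fun y => (0 : ℝ) * deriv (bump x₀ (r / 2)) y) x) = 0 := by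
    intro τ hτ
    rw [Set.uIcc_of_le ht.1] at hτ
    have h1 := integral_mul_eq_of_support (F := fun y => v τ y + v τ y ^ 2 / 2)
      (c := C τ + C τ ^ 2 / 2) hφ.deriv hd (by
        filter_upwards [hC τ ⟨hτ.1, hτ.2.trans ht.2⟩] with y hy hym
        rw [hy hym])
    rw [integral_deriv_eq_zero hφ, mul_zero] at h1
    simpa using h1
  rw [intervalIntegral.integral_congr (g := fun _ => 0) hzero, intervalIntegral.integral_zero,
    add_zero, ← hv.2.1, integral_mul_eq_of_support (hφ.sub hφ.deriv.deriv) hdd (hC t ht),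
    integral_mul_eq_of_support (hφ.sub hφ.deriv.deriv) hdd (hC 0 h0T), hint] at heq
  exact mul_right_cancel₀ (integral_bump_pos x₀ (half_pos hr) (by linarith)).ne' heq

theorem exists_arc_subset {ω : Set Torus} (hω : IsOpen ω) (hne : ω.Nonempty) :
    ∃ x₀ r : ℝ, 0 < r ∧ r < Real.pi ∧ arc (x₀ - r) (x₀ + r) ⊆ ω := by
  obtain ⟨y, hy⟩ := hne
  induction y using QuotientAddGroup.induction_on with
  | H x₀ =>
    have hpre : IsOpen ((fun x : ℝ => (x : Torus)) ⁻¹' ω) :=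
      hω.preimage (AddCircle.continuous_mk' _)
    obtain ⟨ε, hε, hball⟩ := Metric.isOpen_iff.1 hpre x₀ hy
    refine ⟨x₀, min ε 1, lt_min hε one_pos, (min_le_right _ _).trans_lt
      (by linarith [Real.pi_gt_three]), ?_⟩
    rintro _ ⟨x, hx, rfl⟩
    refine hball ?_
    rw [Metric.mem_ball, Real.dist_eq, abs_lt]
    have := min_le_left ε 1
    exact ⟨by linarith [hx.1], by linarith [hx.2]⟩

/-! ### Asymptotics -/

theorem IsCurve.shift {s : ℝ} {α : ℤ → ℂ} {t T : ℝ} {x : ℝ → L2T} (ht : 0 ≤ t) (hT : 0 ≤ T)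
    (hx : IsCurve s α (t + T) x) : IsCurve s α T fun τ => x (t + τ) := by
  have hc : Continuous fun τ => field s α (x τ) := (continuous_field s α).comp hx.1
  refine ⟨hx.1.comp (by fun_prop), fun τ hτ => ?_⟩
  have h1 := hx.2 (t + τ) ⟨by linarith [hτ.1], by linarith [hτ.2]⟩
  have h2 := hx.2 t ⟨ht, by linarith⟩
  have h3 := intervalIntegral.integral_add_adjacent_intervals
    (hc.intervalIntegrable (μ := volume) 0 t) (hc.intervalIntegrable t (t + τ))
  have h4 := intervalIntegral.integral_comp_add_left (a := 0) (b := τ)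
    (fun τ => field s α (x τ)) t
  rw [add_zero] at h4
  simp only [add_zero]
  rw [h4, h1, ← h3, h2, add_assoc]

theorem IsCurve.smoothing {s : ℝ} (hs : 0 ≤ s) {a : ℝ → ℝ} (ha : SmoothPeriodic a) {T : ℝ}
    {x : ℝ → L2T} (hx : IsCurve s (pcoeff a) T x) :
    IsCurve 0 (pcoeff a) T fun t => smoothing s (x t) := by
  have hc : Continuous fun τ => field s (pcoeff a) (x τ) := (continuous_field s _).comp hx.1
  refine ⟨(BBM.smoothing s).continuous.comp hx.1, fun t ht => ?_⟩
  have h := (BBM.smoothing s).intervalIntegral_comp_comm (hc.intervalIntegrable (μ := volume) 0 t)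
  simp only [smoothing_field hs (herm_pcoeff ha) (rapidDecay_pcoeff ha)] at h
  rw [h, ← map_add, ← hx.2 t ht]

theorem exists_global_curve {a : ℝ → ℝ} (ha : SmoothPeriodic a) {u₀ : L2T} {u : ℝ → L2T}
    (hu : ∀ T : ℝ, 0 < T → IsSolution a 1 T u₀ u) :
    ∃ x : ℝ → L2T, (∀ T, IsCurve 1 (pcoeff a) T x) ∧ ∀ t, 0 ≤ t → u t = smoothing 1 (x t) := by
  choose! y hy hyu using fun T (hT : 0 < T) =>
    ((isSolution_iff zero_le_one ha hT.le).1 (hu T hT)).2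
  have hcons : ∀ {t T : ℝ}, t ∈ Set.Icc 0 T → y (t + 1) t = y (T + 1) t := by
    intro t T ht
    refine smoothing_injective zero_le_one ?_
    rw [← hyu (t + 1) (by linarith [ht.1]) t ⟨ht.1, by linarith⟩,
      ← hyu (T + 1) (by linarith [ht.1, ht.2]) t ⟨ht.1, by linarith [ht.2]⟩]
  have hloc : ∀ {t T : ℝ}, 0 ≤ T → t ≤ T → y (max t 0 + 1) (max t 0) = y (T + 1) (max t 0) :=
    fun h0 hT => hcons ⟨le_max_right _ _, max_le hT h0⟩
  have hxc : Continuous fun t : ℝ => y (max t 0 + 1) (max t 0) := by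
    rw [continuous_iff_continuousAt]
    intro t₀
    have hT : 0 ≤ |t₀| + 1 := by positivity
    have h1 : Continuous fun t : ℝ => y (|t₀| + 1 + 1) (max t 0) :=
      (hy _ (by positivity)).1.comp (by fun_prop)
    refine h1.continuousAt.congr ?_
    filter_upwards [Iio_mem_nhds (by linarith [le_abs_self t₀] : t₀ < |t₀| + 1)] with t ht
    exact (hloc hT (le_of_lt ht)).symm
  refine ⟨fun t => y (max t 0 + 1) (max t 0), fun T => ⟨hxc, fun t ht => ?_⟩, fun t ht => ?_⟩
  · have hT : 0 ≤ T := ht.1.trans ht.2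
    have h := (hy (T + 1) (by linarith)).2 t ⟨ht.1, by linarith [ht.2]⟩
    have e : ∀ τ ∈ Set.Icc 0 t, y (max τ 0 + 1) (max τ 0) = y (T + 1) τ := fun τ hτ => by
      rw [hloc hT (hτ.2.trans ht.2), max_eq_left hτ.1]
    simp only
    rw [e t ⟨ht.1, le_rfl⟩, e 0 ⟨le_rfl, ht.1⟩, h]
    congr 1
    refine intervalIntegral.integral_congr fun τ hτ => ?_
    rw [Set.uIcc_of_le ht.1] at hτ
    simp only [e τ hτ]
  · simp only [max_eq_left ht]
    exact hyu _ (by linarith) t ⟨ht, by linarith⟩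

theorem derivOp_ae_eq_zero {a : ℝ → ℝ} (ha : SmoothPeriodic a) (ha0 : ∀ x, 0 ≤ a x)
    {ω : Set Torus} (haω : ∀ x : ℝ, (x : Torus) ∈ ω → 0 < a x) {w : L2T}
    (hw : ⟪dampOp 1 (pcoeff a) w, w⟫_ℝ = 0) : ∀ᵐ y : Torus, y ∈ ω → derivOp w y = 0 := by
  have e := integral_torus fun y => ha.lift y * (derivOp w y * derivOp w y)
  simp only [SmoothPeriodic.lift_coe] at e
  rw [inner_dampOp ha, e] at hw
  have hint : Integrable fun y : Torus => ha.lift y * (derivOp w y * derivOp w y) := by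
    have := Integrable.mul_lift (integrable_sq_L2T (derivOp w)) ha
    refine this.congr (Eventually.of_forall fun y => ?_)
    simp only [sq]
    ring
  have hl : ∀ y, 0 ≤ ha.lift y := fun y => by
    induction y using QuotientAddGroup.induction_on with
    | H y => exact ha0 y
  have h0 := (integral_eq_zero_iff_of_nonneg
    (fun y => mul_nonneg (hl y) (mul_self_nonneg (derivOp w y))) hint).1 hw
  filter_upwards [h0] with y hy hyω
  have hpos : 0 < ha.lift y := by
    induction y using QuotientAddGroup.induction_on with
    | H y => exact haω y hyω
  simpa [hpos.ne'] using hy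

theorem dampOp_pcoeff_zero (x : L2T) : dampOp 1 (pcoeff fun _ => 0) x = 0 := by
  refine ext_coeff fun n => ?_
  rw [coeff_dampOp _ (herm_pcoeff .zero) (rapidDecay_pcoeff .zero)]
  have : coeff (0 : L2T) n = 0 := (coeffL n).map_zero
  simp [dampKer, pcoeff_zero, this]

/-- The convergence of the energy forces the dissipation over time intervals of unit length to
vanish in the limit. -/
theorem tendsto_dissipation {a : ℝ → ℝ} (ha : SmoothPeriodic a) (ha0 : ∀ x, 0 ≤ a x)
    {x : ℝ → L2T} (hx : ∀ T, IsCurve 1 (pcoeff a) T x) :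
    Tendsto (fun t => ∫ τ in (0 : ℝ)..1, ⟪dampOp 1 (pcoeff a) (x (t + τ)), x (t + τ)⟫_ℝ) atTop
      (𝓝 0) := by
  have hanti : Antitone fun t => ‖x (max t 0)‖ ^ 2 := fun t r htr =>
    (hx (max r 0)).norm_sq_antitone ha ha0 ⟨le_max_right _ _, max_le_max_right 0 htr⟩
      ⟨le_max_right _ _, le_rfl⟩ (max_le_max_right 0 htr)
  have hlim := tendsto_atTop_ciInf hanti ⟨0, by rintro _ ⟨t, rfl⟩; positivity⟩
  set ℓ := ⨅ t, ‖x (max t 0)‖ ^ 2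
  have h2 := (hlim.sub (hlim.comp (tendsto_atTop_add_const_right atTop 1 tendsto_id))).div_const 2
  rw [sub_self, zero_div] at h2
  refine h2.congr' ?_
  filter_upwards [eventually_ge_atTop 0] with t ht
  have h3 := ((hx (t + 1)).shift ht zero_le_one).norm_sq ⟨zero_le_one, le_rfl⟩
  simp only [add_zero] at h3
  simp only [Function.comp, id, max_eq_left ht, max_eq_left (by linarith : 0 ≤ t + 1)]
  linarith

theorem inner_dampOp_sq_le {a : ℝ → ℝ} (ha : SmoothPeriodic a) (ha0 : ∀ x, 0 ≤ a x) (x y : L2T) :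
    ⟪x, dampOp 1 (pcoeff a) y⟫_ℝ ^ 2
      ≤ ⟪dampOp 1 (pcoeff a) x, x⟫_ℝ * ⟪dampOp 1 (pcoeff a) y, y⟫_ℝ := by
  set A := dampOp 1 (pcoeff a) with hA
  have hsymm : ⟪A y, x⟫_ℝ = ⟪x, A y⟫_ℝ := real_inner_comm _ _
  have hxy : ⟪A x, y⟫_ℝ = ⟪x, A y⟫_ℝ := inner_dampOp_comm ha x y
  have h : ∀ r : ℝ, 0 ≤ ⟪A y, y⟫_ℝ * (r * r) + 2 * ⟪x, A y⟫_ℝ * r + ⟪A x, x⟫_ℝ := fun r => by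
    have h1 := inner_dampOp_nonneg ha ha0 (x + r • y)
    rw [← hA, map_add, map_smul, inner_add_left, inner_add_right, inner_add_right,
      real_inner_smul_left, real_inner_smul_right, real_inner_smul_left, real_inner_smul_right,
      hsymm, hxy] at h1
    linarith
  have := discrim_le_zero h
  rw [discrim] at this
  nlinarith

/-- Weak limits along the trajectory: if `x (tᵢ)` converges weakly to `z₀`, the damping
term vanishes along the solution started at `z₀`, and unique continuation makes `z₀` a constant. -/
theorem weak_limit_const {a : ℝ → ℝ} (ha : SmoothPeriodic a) (ha0 : ∀ x, 0 ≤ a x) {ω : Set Torus}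
    (hω : IsOpen ω) (hωne : ω.Nonempty) (haω : ∀ x : ℝ, (x : Torus) ∈ ω → 0 < a x) {δ : ℝ≥0∞}
    (hucp : UCPConst δ) {x : ℝ → L2T} (hx : ∀ T, IsCurve 1 (pcoeff a) T x)
    (hδ : sobNorm 1 (smoothing 1 (x 0)) < δ) {r : ℕ → ℝ} (hr0 : ∀ i, 0 ≤ r i)
    (hr : Tendsto r atTop atTop) {z₀ : L2T} (hz₀ : ‖z₀‖ ≤ ‖x 0‖)
    (hlim : ∀ n, Tendsto (fun i => coeff (x (r i)) n) atTop (𝓝 (coeff z₀ n))) :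
    ∃ C : ℝ, smoothing 1 z₀ = constFn C := by
  set A := dampOp 1 (pcoeff a) with hA
  have hxM : ∀ t, 0 ≤ t → ‖x t‖ ≤ ‖x 0‖ := fun t ht =>
    (hx t).norm_antitone ha ha0 ⟨le_rfl, ht⟩ ⟨ht, le_rfl⟩ ht
  obtain ⟨z, hz, hz0, hzM⟩ := exists_isCurve_one ha ha0 zero_le_one hz₀
  -- the translated trajectories converge to `z` in `L²`, uniformly on `[0, 1]`
  have hL2 : ∀ τ ∈ Set.Icc (0 : ℝ) 1,
      Tendsto (fun i => smoothing 1 (x (r i + τ)) - smoothing 1 (z τ)) atTop (𝓝 0) := by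
    intro τ hτ
    have hR : 0 ≤ ‖smoothing 1‖ * ‖x 0‖ := by positivity
    obtain ⟨K, hK⟩ := exists_lipschitz_field 0 (pcoeff a) hR
    have hz' := hz.smoothing zero_le_one ha
    have hS : ∀ {y : L2T}, ‖y‖ ≤ ‖x 0‖ → ‖smoothing 1 y‖ ≤ ‖smoothing 1‖ * ‖x 0‖ := fun h =>
      ((smoothing 1).le_opNorm _).trans (by gcongr)
    have hdist : ∀ i, ‖smoothing 1 (x (r i + τ)) - smoothing 1 (z τ)‖
        ≤ ‖smoothing 1 (x (r i) - z₀)‖ * Real.exp (K * 1) := fun i => by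
      have h1 := (((hx (r i + 1)).shift (hr0 i) zero_le_one).smoothing zero_le_one ha).dist_le hK
        hz' (fun t ht => hS (hxM _ (add_nonneg (hr0 i) ht.1))) (fun t ht => hS (hzM t ht)) hτ
      simpa only [add_zero, hz0, ← map_sub] using h1
    have h2 : Tendsto (fun i => ‖smoothing 1 (x (r i) - z₀)‖) atTop (𝓝 0) := by
      refine tendsto_norm_smoothing_one (M := ‖x 0‖ + ‖z₀‖) (Eventually.of_forall fun i => ?_)
        fun n => ?_
      · exact (norm_sub_le _ _).trans (by linarith [hxM (r i) (hr0 i)])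
      · simp only [coeff_sub]
        simpa using (hlim n).sub_const (coeff z₀ n)
    refine squeeze_zero_norm hdist ?_
    simpa using h2.mul_const (Real.exp (K * 1))
  have hcoeff : ∀ τ ∈ Set.Icc (0 : ℝ) 1, ∀ n,
      Tendsto (fun i => coeff (x (r i + τ)) n) atTop (𝓝 (coeff (z τ) n)) := by
    intro τ hτ n
    have h1 := (((coeffL n).continuous.tendsto 0).comp (hL2 τ hτ)).const_mul (wt 1 n : ℂ)
    simp only [Function.comp_def, coeffL_apply, coeff_sub, mul_sub,
      wt_mul_coeff_smoothing zero_le_one, map_zero, mul_zero] at h1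
    exact tendsto_sub_nhds_zero_iff.1 h1
  -- the dissipation vanishes in the limit, and controls `⟪x, A y⟫`
  have hAz : ∀ τ ∈ Set.Icc (0 : ℝ) 1, A (z τ) = 0 := by
    have hAy : ∀ y : L2T, ∀ τ ∈ Set.Icc (0 : ℝ) 1, ⟪z τ, A y⟫_ℝ = 0 := by
      intro y
      have hcz : Continuous fun τ => ⟪z τ, A y⟫_ℝ ^ 2 := (hz.1.inner continuous_const).pow 2
      have hcx : ∀ i, Continuous fun τ => ⟪x (r i + τ), A y⟫_ℝ ^ 2 := fun i =>
        (((hx 0).1.comp (by fun_prop)).inner continuous_const).pow 2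
      have h1 : Tendsto (fun i => ∫ τ in (0 : ℝ)..1, ⟪x (r i + τ), A y⟫_ℝ ^ 2) atTop
          (𝓝 (∫ τ in (0 : ℝ)..1, ⟪z τ, A y⟫_ℝ ^ 2)) := by
        refine intervalIntegral.tendsto_integral_filter_of_dominated_convergence
          (fun _ => (‖x 0‖ * ‖A y‖) ^ 2)
          (Eventually.of_forall fun i => (hcx i).aestronglyMeasurable)
          (Eventually.of_forall fun i => Eventually.of_forall fun τ hτ => ?_)
          intervalIntegrable_const (Eventually.of_forall fun τ hτ => ?_)
        · rw [Set.uIoc_of_le zero_le_one] at hτ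
          rw [norm_pow]
          gcongr
          refine (norm_inner_le_norm _ _).trans ?_
          gcongr
          exact hxM _ (add_nonneg (hr0 i) hτ.1.le)
        · rw [Set.uIoc_of_le zero_le_one] at hτ
          exact (tendsto_inner_of_coeff (M := ‖x 0‖)
            (Eventually.of_forall fun i => hxM _ (add_nonneg (hr0 i) hτ.1.le))
            (hcoeff τ ⟨hτ.1.le, hτ.2⟩) (A y)).pow 2
      have h2 := ((tendsto_dissipation ha ha0 hx).comp hr).mul_const ⟪A y, y⟫_ℝ
      rw [zero_mul] at h2
      have h3 : ∫ τ in (0 : ℝ)..1, ⟪z τ, A y⟫_ℝ ^ 2 ≤ 0 := by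
        refine le_of_tendsto_of_tendsto' h1 h2 fun i => ?_
        rw [Function.comp, ← intervalIntegral.integral_mul_const]
        have hc : Continuous fun τ => x (r i + τ) := (hx 0).1.comp (by fun_prop)
        exact intervalIntegral.integral_mono_on zero_le_one ((hcx i).intervalIntegrable _ _)
          (((continuous_inner_dampOp _ hc).mul continuous_const).intervalIntegrable _ _)
          fun τ _ => inner_dampOp_sq_le ha ha0 _ _
      intro τ hτ
      by_contra hne
      have h4 := intervalIntegral.integral_pos zero_lt_one hcz.continuousOn
        (fun _ _ => sq_nonneg _) ⟨τ, hτ, by positivity⟩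
      linarith
    intro τ hτ
    rw [← inner_self_eq_zero (𝕜 := ℝ), inner_dampOp_comm ha]
    exact hAy _ τ hτ
  -- hence the limit trajectory solves the undamped equation
  have hz00 : IsCurve 1 (pcoeff fun _ => 0) 1 z := by
    refine ⟨hz.1, fun t ht => (hz.2 t ht).trans ?_⟩
    congr 1
    refine intervalIntegral.integral_congr fun τ hτ => ?_
    rw [Set.uIcc_of_le ht.1] at hτ
    simp only [field]
    rw [dampOp_pcoeff_zero, ← hA, hAz τ ⟨hτ.1, hτ.2.trans ht.2⟩]
  have hsol : IsSolution (fun _ => 0) 1 1 (smoothing 1 z₀) fun t => smoothing 1 (z t) :=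
    (isSolution_iff zero_le_one .zero zero_le_one).2
      ⟨by simp only [hz0], z, hz00, fun _ _ => rfl⟩
  obtain ⟨y₀, ρ, hρ, hρπ, harc⟩ := exists_arc_subset hω hωne
  choose! C hC using fun τ (hτ : τ ∈ Set.Icc (0 : ℝ) 1) =>
    exists_const_of_deriv_eq_zero (x := z τ) (α := y₀ - ρ) (β := y₀ + ρ) (by linarith) (by
      have h1 := derivOp_ae_eq_zero ha ha0 haω (w := z τ) (by
        rw [← hA, hAz τ hτ, inner_zero_left])
      filter_upwards [h1] with y hy hym
      exact hy (harc hym))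
  refine ⟨C 0, hucp _ (memSob_smoothing zero_le_one _) ?_ (arc (y₀ - ρ) (y₀ + ρ)) 1 (C 0)
    (fun t => smoothing 1 (z t)) (isOpen_arc _ _) ⟨_, y₀, ⟨by linarith, by linarith⟩, rfl⟩
    zero_lt_one hsol fun t ht => ?_⟩
  · refine lt_of_le_of_lt ?_ hδ
    rw [sobNorm_smoothing zero_le_one, sobNorm_smoothing zero_le_one]
    exact ENNReal.ofReal_le_ofReal (mul_le_mul_of_nonneg_left hz₀ nrm_pos.le)
  · have htI : t ∈ Set.Icc (0 : ℝ) 1 := ⟨ht.1.le, ht.2.le⟩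
    rw [← const_in_time hρ hρπ hsol hC htI]
    exact hC t htI

/-- Every Fourier coefficient of the trajectory converges to that of the mean value. -/
theorem tendsto_coeff_trajectory {a : ℝ → ℝ} (ha : SmoothPeriodic a) (ha0 : ∀ x, 0 ≤ a x)
    {ω : Set Torus} (hω : IsOpen ω) (hωne : ω.Nonempty)
    (haω : ∀ x : ℝ, (x : Torus) ∈ ω → 0 < a x) {δ : ℝ≥0∞} (hucp : UCPConst δ) {x : ℝ → L2T}
    (hx : ∀ T, IsCurve 1 (pcoeff a) T x) (hδ : sobNorm 1 (smoothing 1 (x 0)) < δ) (n : ℤ) :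
    Tendsto (fun t => coeff (x t) n) atTop
      (𝓝 (coeff (constFn (mean (smoothing 1 (x 0)))) n)) := by
  refine tendsto_of_subseq_tendsto fun r hr => ?_
  -- discard the finitely many negative times
  obtain ⟨N, hN⟩ := eventually_atTop.1 (hr.eventually_ge_atTop 0)
  have hr0 : ∀ i, 0 ≤ r (i + N) := fun i => hN _ (by omega)
  obtain ⟨z₀, φ, hφ, hz₀, hlim⟩ := exists_subseq_tendsto_coeff (y := fun i => x (r (i + N)))
    (M := ‖x 0‖) fun i => (hx _).norm_antitone ha ha0 ⟨le_rfl, hr0 i⟩ ⟨hr0 i, le_rfl⟩ (hr0 i)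
  have hrφ : Tendsto (fun i => r (φ i + N)) atTop atTop :=
    hr.comp ((tendsto_add_atTop_nat N).comp hφ.tendsto_atTop)
  obtain ⟨C, hC⟩ := weak_limit_const ha ha0 hω hωne haω hucp hx hδ (fun i => hr0 (φ i)) hrφ hz₀ hlim
  have hz : z₀ = constFn C := smoothing_injective zero_le_one (by
    rw [hC, smoothing_constFn zero_le_one])
  have hmean : C = mean (smoothing 1 (x 0)) := by
    have h1 : coeff z₀ 0 = coeff (x 0) 0 := by
      refine tendsto_nhds_unique (hlim 0) ?_
      refine tendsto_const_nhds.congr fun i => ?_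
      exact ((hx _).coeff_zero zero_le_one ha ⟨hr0 (φ i), le_rfl⟩).symm
    rw [hz, coeff_constFn, if_pos rfl, ← wt_mul_coeff_smoothing zero_le_one,
      coeff_zero_eq_mean] at h1
    have h2 : wt 1 0 = 1 := by simp [wt, jap]
    rw [h2, Complex.ofReal_one, one_mul, Complex.ofReal_inj] at h1
    exact h1
  refine ⟨fun i => φ i + N, ?_⟩
  rw [← hmean, ← hz]
  exact hlim n

theorem sobInner_smoothing_one (x y : L2T) :
    sobInner 1 (smoothing 1 x) (smoothing 1 y) = (2 * Real.pi)⁻¹ * ⟪x, y⟫_ℝ := by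
  rw [sobInner, ← (hasSum_inner x y).tsum_eq]
  congr 1; ext n
  rw [Real.rpow_one, ← wt_mul_coeff_smoothing zero_le_one x n,
    ← wt_mul_coeff_smoothing zero_le_one y n, map_mul, Complex.conj_ofReal]
  have : (wt 1 n : ℂ) * coeff (smoothing 1 x) n * (wt 1 n * conj (coeff (smoothing 1 y) n))
      = ((wt 1 n ^ 2 : ℝ) : ℂ) * (coeff (smoothing 1 x) n * conj (coeff (smoothing 1 y) n)) := by
    push_cast; ring
  rw [this, Complex.re_ofReal_mul, wt_one_sq]
  rfl

theorem asymptotics {a : ℝ → ℝ} (ha : SmoothPeriodic a) (ha0 : ∀ x, 0 ≤ a x)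
    {ω : Set Torus} (hω : IsOpen ω) (hωne : ω.Nonempty)
    (haω : ∀ x : ℝ, (x : Torus) ∈ ω → 0 < a x) {δ : ℝ≥0∞} (hucp : UCPConst δ) {u₀ : L2T}
    {u : ℝ → L2T} (hδ : sobNorm 1 u₀ < δ) (hu : ∀ T : ℝ, 0 < T → IsSolution a 1 T u₀ u) :
    TendstoWeakH1 u (constFn (mean u₀)) ∧
      ∀ s : ℝ, s < 1 → Tendsto (fun t => sobNorm s (u t - constFn (mean u₀))) atTop (𝓝 0) := by
  obtain ⟨x, hx, hux⟩ := exists_global_curve ha hu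
  have hu0 : u₀ = smoothing 1 (x 0) := by rw [← (hu 1 one_pos).2.1, hux 0 le_rfl]
  have hc := tendsto_coeff_trajectory ha ha0 hω hωne haω hucp hx (by rwa [← hu0])
  rw [← hu0] at hc
  have hM : ∀ᶠ t in atTop, ‖x t‖ ≤ ‖x 0‖ := by
    filter_upwards [eventually_ge_atTop 0] with t ht
    exact (hx t).norm_antitone ha ha0 ⟨le_rfl, ht⟩ ⟨ht, le_rfl⟩ ht
  refine ⟨fun g hg => ?_, fun s hs => ?_⟩
  · obtain ⟨y, rfl⟩ := exists_smoothing_eq zero_le_one hg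
    have h := (tendsto_inner_of_coeff hM hc y).const_mul (2 * Real.pi)⁻¹
    rw [← smoothing_constFn zero_le_one, sobInner_smoothing_one]
    refine h.congr' ?_
    filter_upwards [eventually_ge_atTop 0] with t ht
    rw [hux t ht, sobInner_smoothing_one]
  · have h := tendsto_sobNorm_smoothing_one (y := fun t => x t - constFn (mean u₀))
      (M := ‖x 0‖ + ‖constFn (mean u₀)‖)
      (hM.mono fun t ht => (norm_sub_le _ _).trans (by linarith)) (fun n => by
        simp only [coeff_sub]
        simpa using (hc n).sub_const (coeff (constFn (mean u₀)) n)) hs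
    refine h.congr' ?_
    filter_upwards [eventually_ge_atTop 0] with t ht
    rw [hux t ht, map_sub, smoothing_constFn zero_le_one]

end

end BBM

theorem mainTheorem2 (a : ℝ → ℝ) (ha : BBM.SmoothPeriodic a) (ha0 : ∀ x, 0 ≤ a x)
    (ω : Set BBM.Torus) (hω : IsOpen ω) (hωne : ω.Nonempty)
    (haω : ∀ x : ℝ, (x : BBM.Torus) ∈ ω → 0 < a x) :
    -- local well-posedness in every `H^s`, `s ≥ 0`
    (∀ s : ℝ, 0 ≤ s → ∀ ρ : ℝ≥0, ∃ T : ℝ, 0 < T ∧ BBM.WellPosedOnBall a s ρ T) ∧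
    -- for `s = 1` the time `T` is arbitrary
    (∀ (ρ : ℝ≥0) (T : ℝ), 0 < T → BBM.WellPosedOnBall a 1 ρ T) ∧
    (∀ u₀ : BBM.L2T, BBM.MemSob 1 u₀ → ∃ u : ℝ → BBM.L2T, ∀ T : ℝ, 0 < T →
      BBM.IsSolution a 1 T u₀ u) ∧
    -- monotonicity of the energy and the dissipation identity
    (∀ (u₀ : BBM.L2T) (T : ℝ) (u : ℝ → BBM.L2T), BBM.MemSob 1 u₀ → 0 < T →
      BBM.IsSolution a 1 T u₀ u →
      AntitoneOn (fun t => BBM.sobNorm 1 (u t - BBM.constFn (BBM.mean u₀))) (Set.Icc 0 T) ∧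
      AntitoneOn (fun t => BBM.sobNorm 1 (u t)) (Set.Icc 0 T) ∧
      ∃ ux : ℝ → BBM.L2T,
        (∀ t ∈ Set.Icc 0 T, BBM.IsWeakDeriv (u t) (ux t)) ∧
        IntervalIntegrable
          (fun t => ∫ x in (0 : ℝ)..(2 * Real.pi), a x * ux t (x : BBM.Torus) ^ 2) volume 0 T ∧
        ∀ t ∈ Set.Icc 0 T,
          (1 / 2) * (BBM.sobNorm 1 (u t)).toReal ^ 2 - (1 / 2) * (BBM.sobNorm 1 u₀).toReal ^ 2 +
            (2 * Real.pi)⁻¹ * (∫ τ in (0 : ℝ)..t, ∫ x in (0 : ℝ)..(2 * Real.pi),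
              a x * ux τ (x : BBM.Torus) ^ 2) = 0) ∧
    -- convergence to the mean, conditional on unique continuation
    (∀ δ : ℝ≥0∞, BBM.UCPConst δ → ∀ (u₀ : BBM.L2T) (u : ℝ → BBM.L2T),
      BBM.MemSob 1 u₀ → BBM.sobNorm 1 u₀ < δ →
      (∀ T : ℝ, 0 < T → BBM.IsSolution a 1 T u₀ u) →
      BBM.TendstoWeakH1 u (BBM.constFn (BBM.mean u₀)) ∧
      ∀ s : ℝ, s < 1 →
        Tendsto (fun t => BBM.sobNorm s (u t - BBM.constFn (BBM.mean u₀))) atTop (𝓝 0)) := by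
  refine ⟨fun s hs ρ => BBM.exists_wellPosedOnBall hs ha ρ,
    fun ρ T hT => BBM.wellPosedOnBall_one ha ha0 ρ hT.le,
    fun u₀ hu₀ => BBM.exists_global_solution ha ha0 hu₀,
    fun u₀ T u _ hT hu => BBM.dissipation ha ha0 hT hu _,
    fun δ hucp u₀ u _ hδ hu => BBM.asymptotics ha ha0 hω hωne haω hucp hδ hu⟩
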